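/- For each $n\ge 1$ let $p_n\ge 1$ be an integer, with $p_n/n\to\tau\in[0,1)$, and consider the linear model $\boldsymbol Y=X\boldsymbol\beta+\boldsymbol\epsilon$, where the $n$ rows of $X\in\mathbb R^{n\times p_n}$ are i.i.d. $N(\mathbf 0,\Sigma)$, $\boldsymbol\epsilon\sim N(\mathbf 0,\sigma_\epsilon^2\mathbf I_n)$ is independent of $X$, and $\Sigma=\Sigma_n$ and $\sigma_\epsilon^2=\sigma_{\epsilon,n}^2>0$ may depend on $n$. Assume that $\sigma_\epsilon^2=O(n)$, that all eigenvalues of all $\Sigma_n$ lie strictly between two positive constants independent of $n$, and that the vectors $\boldsymbol\beta_0=\boldsymbol\beta_{0,n}\in\mathbb R^{p_n}$ satisfy $\|\boldsymbol\beta_0\|_\infty\le C$ for a constant $C\in(0,\infty)$ independent of $n$. Let $x_1=4(1+\sqrt\tau)^2\|\Sigma\|_2$ and $x_2=(1-\sqrt\tau)^2/(4\|\Sigma^{-1}\|_2)$, with $\|\cdot\|_2$ the spectral norm, let $K$ be the event that $X^TX$ is invertible, $\|(X^TX/n)^{-1}\|_2<x_2^{-1}$ and $\|X^TX/n\|_2<x_1$,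 and put $$\zeta_n^2=4\sigma_\epsilon^2\,\boldsymbol\beta_0^T\mathrm E\{(X^TX)^{-1}\mathbf 1_K\}\boldsymbol\beta_0+2\sigma_\epsilon^4\,\mathrm E\,[\mathrm{tr}\{(X^TX)^{-2}\}\mathbf 1_K]+\frac{2\sigma_\epsilon^4\,\big(\mathrm E[\mathrm{tr}\{(X^TX)^{-1}\}\mathbf 1_K]\big)^2}{n-p_n}.$$ For a constant $c>1$ let $$\mathcal G_{\boldsymbol\beta_0}(c)=\Big\{\boldsymbol\beta\in\mathbb R^{p_n}:\ \|\boldsymbol\beta\|_\infty\le C,\ \|\boldsymbol\beta\|_2\le c\big(\|\boldsymbol\beta_0\|_2+\sigma_\epsilon\sqrt{p_n}/\sqrt n\big)\Big\}.$$ Then, as $n\to\infty$, $$\inf_T\ \sup_{\boldsymbol\beta\in\mathcal G_{\boldsymbol\beta_0}(c)}\mathrm E_{\boldsymbol\beta}\big(T-\|\boldsymbol\beta\|_2^2\big)^2=\Omega(\zeta_n^2),$$ where the infimum is over all measurable functions $T=T(\boldsymbol Y,X)$, $\mathrm E_{\boldsymbol\beta}$ is the expectation under the model with parameters $(\boldsymbol\beta,\sigma_\epsilon^2,\Sigma)$,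 and $a_n=\Omega(b_n)$ means $a_n=O(b_n)$ and $b_n=O(a_n)$. Moreover, the bias-corrected estimator $$\widehat{\|\boldsymbol\beta\|_2^2}=\|\widehat{\boldsymbol\beta}\|_2^2-\mathrm{tr}\{(X^TX)^{-1}\}\,\frac{\|\boldsymbol Y-X\widehat{\boldsymbol\beta}\|_2^2}{n-p_n},\qquad \widehat{\boldsymbol\beta}=(X^TX)^{-1}X^T\boldsymbol Y,$$ attains this rate: $\sup_{\boldsymbol\beta\in\mathcal G_{\boldsymbol\beta_0}(c)}\mathrm E_{\boldsymbol\beta}\big(\widehat{\|\boldsymbol\beta\|_2^2}-\|\boldsymbol\beta\|_2^2\big)^2=\Omega(\zeta_n^2)$. -/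

import Mathlib

open Filter MeasureTheory ProbabilityTheory
open scoped ENNReal Matrix Topology

namespace QuadReg

/-- The design: the `n` rows `X₁, …, Xₙ ∈ ℝᵖ`. -/
abbrev Design (n p : ℕ) : Type := Fin n → EuclideanSpace ℝ (Fin p)

/-- The observed data `(Y, X)`. -/
abbrev Data (n p : ℕ) : Type := (Fin n → ℝ) × Design n p

/-- The `n × p` design matrix `X`, whose `i`-th row is `Xᵢ`. -/
def designMatrix {n p : ℕ} (X : Design n p) : Matrix (Fin n) (Fin p) ℝ :=
  Matrix.of fun i j => X i j

/-- The matrix `Xᵀ X`. -/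
def gram {n p : ℕ} (X : Design n p) : Matrix (Fin p) (Fin p) ℝ :=
  (designMatrix X)ᵀ * designMatrix X

/-- The spectral norm `‖A‖₂`, the operator norm of `A` on Euclidean space. -/
noncomputable def specNorm {m : ℕ} (A : Matrix (Fin m) (Fin m) ℝ) : ℝ :=
  ‖Matrix.toEuclideanCLM (n := Fin m) (𝕜 := ℝ) A‖

/-- The law of the design: `X₁, …, Xₙ` are i.i.d. `N(0, S)`. -/
noncomputable def designLaw (n : ℕ) {p : ℕ} (S : Matrix (Fin p) (Fin p) ℝ) :
    Measure (Design n p) :=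
  Measure.pi fun _ => multivariateGaussian 0 S

/-- The law `N(0, σ² Iₙ)` of the error vector. -/
noncomputable def errorLaw (n : ℕ) (σ : ℝ) : Measure (Fin n → ℝ) :=
  Measure.pi fun _ => gaussianReal 0 (Real.toNNReal (σ ^ 2))

/-- The law of `(Y, X)` with `Y = X β + ε`, where `X` has i.i.d. `N(0, S)` rows and
`ε ∼ N(0, σ² Iₙ)` is independent of `X`. -/
noncomputable def dataLaw (n : ℕ) {p : ℕ} (S : Matrix (Fin p) (Fin p) ℝ) (σ : ℝ)
    (β : EuclideanSpace ℝ (Fin p)) : Measure (Data n p) :=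
  ((designLaw n S).prod (errorLaw n σ)).map
    fun q => (designMatrix q.1 *ᵥ (fun j => β j) + q.2, q.1)

/-- The quadratic risk `E (T - ‖β‖₂²)²` of an estimator `T` of `‖β‖₂²`, under the law of the data
with parameters `(β, σ², S)`; it takes the value `∞` where the expectation is infinite. -/
noncomputable def risk {n p : ℕ} (S : Matrix (Fin p) (Fin p) ℝ) (σ : ℝ) (T : Data n p → ℝ)
    (β : EuclideanSpace ℝ (Fin p)) : ℝ≥0∞ :=
  ∫⁻ d, ENNReal.ofReal ((T d - ‖β‖ ^ 2) ^ 2) ∂(dataLaw n S σ β)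

/-- The class of all `β ∈ ℝᵖ` with `‖β‖_∞ ≤ C` and `‖β‖₂ ≤ c (‖β₀‖₂ + σ √p / √n)`. -/
def paramClass (n : ℕ) {p : ℕ} (C c σ : ℝ) (β₀ : EuclideanSpace ℝ (Fin p)) :
    Set (EuclideanSpace ℝ (Fin p)) :=
  {β | (∀ j, |β j| ≤ C) ∧ ‖β‖ ≤ c * (‖β₀‖ + σ * √(p : ℝ) / √(n : ℝ))}

/-- The largest risk of `T` over a set `G` of parameters. -/
noncomputable def supRisk {n p : ℕ} (S : Matrix (Fin p) (Fin p) ℝ) (σ : ℝ)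
    (G : Set (EuclideanSpace ℝ (Fin p))) (T : Data n p → ℝ) : ℝ≥0∞ :=
  ⨆ β ∈ G, risk S σ T β

/-- The minimax risk over `G`: the infimum runs over all (measurable) estimators. -/
noncomputable def minimaxRisk (n : ℕ) {p : ℕ} (S : Matrix (Fin p) (Fin p) ℝ) (σ : ℝ)
    (G : Set (EuclideanSpace ℝ (Fin p))) : ℝ≥0∞ :=
  ⨅ (T : Data n p → ℝ) (_ : Measurable T), supRisk S σ G T

/-- The ordinary least squares estimator `(XᵀX)⁻¹ Xᵀ Y`. -/
noncomputable def ols {n p : ℕ} (d : Data n p) : Fin p → ℝ :=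
  (gram d.2)⁻¹ *ᵥ ((designMatrix d.2)ᵀ *ᵥ d.1)

/-- The estimated error variance `‖Y - X ols‖₂² / (n - p)`. -/
noncomputable def sigmaSqHat {n p : ℕ} (d : Data n p) : ℝ :=
  (∑ i, (d.1 i - (designMatrix d.2 *ᵥ ols d) i) ^ 2) / ((n : ℝ) - (p : ℝ))

/-- The bias-corrected estimator `‖ols‖₂² - tr((XᵀX)⁻¹) sigmaSqHat`. -/
noncomputable def biasCorrected {n p : ℕ} (d : Data n p) : ℝ :=
  (∑ j, ols d j ^ 2) - ((gram d.2)⁻¹).trace * sigmaSqHat d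

/-- The truncation level `x₁ = 4 (1 + √τ)² ‖S‖₂`. -/
noncomputable def upperLevel {p : ℕ} (τ : ℝ) (S : Matrix (Fin p) (Fin p) ℝ) : ℝ :=
  4 * (1 + √τ) ^ 2 * specNorm S

/-- The truncation level `x₂ = (1 - √τ)² / (4 ‖S⁻¹‖₂)`. -/
noncomputable def lowerLevel {p : ℕ} (τ : ℝ) (S : Matrix (Fin p) (Fin p) ℝ) : ℝ :=
  (1 - √τ) ^ 2 / (4 * specNorm S⁻¹)

/-- The event `K`: `XᵀX / n` is invertible, `‖(XᵀX / n)⁻¹‖₂ < x₂⁻¹` and `‖XᵀX / n‖₂ < x₁`. -/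
def eventK (n : ℕ) {p : ℕ} (τ : ℝ) (S : Matrix (Fin p) (Fin p) ℝ) : Set (Design n p) :=
  {X | IsUnit (((n : ℝ)⁻¹ • gram X).det) ∧
    specNorm (((n : ℝ)⁻¹ • gram X)⁻¹) < (lowerLevel τ S)⁻¹ ∧
    specNorm ((n : ℝ)⁻¹ • gram X) < upperLevel τ S}

/-- The quantity
`ζ² = 4 σ² β₀ᵀ E[(XᵀX)⁻¹ 1_K] β₀ + 2 σ⁴ E[tr((XᵀX)⁻²) 1_K] + 2 σ⁴ (E[tr((XᵀX)⁻¹) 1_K])² / (n - p)`.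
All integrands are bounded; in the first term `β₀` stands inside the expectation. -/
noncomputable def zetaSq (n : ℕ) {p : ℕ} (τ : ℝ) (S : Matrix (Fin p) (Fin p) ℝ) (σ : ℝ)
    (β₀ : EuclideanSpace ℝ (Fin p)) : ℝ :=
  4 * σ ^ 2 * (∫ X in eventK n τ S,
      (fun j => β₀ j) ⬝ᵥ ((gram X)⁻¹ *ᵥ (fun j => β₀ j)) ∂(designLaw n S))
    + 2 * σ ^ 4 * (∫ X in eventK n τ S, ((gram X)⁻¹ ^ 2).trace ∂(designLaw n S))
    + 2 * σ ^ 4 * (∫ X in eventK n τ S, ((gram X)⁻¹).trace ∂(designLaw n S)) ^ 2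
        / ((n : ℝ) - (p : ℝ))

/-- All eigenvalues of all the matrices `S n` lie strictly between two positive constants. -/
def EigenvaluesBounded (p : ℕ → ℕ) (S : ∀ n, Matrix (Fin (p n)) (Fin (p n)) ℝ) : Prop :=
  ∃ a b : ℝ, 0 < a ∧ ∀ n, ∃ h : (S n).IsHermitian, ∀ i, a < h.eigenvalues i ∧ h.eigenvalues i < b

/-- `R` is of exact order `z`: up to positive constant factors, each bounds the other for all
large `n` (so `R n` is finite for all large `n`). -/
def HasExactOrder (R : ℕ → ℝ≥0∞) (z : ℕ → ℝ) : Prop :=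
  ∃ k₁ k₂ : ℝ, 0 < k₁ ∧ 0 < k₂ ∧
    ∀ᶠ n in atTop, ENNReal.ofReal (k₁ * z n) ≤ R n ∧ R n ≤ ENNReal.ofReal (k₂ * z n)

end QuadReg

/-! All quantities of the theorem are compared with one deterministic rate, σ²‖β₀‖²/n + σ⁴p/n²
(`rate`).

Upper bound. When XᵀX is invertible, the error of the bias-corrected estimator is a linear form in ε
plus a quadratic form in ε with a symmetric matrix of trace zero (`biasCorrected_eq`,
`biasQuad_trace`). Its conditional second moment is therefore at most a constant times σ² βᵀ(XᵀX)⁻¹β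
+ σ⁴ tr (XᵀX)⁻² (`lintegral_biasCorrected_le`). The mean over the design is taken without
restriction to K, so genuine inverse Wishart moments are needed. They come from Stein's identity for
the regularized inverse (ZᵀZ + δ)⁻¹, where every integrand is bounded (`stein_resolv`), followed by
δ → 0 and Fatou's lemma (`lintegral_inv_le_of_resolv`). On the parameter class ‖β‖² is of order
‖β₀‖² + σ²p/n, and the second summand only adds a multiple of σ⁴p/n².

Lower bound. A point is tested against a finite mixture of parameters with a common norm. If the
chi-square moment of the mixture is at most M, the sum of the two mean risks is at least the squared
separation divided by 1 + M (`ofReal_le_lintegral_add_mixture`). The pair β₀ and (1 - η)β₀ yields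
σ²‖β₀‖²/n (`ofReal_le_supRisk_scaling`). The origin against all sign vectors of one amplitude yields
σ⁴p/n² (`ofReal_le_supRisk_signs`). Both chi-square moments are bounded on K, where ‖XᵀX‖ is at most
a constant times n, and it is enough that K has probability at least one half.

Probability of K. After whitening, this asks for the extreme singular values of an n × p standard
Gaussian matrix to be asymptotically within √n (1 ± √τ). This follows from Gordon's comparison
inequality (`gordon_comparison`), proved by Gaussian interpolation (`integral_comp_mulVec_le`).

Comparison with ζ². On K the eigenvalues of XᵀX/n lie between positive constants, so each truncated
expectation in ζ² can be estimated directly (`zetaSq_bounds`). -/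

namespace QuadReg

/-! ### Gaussian integration by parts and translations -/

/-- The law of independent standard Gaussian coordinates. -/
noncomputable abbrev stdPi (I : Type*) [Fintype I] : Measure (I → ℝ) :=
  Measure.pi fun _ : I => gaussianReal 0 1

theorem gaussianPDFReal_std (x : ℝ) :
    gaussianPDFReal 0 1 x = (√(2 * Real.pi))⁻¹ * Real.exp (-x ^ 2 / 2) := by
  simp [gaussianPDFReal]

theorem hasDerivAt_gaussianPDFReal_std (x : ℝ) :
    HasDerivAt (gaussianPDFReal 0 1) (-x * gaussianPDFReal 0 1 x) x := by
  have h : gaussianPDFReal 0 1 = fun x : ℝ => (√(2 * Real.pi))⁻¹ * Real.exp (-x ^ 2 / 2) := by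
    ext x; exact gaussianPDFReal_std x
  rw [h]
  have h1 : HasDerivAt (fun x : ℝ => -x ^ 2 / 2) (-x) x := by
    have := ((hasDerivAt_pow 2 x).neg.div_const 2)
    refine this.congr_deriv ?_
    push_cast; ring
  refine (h1.exp.const_mul (√(2 * Real.pi))⁻¹).congr_deriv ?_
  ring

theorem integrable_gaussianReal_std_iff {F : ℝ → ℝ} :
    Integrable F (gaussianReal 0 1) ↔ Integrable (fun x => gaussianPDFReal 0 1 x * F x) := by
  rw [gaussianReal_of_var_ne_zero _ one_ne_zero,
    integrable_withDensity_iff_integrable_smul' (measurable_gaussianPDF 0 1)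
      (ae_of_all _ fun x => gaussianPDF_lt_top)]
  simp [toReal_gaussianPDF]

/-- Gaussian integration by parts on the line. -/
theorem integral_id_mul_gaussianReal {F F' : ℝ → ℝ} (hF : ∀ x, HasDerivAt F (F' x) x)
    (h0 : Integrable F (gaussianReal 0 1)) (h1 : Integrable (fun x => x * F x) (gaussianReal 0 1))
    (h2 : Integrable F' (gaussianReal 0 1)) :
    ∫ x, x * F x ∂(gaussianReal 0 1) = ∫ x, F' x ∂(gaussianReal 0 1) := by
  rw [integrable_gaussianReal_std_iff] at h0 h1 h2
  rw [integral_gaussianReal_eq_integral_smul one_ne_zero,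
    integral_gaussianReal_eq_integral_smul one_ne_zero]
  have := integral_mul_deriv_eq_deriv_mul_of_integrable (u := gaussianPDFReal 0 1) (v := F)
    (u' := fun x => -x * gaussianPDFReal 0 1 x) (v' := F')
    (fun x _ => hasDerivAt_gaussianPDFReal_std x) (fun x _ => hF x) h2
    (by refine (h1.neg).congr (ae_of_all _ fun x => ?_); simp; ring) h0
  simp only [smul_eq_mul]
  rw [this, ← integral_neg]
  congr 1; ext x; ring

section Pi

variable {I : Type*} [Fintype I] [DecidableEq I]

/-- Redrawing one coordinate independently does not change a product law. With Fubini's theorem this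
reduces integration by parts in one coordinate to the real line. -/
theorem measurePreserving_update_pi {X : Type*} [MeasurableSpace X] (ν : Measure X)
    [IsProbabilityMeasure ν] (i : I) :
    MeasurePreserving (fun q : (I → X) × X => Function.update q.1 i q.2)
      ((Measure.pi fun _ : I => ν).prod ν) (Measure.pi fun _ : I => ν) := by
  have hm : Measurable (fun q : (I → X) × X => Function.update q.1 i q.2) := by
    rw [measurable_pi_iff]
    intro j
    by_cases h : j = i
    · subst h; simpa using measurable_snd
    · simpa [h, Function.comp_def] using (measurable_pi_apply j).comp measurable_fst
  refine ⟨hm, ?_⟩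
  symm
  refine Measure.pi_eq fun s hs => ?_
  rw [Measure.map_apply hm (MeasurableSet.univ_pi hs)]
  have : (fun q : (I → X) × X => Function.update q.1 i q.2) ⁻¹' (Set.univ.pi s)
      = (Set.univ.pi (Function.update s i Set.univ)) ×ˢ (s i) := by
    ext q
    simp only [Set.mem_preimage, Set.mem_pi, Set.mem_univ, true_implies, Set.mem_prod]
    constructor
    · intro h
      refine ⟨fun j => ?_, by simpa using h i⟩
      by_cases hj : j = i
      · subst hj; simp
      · simpa [hj] using h j
    · rintro ⟨h1, h2⟩ j
      by_cases hj : j = i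
      · subst hj; simpa using h2
      · simpa [hj] using h1 j
  rw [this, Measure.prod_prod, Measure.pi_pi, ← Finset.prod_erase_mul _ _ (Finset.mem_univ i),
    ← Finset.prod_erase_mul (a := i) (f := fun i => ν (s i)) _ (Finset.mem_univ i)]
  simp only [Function.update_self, measure_univ, mul_one]
  congr 1
  exact Finset.prod_congr rfl fun j hj => by simp [Finset.ne_of_mem_erase hj]

/-- Gaussian integration by parts in the `i`-th coordinate. -/
theorem integral_coord_mul_stdPi {F F' : (I → ℝ) → ℝ} (i : I)
    (hF : ∀ x, HasDerivAt (fun t => F (Function.update x i t)) (F' x) (x i))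
    (h0 : Integrable F (stdPi I)) (h1 : Integrable (fun x => x i * F x) (stdPi I))
    (h2 : Integrable F' (stdPi I)) :
    ∫ x, x i * F x ∂(stdPi I) = ∫ x, F' x ∂(stdPi I) := by
  have hmp := measurePreserving_update_pi (gaussianReal 0 1) i
  have key : ∀ G : (I → ℝ) → ℝ, Integrable G (stdPi I) →
      Integrable (fun q : (I → ℝ) × ℝ => G (Function.update q.1 i q.2))
        ((stdPi I).prod (gaussianReal 0 1)) ∧
      ∫ x, G x ∂(stdPi I)
        = ∫ x, ∫ t, G (Function.update x i t) ∂(gaussianReal 0 1) ∂(stdPi I) := by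
    intro G hG
    have hi : Integrable (fun q : (I → ℝ) × ℝ => G (Function.update q.1 i q.2))
        ((stdPi I).prod (gaussianReal 0 1)) := hmp.integrable_comp_of_integrable hG
    refine ⟨hi, ?_⟩
    rw [stdPi, ← hmp.map_eq, integral_map hmp.measurable.aemeasurable
      (by rw [hmp.map_eq]; exact hG.aestronglyMeasurable), hmp.map_eq, integral_prod _ hi]
  obtain ⟨k0, -⟩ := key _ h0
  obtain ⟨k1, e1⟩ := key _ h1
  obtain ⟨k2, e2⟩ := key _ h2
  rw [e1, e2]
  refine integral_congr_ae ?_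
  filter_upwards [k0.prod_right_ae, k1.prod_right_ae, k2.prod_right_ae] with x a0 a1 a2
  simp only [Function.update_self] at a1 ⊢
  refine integral_id_mul_gaussianReal (fun t => ?_) a0 a1 a2
  simpa using hF (Function.update x i t)

end Pi

/-- The Cameron–Martin formula. In one dimension it is completion of the square in the Gaussian
density; in several, both measures are compared on boxes, where the integral factors by independence
of the coordinates. -/
theorem stdPi_shift_eq_withDensity {I : Type*} [Fintype I] (m : I → ℝ) :
    (stdPi I).map (fun x => x + m)
      = (stdPi I).withDensity fun x => ∏ i, ENNReal.ofReal (Real.exp (m i * x i - m i ^ 2 / 2)) := by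
  have h1 : ∀ a : ℝ, (gaussianReal 0 1).map (fun x => x + a)
      = (gaussianReal 0 1).withDensity fun x => ENNReal.ofReal (Real.exp (a * x - a ^ 2 / 2)) := by
    intro a
    rw [gaussianReal_map_add_const, gaussianReal_of_var_ne_zero _ one_ne_zero,
      gaussianReal_of_var_ne_zero _ one_ne_zero, ← withDensity_mul _ (measurable_gaussianPDF 0 1)
        (by fun_prop)]
    congr 1
    ext x
    simp only [gaussianPDF, Pi.mul_apply]
    rw [← ENNReal.ofReal_mul (gaussianPDFReal_nonneg _ _ _)]
    congr 1
    simp only [gaussianPDFReal, NNReal.coe_one, mul_one]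
    rw [mul_assoc, ← Real.exp_add]
    congr 2
    ring
  have h2 : (stdPi I).map (fun x => x + m) = Measure.pi fun i => (gaussianReal 0 1).map (fun x => x + m i) := by
    exact Measure.pi_map_pi (f := fun i x => x + m i) (fun i => by fun_prop)
  rw [h2]
  refine Measure.pi_eq fun s hs => ?_
  have hind := (iIndepFun_pi (μ := fun _ : I => gaussianReal 0 1)
    (X := fun i x => (s i).indicator (fun x => ENNReal.ofReal (Real.exp (m i * x - m i ^ 2 / 2))) x)
    (fun i => (Measurable.indicator (by fun_prop) (hs i)).aemeasurable))
  rw [withDensity_apply _ (MeasurableSet.univ_pi hs), ← lintegral_indicator (MeasurableSet.univ_pi hs)]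
  have := lintegral_prod_eq_prod_lintegral_of_indepFun (s := Finset.univ) (X := fun i (x : I → ℝ) => (s i).indicator (fun x => ENNReal.ofReal (Real.exp (m i * x - m i ^ 2 / 2))) (x i)) hind
    (fun i => (Measurable.indicator (by fun_prop) (hs i)).comp (measurable_pi_apply i))
  trans ∫⁻ x, ∏ i, (s i).indicator (fun x => ENNReal.ofReal (Real.exp (m i * x - m i ^ 2 / 2))) (x i) ∂(stdPi I)
  · congr 1
    ext x
    by_cases hx : x ∈ Set.univ.pi s
    · rw [Set.indicator_of_mem hx]
      refine Finset.prod_congr rfl fun i _ => ?_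
      rw [Set.indicator_of_mem (hx i trivial)]
    · rw [Set.indicator_of_notMem hx]
      simp only [Set.mem_pi, Set.mem_univ, true_implies, not_forall] at hx
      obtain ⟨i, hi⟩ := hx
      exact (Finset.prod_eq_zero (Finset.mem_univ i) (Set.indicator_of_notMem hi _)).symm
  · rw [this]
    refine Finset.prod_congr rfl fun i _ => ?_
    rw [h1, withDensity_apply _ (hs i), ← lintegral_indicator (hs i)]
    have hmp := measurePreserving_eval (fun _ : I => gaussianReal 0 1) i
    exact hmp.lintegral_comp (Measurable.indicator (by fun_prop) (hs i))

theorem integrable_coord_stdPi {I : Type*} [Fintype I] (m : I) :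
    Integrable (fun w : I → ℝ => w m) (stdPi I) := by
  have h : Integrable (fun x : ℝ => x) (gaussianReal 0 1) :=
    (memLp_id_gaussianReal 1).integrable (by simp)
  exact (measurePreserving_eval (fun _ : I => gaussianReal 0 1) m).integrable_comp_of_integrable h

theorem integrable_of_continuous_bounded {X : Type*} [TopologicalSpace X] [MeasurableSpace X]
    [BorelSpace X] [SecondCountableTopology X] {μ : Measure X} [IsFiniteMeasure μ] {F : X → ℝ}
    (hc : Continuous F) {C : ℝ} (hb : ∀ x, |F x| ≤ C) : Integrable F μ :=
  Integrable.of_bound hc.aestronglyMeasurable C (ae_of_all _ hb)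

theorem integrable_coord_mul_stdPi {I : Type*} [Fintype I] (m : I) {F : (I → ℝ) → ℝ}
    (hc : Continuous F) {C : ℝ} (hb : ∀ x, |F x| ≤ C) :
    Integrable (fun w : I → ℝ => w m * F w) (stdPi I) :=
  (integrable_coord_stdPi m).mul_bdd hc.aestronglyMeasurable (ae_of_all _ hb)

/-! ### Gaussian interpolation -/

section Interpolation

variable {I K : Type*} [Fintype I] [Fintype K]

theorem hasDerivAt_mulVec_update [DecidableEq I] (M : Matrix K I ℝ) (w : I → ℝ) (m : I) (t : ℝ) :
    HasDerivAt (fun t => M *ᵥ Function.update w m t) (M.col m) t := by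
  have h := (M.mulVecLin.toContinuousLinearMap).hasFDerivAt.comp_hasDerivAt t
    (hasDerivAt_update w m t)
  have e : M.mulVecLin.toContinuousLinearMap (Pi.single m (1 : ℝ)) = M.col m := by
    simp
  rw [e] at h
  exact h

/-- Integration by parts for a smooth function of linear forms of a standard Gaussian vector. -/
theorem integral_coord_mul_comp_mulVec {G : (K → ℝ) → ℝ} {G' : K → (K → ℝ) → ℝ}
    (hG : ∀ x, HasFDerivAt G (∑ l, G' l x • ContinuousLinearMap.proj (R := ℝ) (φ := fun _ : K => ℝ) l) x)
    (hG' : ∀ l, Continuous (G' l)) {C : ℝ} (hb : ∀ x, |G x| ≤ C) (hb' : ∀ l x, |G' l x| ≤ C)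
    (M : Matrix K I ℝ) (m : I) :
    ∫ w, w m * G (M *ᵥ w) ∂(stdPi I) = ∑ l, M l m * ∫ w, G' l (M *ᵥ w) ∂(stdPi I) := by
  classical
  have hGc : Continuous G := continuous_iff_continuousAt.2 fun x => (hG x).continuousAt
  have hMc : Continuous fun w : I → ℝ => M *ᵥ w := by fun_prop
  have hint : ∀ l, Integrable (fun w => G' l (M *ᵥ w)) (stdPi I) := fun l =>
    integrable_of_continuous_bounded ((hG' l).comp hMc) (fun w => hb' l _)
  rw [integral_coord_mul_stdPi (F := fun w => G (M *ᵥ w)) (F' := fun w => ∑ l, M l m * G' l (M *ᵥ w)) m]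
  · rw [integral_finsetSum _ fun l _ => (hint l).const_mul _]
    simp_rw [integral_const_mul]
  · intro w
    have h1 := (hG (M *ᵥ w))
    have h2 := hasDerivAt_mulVec_update M w m (w m)
    have h3 : HasFDerivAt G (∑ l, G' l (M *ᵥ w) • ContinuousLinearMap.proj (R := ℝ) (φ := fun _ : K => ℝ) l)
      (M *ᵥ Function.update w m (w m)) := by simpa using h1
    refine (h3.comp_hasDerivAt (w m) h2).congr_deriv ?_
    simp [mul_comm]
  · exact integrable_of_continuous_bounded (hGc.comp hMc) fun w => hb _
  · exact integrable_coord_mul_stdPi m (hGc.comp hMc) fun w => hb _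
  · exact integrable_finsetSum _ fun l _ => (hint l).const_mul _

/-- Gaussian interpolation: if replacing the covariance of `B w` by that of `A w` changes it in
directions where the second derivatives of `f` have the same sign, the mean of `f` grows. -/
theorem integral_comp_mulVec_le {f : (K → ℝ) → ℝ} {D : K → (K → ℝ) → ℝ}
    {D2 : K → K → (K → ℝ) → ℝ}
    (hf : ∀ x, HasFDerivAt f (∑ l, D l x • ContinuousLinearMap.proj (R := ℝ) (φ := fun _ : K => ℝ) l) x)
    (hD : ∀ k x, HasFDerivAt (D k)
      (∑ l, D2 k l x • ContinuousLinearMap.proj (R := ℝ) (φ := fun _ : K => ℝ) l) x)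
    (hD2 : ∀ k l, Continuous (D2 k l)) {C : ℝ} (hb0 : ∀ x, |f x| ≤ C) (hb1 : ∀ k x, |D k x| ≤ C)
    (hb2 : ∀ k l x, |D2 k l x| ≤ C) (A B : Matrix K I ℝ) (horth : A * Bᵀ = 0)
    (hsign : ∀ k l x, 0 ≤ ((A * Aᵀ) k l - (B * Bᵀ) k l) * D2 k l x) :
    ∫ w, f (B *ᵥ w) ∂(stdPi I) ≤ ∫ w, f (A *ᵥ w) ∂(stdPi I) := by
  have hfc : Continuous f := continuous_iff_continuousAt.2 fun x => (hf x).continuousAt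
  have hDc : ∀ k, Continuous (D k) := fun k =>
    continuous_iff_continuousAt.2 fun x => (hD k x).continuousAt
  -- The path rotates from A at s = 0 to B at s = π/2. Because A Bᵀ = 0, the covariance along it is
  -- cos² s · AAᵀ + sin² s · BBᵀ.
  set M : ℝ → Matrix K I ℝ := fun s => Real.cos s • A + Real.sin s • B with hM
  set M' : ℝ → Matrix K I ℝ := fun s => -Real.sin s • A + Real.cos s • B with hM'
  have hMd : ∀ w s, HasDerivAt (fun s => M s *ᵥ w) (M' s *ᵥ w) s := by
    intro w s
    have e1 : (fun s => M s *ᵥ w) = fun s => Real.cos s • (A *ᵥ w) + Real.sin s • (B *ᵥ w) := by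
      ext1 s; simp [hM, Matrix.add_mulVec, Matrix.smul_mulVec]
    have e2 : M' s *ᵥ w = -Real.sin s • (A *ᵥ w) + Real.cos s • (B *ᵥ w) := by
      simp only [hM', Matrix.add_mulVec, Matrix.smul_mulVec]
    rw [e1, e2]
    exact ((Real.hasDerivAt_cos s).smul_const _).add ((Real.hasDerivAt_sin s).smul_const _)
  set Φ : ℝ → ℝ := fun s => ∫ w, f (M s *ᵥ w) ∂(stdPi I) with hΦ
  have hCpos : 0 ≤ C := (abs_nonneg _).trans (hb0 0)
  have hMc : ∀ s, Continuous fun w : I → ℝ => M s *ᵥ w := fun s => by fun_prop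
  have hM'b : ∀ s k (w : I → ℝ), |(M' s *ᵥ w) k| ≤ ∑ m, (|A k m| + |B k m|) * |w m| := by
    intro s k w
    refine (Finset.abs_sum_le_sum_abs _ _).trans (Finset.sum_le_sum fun m _ => ?_)
    rw [abs_mul]
    refine mul_le_mul_of_nonneg_right ?_ (abs_nonneg _)
    simp only [hM', Matrix.add_apply, Matrix.smul_apply, smul_eq_mul]
    refine (abs_add_le _ _).trans (add_le_add ?_ ?_)
    · rw [abs_mul, abs_neg]
      exact mul_le_of_le_one_left (abs_nonneg _) (Real.abs_sin_le_one s)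
    · rw [abs_mul]
      exact mul_le_of_le_one_left (abs_nonneg _) (Real.abs_cos_le_one s)
  have hder : ∀ s, HasDerivAt Φ (∫ w, ∑ k, D k (M s *ᵥ w) * (M' s *ᵥ w) k ∂(stdPi I)) s := by
    intro s
    refine (hasDerivAt_integral_of_dominated_loc_of_deriv_le (s := Set.univ)
      (F := fun s w => f (M s *ᵥ w))
      (F' := fun s w => ∑ k, D k (M s *ᵥ w) * (M' s *ᵥ w) k)
      (bound := fun w => ∑ k, C * ∑ m, (|A k m| + |B k m|) * |w m|)
      univ_mem ?_ ?_ ?_ ?_ ?_ ?_).2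
    · exact Eventually.of_forall fun s => (hfc.comp (hMc s)).aestronglyMeasurable
    · exact integrable_of_continuous_bounded (hfc.comp (hMc s)) fun w => hb0 _
    · refine Continuous.aestronglyMeasurable ?_
      exact continuous_finsetSum _ fun k _ => ((hDc k).comp (hMc s)).mul (by fun_prop)
    · refine ae_of_all _ fun w s _ => ?_
      rw [Real.norm_eq_abs]
      refine (Finset.abs_sum_le_sum_abs _ _).trans (Finset.sum_le_sum fun k _ => ?_)
      rw [abs_mul]
      exact mul_le_mul (hb1 _ _) (hM'b s k w) (abs_nonneg _) hCpos
    · exact integrable_finsetSum _ fun k _ => (integrable_finsetSum _ fun m _ =>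
        ((integrable_coord_stdPi m).abs).const_mul _).const_mul _
    · refine ae_of_all _ fun w s _ => ?_
      refine ((hf _).comp_hasDerivAt s (hMd w s)).congr_deriv ?_
      simp
  have hval : ∀ s, ∫ w, ∑ k, D k (M s *ᵥ w) * (M' s *ᵥ w) k ∂(stdPi I)
      = -(Real.sin s * Real.cos s * ∑ k, ∑ l, ((A * Aᵀ) k l - (B * Bᵀ) k l)
          * ∫ w, D2 k l (M s *ᵥ w) ∂(stdPi I)) := by
    intro s
    have hi : ∀ k m, Integrable (fun w : I → ℝ => M' s k m * (w m * D k (M s *ᵥ w))) (stdPi I) :=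
      fun k m => (integrable_coord_mul_stdPi m ((hDc k).comp (hMc s)) fun w => hb1 k _).const_mul _
    have e1 : ∀ w : I → ℝ, ∑ k, D k (M s *ᵥ w) * (M' s *ᵥ w) k
        = ∑ k, ∑ m, M' s k m * (w m * D k (M s *ᵥ w)) := by
      intro w
      refine Finset.sum_congr rfl fun k _ => ?_
      rw [Matrix.mulVec, dotProduct, Finset.mul_sum]
      exact Finset.sum_congr rfl fun m _ => by ring
    simp_rw [e1]
    rw [integral_finsetSum _ fun k _ => integrable_finsetSum _ fun m _ => hi k m]
    rw [Finset.mul_sum, ← Finset.sum_neg_distrib]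
    refine Finset.sum_congr rfl fun k _ => ?_
    rw [integral_finsetSum _ fun m _ => hi k m]
    simp_rw [integral_const_mul]
    have e2 : ∀ m, ∫ w, w m * D k (M s *ᵥ w) ∂(stdPi I)
        = ∑ l, M s l m * ∫ w, D2 k l (M s *ᵥ w) ∂(stdPi I) := fun m =>
      integral_coord_mul_comp_mulVec (hD k) (hD2 k) (hb1 k) (hb2 k) (M s) m
    simp_rw [e2, Finset.mul_sum]
    rw [Finset.sum_comm, ← Finset.sum_neg_distrib]
    refine Finset.sum_congr rfl fun l _ => ?_
    -- Integration by parts has produced the covariance of velocity and position, which is half the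
    -- derivative of the covariance along the path.
    have e3 : (M' s * (M s)ᵀ) k l
        = -(Real.sin s * Real.cos s * ((A * Aᵀ) k l - (B * Bᵀ) k l)) := by
      have horth' : B * Aᵀ = 0 := by
        have := congrArg Matrix.transpose horth
        simpa [Matrix.transpose_mul] using this
      have : M' s * (M s)ᵀ = -(Real.sin s * Real.cos s) • (A * Aᵀ)
          + (Real.sin s * Real.cos s) • (B * Bᵀ) := by
        simp only [hM, hM', Matrix.transpose_add, Matrix.transpose_smul, Matrix.add_mul,
          Matrix.mul_add, Matrix.smul_mul, Matrix.mul_smul, horth, horth', smul_zero]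
        simp only [add_zero, zero_add]
        module
      rw [this]
      simp only [Matrix.add_apply, Matrix.smul_apply, smul_eq_mul]
      ring
    rw [show -(Real.sin s * Real.cos s * (((A * Aᵀ) k l - (B * Bᵀ) k l)
        * ∫ w, D2 k l (M s *ᵥ w) ∂(stdPi I)))
        = (M' s * (M s)ᵀ) k l * ∫ w, D2 k l (M s *ᵥ w) ∂(stdPi I) by rw [e3]; ring]
    rw [Matrix.mul_apply, Finset.sum_mul]
    exact Finset.sum_congr rfl fun m _ => by rw [Matrix.transpose_apply]; ring
  -- Both sine and cosine are nonnegative on this interval and `hsign` fixes the sign of each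
  -- summand, so Φ decreases from its value for A to its value for B.
  have hanti : AntitoneOn Φ (Set.Icc 0 (Real.pi / 2)) := by
    refine antitoneOn_of_deriv_nonpos (convex_Icc _ _)
      (fun s _ => (hder s).continuousAt.continuousWithinAt)
      (fun s _ => (hder s).differentiableAt.differentiableWithinAt) fun s hs => ?_
    rw [interior_Icc] at hs
    rw [(hder s).deriv, hval s, neg_nonpos]
    refine mul_nonneg (mul_nonneg (Real.sin_nonneg_of_nonneg_of_le_pi hs.1.le
      (hs.2.le.trans (by linarith [Real.pi_pos])))
      (Real.cos_nonneg_of_mem_Icc ⟨by linarith [hs.1, Real.pi_pos], hs.2.le⟩)) ?_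
    refine Finset.sum_nonneg fun k _ => Finset.sum_nonneg fun l _ => ?_
    rw [← integral_const_mul]
    exact integral_nonneg fun w => hsign k l _
  have h0 := hanti (Set.left_mem_Icc.2 (by positivity)) (Set.right_mem_Icc.2 (by positivity))
    (by positivity : (0 : ℝ) ≤ Real.pi / 2)
  simpa [hΦ, hM] using h0

end Interpolation

/-! ### Smooth cutoffs and Gordon's comparison inequality -/

/-- A smooth nonincreasing cutoff with two bounded derivatives. -/
structure Cutoff (s t : ℝ) where
  (h h' h'' : ℝ → ℝ)
  deriv_h : ∀ x, HasDerivAt h (h' x) x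
  deriv_h' : ∀ x, HasDerivAt h' (h'' x) x
  cont : Continuous h''
  nonneg : ∀ x, 0 ≤ h x
  le_one : ∀ x, h x ≤ 1
  deriv_nonpos : ∀ x, h' x ≤ 0
  bound : ℝ
  one_le_bound : 1 ≤ bound
  abs_h'_le : ∀ x, |h' x| ≤ bound
  abs_h''_le : ∀ x, |h'' x| ≤ bound
  eq_one : ∀ x ≤ s, h x = 1
  eq_zero : ∀ x, t ≤ x → h x = 0

theorem exists_bound_of_deriv_smoothTransition (g : ℝ → ℝ) (hg : Continuous g)
    (h0 : ∀ x < 0, g x = 0) (h1 : ∀ x, 1 < x → g x = 0) : ∃ B, ∀ x, |g x| ≤ B := by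
  obtain ⟨B, hB⟩ := (isCompact_Icc (a := (0 : ℝ)) (b := 1)).exists_bound_of_continuousOn
    hg.continuousOn
  refine ⟨B, fun x => ?_⟩
  have hB0 : 0 ≤ B := (norm_nonneg _).trans (hB 0 (by simp))
  by_cases hx0 : x < 0
  · simpa [h0 x hx0] using hB0
  by_cases hx1 : 1 < x
  · simpa [h1 x hx1] using hB0
  exact hB x ⟨not_lt.1 hx0, not_lt.1 hx1⟩

theorem nonempty_cutoff {s t : ℝ} (hst : s < t) : Nonempty (Cutoff s t) := by
  set φ := Real.smoothTransition with hφ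
  have hc : ContDiff ℝ 2 φ := Real.smoothTransition.contDiff (n := 2)
  have hd1 : ContDiff ℝ 1 (deriv φ) := by
    have : ContDiff ℝ (1 + 1) φ := by simpa [one_add_one_eq_two] using hc
    exact (contDiff_succ_iff_deriv.1 this).2.2
  have hd2 : Continuous (deriv (deriv φ)) := hd1.continuous_deriv le_rfl
  have z0 : ∀ x < 0, φ =ᶠ[𝓝 x] fun _ => 0 := fun x hx => by
    filter_upwards [Iio_mem_nhds hx] with y hy
    exact Real.smoothTransition.zero_of_nonpos (le_of_lt hy)
  have z1 : ∀ x, 1 < x → φ =ᶠ[𝓝 x] fun _ => 1 := fun x hx => by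
    filter_upwards [Ioi_mem_nhds hx] with y hy
    exact Real.smoothTransition.one_of_one_le (le_of_lt hy)
  obtain ⟨B1, hB1⟩ := exists_bound_of_deriv_smoothTransition (deriv φ) hd1.continuous
    (fun x hx => by simp [(z0 x hx).deriv_eq]) (fun x hx => by simp [(z1 x hx).deriv_eq])
  obtain ⟨B2, hB2⟩ := exists_bound_of_deriv_smoothTransition (deriv (deriv φ)) hd2
    (fun x hx => by simp [(z0 x hx).deriv.deriv_eq]) (fun x hx => by simp [(z1 x hx).deriv.deriv_eq])
  have hpos : 0 < t - s := sub_pos.2 hst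
  set r := (t - s)⁻¹ with hr
  have hrpos : 0 < r := inv_pos.2 hpos
  have hlin : ∀ x, HasDerivAt (fun x => r * (x - s)) r x := fun x => by
    simpa using ((hasDerivAt_id x).sub_const s).const_mul r
  have hB10 : 0 ≤ B1 := (abs_nonneg _).trans (hB1 0)
  have hB20 : 0 ≤ B2 := (abs_nonneg _).trans (hB2 0)
  -- A single bound serves both derivatives. Its summand 1 makes the bound at least one, so that its
  -- square also dominates products with fewer derivative factors.
  refine ⟨⟨fun x => 1 - φ (r * (x - s)), fun x => -(deriv φ (r * (x - s)) * r),
    fun x => -(deriv (deriv φ) (r * (x - s)) * r * r), fun x => ?_, fun x => ?_, ?_, fun x => ?_,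
    fun x => ?_, fun x => ?_, 1 + B1 * r + B2 * r * r, ?_, fun x => ?_, fun x => ?_,
    fun x hx => ?_, fun x hx => ?_⟩⟩
  · exact (((hc.differentiable (by norm_num)) _).hasDerivAt.comp x (hlin x)).const_sub 1
  · exact ((((hd1.differentiable (by norm_num)) _).hasDerivAt.comp x (hlin x)).mul_const r).neg
  · exact (((hd2.comp (by fun_prop)).mul continuous_const).mul continuous_const).neg
  · exact sub_nonneg.2 (Real.smoothTransition.le_one _)
  · exact sub_le_self _ (Real.smoothTransition.nonneg _)
  · exact neg_nonpos.2 (mul_nonneg (Real.smoothTransition.monotone.deriv_nonneg) hrpos.le)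
  · have := mul_nonneg hB10 hrpos.le
    have := mul_nonneg (mul_nonneg hB20 hrpos.le) hrpos.le
    linarith
  · rw [abs_neg, abs_mul, abs_of_pos hrpos]
    have := mul_le_mul_of_nonneg_right (hB1 (r * (x - s))) hrpos.le
    have := mul_nonneg (mul_nonneg hB20 hrpos.le) hrpos.le
    linarith
  · rw [abs_neg, abs_mul, abs_mul, abs_of_pos hrpos]
    have := mul_le_mul_of_nonneg_right (mul_le_mul_of_nonneg_right (hB2 (r * (x - s))) hrpos.le) hrpos.le
    have := mul_nonneg hB10 hrpos.le
    linarith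
  · have : r * (x - s) ≤ 0 := mul_nonpos_of_nonneg_of_nonpos hrpos.le (by linarith)
    simp [hφ, Real.smoothTransition.zero_of_nonpos this]
  · have : 1 ≤ r * (x - s) := by
      rw [hr, inv_mul_eq_div, one_le_div hpos]; linarith
    simp [hφ, Real.smoothTransition.one_of_one_le this]

section Gordon

variable {ι κ : Type*} [Fintype ι] [Fintype κ] [DecidableEq ι] [DecidableEq κ] {s t : ℝ}

theorem mul_le_of_le_of_le_one_of_nonneg' {a b c : ℝ} (hab : a ≤ b) (hc : c ≤ 1) (ha : 0 ≤ a) :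
    a * c ≤ b :=
  (mul_le_of_le_one_right ha hc).trans hab

namespace Cutoff

variable (c : Cutoff s t)

/-- The coordinate functional. -/
local notation "ev" => fun k => ContinuousLinearMap.proj (R := ℝ) (φ := fun _ : ι × κ => ℝ) k

/-- The product of the cutoffs over part of a row. -/
def rowProd (i : ι) (J : Finset κ) (x : ι × κ → ℝ) : ℝ := ∏ j ∈ J, c.h (x (i, j))

/-- The product over rows of `1 - rowProd`. -/
def colProd (S : Finset ι) (x : ι × κ → ℝ) : ℝ := ∏ i ∈ S, (1 - c.rowProd i Finset.univ x)

/-- First partial derivatives of `colProd`. -/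
def partial1 (k : ι × κ) (x : ι × κ → ℝ) : ℝ :=
  -(c.h' (x k) * c.rowProd k.1 (Finset.univ.erase k.2) x * c.colProd (Finset.univ.erase k.1) x)

/-- Second partial derivatives of `colProd`. -/
def partial2 (k l : ι × κ) (x : ι × κ → ℝ) : ℝ :=
  if l.1 = k.1 then
    if l.2 = k.2 then
      -(c.h'' (x k) * c.rowProd k.1 (Finset.univ.erase k.2) x * c.colProd (Finset.univ.erase k.1) x)
    else
      -(c.h' (x k) * (c.h' (x l) * c.rowProd k.1 ((Finset.univ.erase k.2).erase l.2) x)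
        * c.colProd (Finset.univ.erase k.1) x)
  else
    c.h' (x k) * c.rowProd k.1 (Finset.univ.erase k.2) x
      * (c.h' (x l) * c.rowProd l.1 (Finset.univ.erase l.2) x
        * c.colProd ((Finset.univ.erase k.1).erase l.1) x)

theorem rowProd_nonneg (i : ι) (J : Finset κ) (x : ι × κ → ℝ) : 0 ≤ c.rowProd i J x :=
  Finset.prod_nonneg fun _ _ => c.nonneg _

theorem rowProd_le_one (i : ι) (J : Finset κ) (x : ι × κ → ℝ) : c.rowProd i J x ≤ 1 :=
  Finset.prod_le_one (fun _ _ => c.nonneg _) fun _ _ => c.le_one _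

theorem colProd_nonneg (S : Finset ι) (x : ι × κ → ℝ) : 0 ≤ c.colProd S x :=
  Finset.prod_nonneg fun _ _ => sub_nonneg.2 (c.rowProd_le_one _ _ _)

theorem colProd_le_one (S : Finset ι) (x : ι × κ → ℝ) : c.colProd S x ≤ 1 :=
  Finset.prod_le_one (fun _ _ => sub_nonneg.2 (c.rowProd_le_one _ _ _))
    fun _ _ => sub_le_self _ (c.rowProd_nonneg _ _ _)

theorem hasFDerivAt_rowProd (i : ι) (J : Finset κ) (x : ι × κ → ℝ) :
    HasFDerivAt (c.rowProd i J)
      (∑ j ∈ J, (c.h' (x (i, j)) * c.rowProd i (J.erase j) x) • ev (i, j)) x := by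
  have h1 : ∀ j, HasFDerivAt (fun x : ι × κ → ℝ => c.h (x (i, j))) (c.h' (x (i, j)) • ev (i, j)) x :=
    fun j => (c.deriv_h _).comp_hasFDerivAt x (ev (i, j)).hasFDerivAt
  have := HasFDerivAt.finsetProd (u := J) fun j _ => h1 j
  refine this.congr_fderiv ?_
  refine Finset.sum_congr rfl fun j _ => ?_
  rw [smul_smul, mul_comm]
  rfl

theorem hasFDerivAt_colProd (S : Finset ι) (x : ι × κ → ℝ) :
    HasFDerivAt (c.colProd S)
      (∑ i ∈ S, ∑ j, (-(c.h' (x (i, j)) * c.rowProd i (Finset.univ.erase j) x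
        * c.colProd (S.erase i) x)) • ev (i, j)) x := by
  have := HasFDerivAt.finsetProd (u := S) fun i _ =>
    (c.hasFDerivAt_rowProd i Finset.univ x).const_sub 1
  refine this.congr_fderiv ?_
  refine Finset.sum_congr rfl fun i _ => ?_
  rw [← Finset.sum_neg_distrib, Finset.smul_sum]
  refine Finset.sum_congr rfl fun j _ => ?_
  rw [← neg_smul, smul_smul]
  congr 1
  change c.colProd (S.erase i) x * _ = _
  ring

theorem hasFDerivAt_colProd_univ (x : ι × κ → ℝ) :
    HasFDerivAt (c.colProd (Finset.univ : Finset ι)) (∑ k, c.partial1 k x • ev k) x := by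
  refine (c.hasFDerivAt_colProd Finset.univ x).congr_fderiv ?_
  rw [Fintype.sum_prod_type]
  rfl

/-- The three cases of `partial2` are the three terms of the product rule: differentiating the slope
gives the diagonal entry, the row product gives the other entries of the same row, and the product
over the remaining rows gives the rest. -/
theorem hasFDerivAt_partial1 (k : ι × κ) (x : ι × κ → ℝ) :
    HasFDerivAt (c.partial1 k) (∑ l, c.partial2 k l x • ev l) x := by
  obtain ⟨i, j⟩ := k
  have h1 : HasFDerivAt (fun x : ι × κ → ℝ => c.h' (x (i, j))) (c.h'' (x (i, j)) • ev (i, j)) x :=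
    (c.deriv_h' _).comp_hasFDerivAt x (ev (i, j)).hasFDerivAt
  have h2 := ((h1.mul (c.hasFDerivAt_rowProd i (Finset.univ.erase j) x)).mul
    (c.hasFDerivAt_colProd (Finset.univ.erase i) x)).neg
  refine h2.congr_fderiv ?_
  rw [Fintype.sum_prod_type, ← Finset.add_sum_erase _ _ (Finset.mem_univ i),
    ← Finset.add_sum_erase _ _ (Finset.mem_univ j)]
  have e1 : ∑ j' ∈ Finset.univ.erase j, c.partial2 (i, j) (i, j') x • ev (i, j')
      = ∑ j' ∈ Finset.univ.erase j, -(c.h' (x (i, j)) * (c.h' (x (i, j'))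
        * c.rowProd i ((Finset.univ.erase j).erase j') x)
        * c.colProd (Finset.univ.erase i) x) • ev (i, j') :=
    Finset.sum_congr rfl fun j' hj' => by simp [partial2, Finset.ne_of_mem_erase hj']
  have e2 : ∑ i' ∈ Finset.univ.erase i, ∑ j', c.partial2 (i, j) (i', j') x • ev (i', j')
      = ∑ i' ∈ Finset.univ.erase i, ∑ j', (c.h' (x (i, j)) * c.rowProd i (Finset.univ.erase j) x
      * (c.h' (x (i', j')) * c.rowProd i' (Finset.univ.erase j') x
        * c.colProd ((Finset.univ.erase i).erase i') x)) • ev (i', j') :=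
    Finset.sum_congr rfl fun i' hi' => Finset.sum_congr rfl fun j' _ => by
      simp [partial2, Finset.ne_of_mem_erase hi']
  rw [e1, e2]
  have e3 : c.partial2 (i, j) (i, j) x = -(c.h'' (x (i, j)) * c.rowProd i (Finset.univ.erase j) x
      * c.colProd (Finset.univ.erase i) x) := by simp [partial2]
  rw [e3]
  ext v
  simp only [neg_apply, add_apply, smul_apply, sum_apply, smul_eq_mul, Finset.mul_sum, mul_add,
    neg_add, ← Finset.sum_neg_distrib]
  have hadd : ∀ a b d a' b' d' : ℝ, a = d' → b = b' → d = a' → a + (b + d) = a' + b' + d' := by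
    intro a b d a' b' d' h1 h2 h3; rw [h1, h2, h3]; ring
  refine hadd _ _ _ _ _ _ ?_ ?_ ?_
  · exact Finset.sum_congr rfl fun _ _ => Finset.sum_congr rfl fun _ _ => by
      simp only [Pi.mul_apply]; ring
  · exact Finset.sum_congr rfl fun _ _ => by ring
  · ring

theorem continuous_rowProd (i : ι) (J : Finset κ) : Continuous (c.rowProd i J) :=
  continuous_iff_continuousAt.2 fun x => (c.hasFDerivAt_rowProd i J x).continuousAt

theorem continuous_colProd (S : Finset ι) : Continuous (c.colProd (κ := κ) S) :=
  continuous_iff_continuousAt.2 fun x => (c.hasFDerivAt_colProd S x).continuousAt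

theorem continuous_partial2 (k l : ι × κ) : Continuous (c.partial2 k l) := by
  have h1 : Continuous c.h' := continuous_iff_continuousAt.2 fun x => (c.deriv_h' x).continuousAt
  have hr := c.continuous_rowProd (ι := ι) (κ := κ)
  have hk := c.continuous_colProd (ι := ι) (κ := κ)
  have h2 := c.cont
  unfold partial2
  split_ifs <;> fun_prop

theorem abs_colProd_le (S : Finset ι) (x : ι × κ → ℝ) : |c.colProd S x| ≤ 1 := by
  rw [abs_of_nonneg (c.colProd_nonneg S x)]; exact c.colProd_le_one S x

theorem abs_rowProd_le (i : ι) (J : Finset κ) (x : ι × κ → ℝ) : |c.rowProd i J x| ≤ 1 := by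
  rw [abs_of_nonneg (c.rowProd_nonneg i J x)]; exact c.rowProd_le_one i J x

theorem bound_le_sq : c.bound ≤ c.bound ^ 2 := by nlinarith [c.one_le_bound]

theorem abs_partial1_le (k : ι × κ) (x : ι × κ → ℝ) : |c.partial1 k x| ≤ c.bound ^ 2 := by
  refine le_trans ?_ c.bound_le_sq
  unfold partial1
  rw [abs_neg, abs_mul, abs_mul, mul_assoc]
  exact mul_le_of_le_of_le_one_of_nonneg' (c.abs_h'_le _)
    (mul_le_one₀ (c.abs_rowProd_le _ _ _) (abs_nonneg _) (c.abs_colProd_le _ _)) (abs_nonneg _)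

theorem abs_partial2_le (k l : ι × κ) (x : ι × κ → ℝ) : |c.partial2 k l x| ≤ c.bound ^ 2 := by
  have hb : 0 ≤ c.bound := zero_le_one.trans c.one_le_bound
  unfold partial2
  split_ifs
  · refine le_trans ?_ c.bound_le_sq
    rw [abs_neg, abs_mul, abs_mul, mul_assoc]
    exact mul_le_of_le_of_le_one_of_nonneg' (c.abs_h''_le _)
      (mul_le_one₀ (c.abs_rowProd_le _ _ _) (abs_nonneg _) (c.abs_colProd_le _ _)) (abs_nonneg _)
  · rw [abs_neg, abs_mul, abs_mul, abs_mul, pow_two]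
    refine mul_le_of_le_of_le_one_of_nonneg' ?_ (c.abs_colProd_le _ _) (by positivity)
    refine mul_le_mul (c.abs_h'_le _) ?_ (by positivity) hb
    exact mul_le_of_le_of_le_one_of_nonneg' (c.abs_h'_le _) (c.abs_rowProd_le _ _ _) (abs_nonneg _)
  · rw [abs_mul, abs_mul, abs_mul, abs_mul, pow_two, mul_assoc |c.h' (x l)|]
    refine mul_le_mul ?_ ?_ (by positivity) hb
    · exact mul_le_of_le_of_le_one_of_nonneg' (c.abs_h'_le _) (c.abs_rowProd_le _ _ _) (abs_nonneg _)
    · exact mul_le_of_le_of_le_one_of_nonneg' (c.abs_h'_le _)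
        (mul_le_one₀ (c.abs_rowProd_le _ _ _) (abs_nonneg _) (c.abs_colProd_le _ _)) (abs_nonneg _)

end Cutoff

/-- Gordon's comparison inequality for two families of linear forms of a Gaussian vector. -/
theorem gordon_comparison {I : Type*} [Fintype I] (hst : s < t) (A B : Matrix (ι × κ) I ℝ)
    (horth : A * Bᵀ = 0) (hrow : ∀ i j j', (A * Aᵀ) (i, j) (i, j') = (B * Bᵀ) (i, j) (i, j'))
    (hcol : ∀ i i' j j', (B * Bᵀ) (i, j) (i', j') ≤ (A * Aᵀ) (i, j) (i', j')) :
    (stdPi I).real {w | ∀ i, ∃ j, t ≤ (B *ᵥ w) (i, j)}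
      ≤ (stdPi I).real {w | ∀ i, ∃ j, s < (A *ᵥ w) (i, j)} := by
  -- The test function is `colProd`. A row with an entry at least t contributes the factor one,
  -- while a row with all entries at most s makes the product vanish. Hence `colProd` lies between
  -- the indicators of the two events.
  obtain ⟨c⟩ := nonempty_cutoff hst
  have hB1 : 1 ≤ c.bound ^ 2 := one_le_pow₀ c.one_le_bound
  have key := integral_comp_mulVec_le (c.hasFDerivAt_colProd_univ (ι := ι) (κ := κ))
    c.hasFDerivAt_partial1 c.continuous_partial2
    (fun x => (c.abs_colProd_le _ x).trans hB1) c.abs_partial1_le c.abs_partial2_le A B horth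
    (fun k l x => by
      -- Within a row the two covariances agree, so the sign of the second derivative is irrelevant.
      -- Across rows the mixed derivative is a product of two nonpositive slopes and nonnegative
      -- factors.
      by_cases h : l.1 = k.1
      · have := hrow k.1 k.2 l.2
        rw [show (k.1, l.2) = l by rw [← h]] at this
        rw [this]; simp
      · refine mul_nonneg (sub_nonneg.2 (hcol k.1 l.1 k.2 l.2)) ?_
        simp only [Cutoff.partial2, if_neg h]
        have := mul_nonneg_of_nonpos_of_nonpos (c.deriv_nonpos (x k)) (c.deriv_nonpos (x l))
        have h2 := mul_nonneg this (mul_nonneg (c.rowProd_nonneg k.1 (Finset.univ.erase k.2) x)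
          (mul_nonneg (c.rowProd_nonneg l.1 (Finset.univ.erase l.2) x)
            (c.colProd_nonneg ((Finset.univ.erase k.1).erase l.1) x)))
        refine h2.trans (le_of_eq ?_)
        ring)
  have hint : ∀ M : Matrix (ι × κ) I ℝ,
      Integrable (fun w => c.colProd Finset.univ (M *ᵥ w)) (stdPi I) := fun M =>
    integrable_of_continuous_bounded ((c.continuous_colProd _).comp (by fun_prop))
      fun w => c.abs_colProd_le _ _
  have hcoord : ∀ (M : Matrix (ι × κ) I ℝ) k, Measurable fun w : I → ℝ => (M *ᵥ w) k :=
    fun M k => Continuous.measurable (by fun_prop)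
  have mB : MeasurableSet {w : I → ℝ | ∀ i, ∃ j, t ≤ (B *ᵥ w) (i, j)} := by
    simp only [Set.ofPred_forall, Set.ofPred_exists]
    exact MeasurableSet.iInter fun i => MeasurableSet.iUnion fun j =>
      measurableSet_le measurable_const (hcoord B _)
  have mA : MeasurableSet {w : I → ℝ | ∀ i, ∃ j, s < (A *ᵥ w) (i, j)} := by
    simp only [Set.ofPred_forall, Set.ofPred_exists]
    exact MeasurableSet.iInter fun i => MeasurableSet.iUnion fun j =>
      measurableSet_lt measurable_const (hcoord A _)
  rw [← integral_indicator_one mB, ← integral_indicator_one mA]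
  refine le_trans (integral_mono ((integrable_const _).indicator mB) (hint B) fun w => ?_)
    (key.trans (integral_mono (hint A) ((integrable_const _).indicator mA) fun w => ?_))
  · refine Set.indicator_le' (fun w hw => ?_) (fun w _ => c.colProd_nonneg _ _) w
    refine le_of_eq (Finset.prod_eq_one fun i _ => ?_).symm
    obtain ⟨j, hj⟩ := hw i
    rw [sub_eq_self]
    exact Finset.prod_eq_zero (Finset.mem_univ j) (c.eq_zero _ hj)
  · refine Set.le_indicator (f := fun w => c.colProd Finset.univ (A *ᵥ w)) (g := 1)
      (fun w _ => c.colProd_le_one _ _) (fun w hw => ?_) w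
    simp only [Set.mem_ofPred_eq, not_forall, not_exists, not_lt] at hw
    obtain ⟨i, hi⟩ := hw
    refine le_of_eq (Finset.prod_eq_zero (Finset.mem_univ i) ?_)
    rw [sub_eq_zero]
    exact (Finset.prod_eq_one fun j _ => c.eq_one _ (hi j)).symm

end Gordon

/-! ### Extreme singular values of a Gaussian matrix -/

/-- The action of a matrix on Euclidean vectors. -/
noncomputable def mulE {n p : ℕ} (Z : Matrix (Fin n) (Fin p) ℝ) (u : EuclideanSpace ℝ (Fin p)) :
    EuclideanSpace ℝ (Fin n) :=
  WithLp.toLp 2 (Z *ᵥ u.ofLp)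

/-- The matrix with the given entries. -/
def entryMatrix {n p : ℕ} (z : Fin n × Fin p → ℝ) : Matrix (Fin n) (Fin p) ℝ :=
  Matrix.of fun i j => z (i, j)

theorem inner_eq_dotProduct {m : ℕ} (x y : EuclideanSpace ℝ (Fin m)) :
    inner ℝ x y = x.ofLp ⬝ᵥ y.ofLp := by
  rw [dotProduct_comm]
  simpa using EuclideanSpace.inner_eq_star_dotProduct x y

theorem inner_mulE {n p : ℕ} (Z : Matrix (Fin n) (Fin p) ℝ) (u : EuclideanSpace ℝ (Fin p))
    (v : EuclideanSpace ℝ (Fin n)) : inner ℝ v (mulE Z u) = v.ofLp ⬝ᵥ (Z *ᵥ u.ofLp) :=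
  inner_eq_dotProduct _ _

theorem mulE_smul {n p : ℕ} (Z : Matrix (Fin n) (Fin p) ℝ) (c : ℝ) (u : EuclideanSpace ℝ (Fin p)) :
    mulE Z (c • u) = c • mulE Z u := by
  simp [mulE, Matrix.mulVec_smul]

theorem continuous_mulE {n p : ℕ} :
    Continuous fun q : (Fin n × Fin p → ℝ) × EuclideanSpace ℝ (Fin p) =>
      mulE (entryMatrix q.1) q.2 := by
  unfold mulE entryMatrix
  refine (PiLp.continuous_toLp 2 _).comp ?_
  refine continuous_pi fun i => ?_
  simp only [Matrix.mulVec, dotProduct, Matrix.of_apply]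
  fun_prop

/-- The index set of the Gaussian coordinates `(Z, g, b, a)` of the comparison argument. -/
abbrev CmpIdx (n p : ℕ) : Type := (Fin n × Fin p) ⊕ (Unit ⊕ (Fin n ⊕ Fin p))

section Forms

variable {K : Type*} {n p : ℕ} (U : K → EuclideanSpace ℝ (Fin p))
  (V : K → EuclideanSpace ℝ (Fin n))

/-- The coefficients of the forms `⟪v, Z u⟫ + g`. -/
def bilinForms : Matrix K (CmpIdx n p) ℝ := Matrix.of fun k =>
  Sum.elim (fun q => V k q.1 * U k q.2) (Sum.elim (fun _ => 1) (fun _ => 0))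

/-- The coefficients of the forms `⟪b, v⟫ + ⟪a, u⟫`. -/
def linForms : Matrix K (CmpIdx n p) ℝ := Matrix.of fun k =>
  Sum.elim (fun _ => 0) (Sum.elim (fun _ => 0) (Sum.elim (fun a => V k a) (fun b => U k b)))

/-- The four blocks of the Gaussian vector of the comparison argument. -/
def blockZ (w : CmpIdx n p → ℝ) : Fin n × Fin p → ℝ := fun q => w (Sum.inl q)

/-- The scalar block. -/
def blockG (w : CmpIdx n p → ℝ) : ℝ := w (Sum.inr (Sum.inl ()))

/-- The block of the left vector. -/
def blockL (w : CmpIdx n p → ℝ) : EuclideanSpace ℝ (Fin n) :=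
  WithLp.toLp 2 fun i => w (Sum.inr (Sum.inr (Sum.inl i)))

/-- The block of the right vector. -/
def blockR (w : CmpIdx n p → ℝ) : EuclideanSpace ℝ (Fin p) :=
  WithLp.toLp 2 fun i => w (Sum.inr (Sum.inr (Sum.inr i)))

theorem bilinForms_mulVec (w : CmpIdx n p → ℝ) (k : K) :
    (bilinForms U V *ᵥ w) k = inner ℝ (V k) (mulE (entryMatrix (blockZ w)) (U k)) + blockG w := by
  rw [inner_mulE]
  simp only [bilinForms, Matrix.mulVec, dotProduct, Fintype.sum_sum_type, Matrix.of_apply,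
    Sum.elim_inl, Sum.elim_inr, Fintype.sum_prod_type, blockZ, blockG, entryMatrix, Finset.mul_sum]
  simp only [zero_mul, Finset.sum_const_zero, add_zero, one_mul, Finset.univ_unique,
    Finset.sum_singleton]
  congr 1
  exact Finset.sum_congr rfl fun i _ => Finset.sum_congr rfl fun j _ => by ring

theorem linForms_mulVec (w : CmpIdx n p → ℝ) (k : K) :
    (linForms U V *ᵥ w) k = inner ℝ (V k) (blockL w) + inner ℝ (U k) (blockR w) := by
  rw [inner_eq_dotProduct, inner_eq_dotProduct]
  simp [linForms, Matrix.mulVec, dotProduct, Fintype.sum_sum_type, blockL, blockR]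

theorem bilinForms_mul_linForms_transpose : bilinForms U V * (linForms U V)ᵀ = 0 := by
  ext k l
  simp [bilinForms, linForms, Matrix.mul_apply, Fintype.sum_sum_type]

theorem bilinForms_gram (k l : K) : (bilinForms U V * (bilinForms U V)ᵀ) k l
    = inner ℝ (V k) (V l) * inner ℝ (U k) (U l) + 1 := by
  rw [inner_eq_dotProduct, inner_eq_dotProduct]
  simp only [bilinForms, Matrix.mul_apply, Fintype.sum_sum_type, Matrix.of_apply,
    Sum.elim_inl, Sum.elim_inr, Fintype.sum_prod_type, Matrix.transpose_apply, dotProduct,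
    Finset.sum_mul_sum]
  simp only [mul_zero, Finset.sum_const_zero, add_zero, mul_one, Finset.univ_unique,
    Finset.sum_singleton]
  congr 1
  exact Finset.sum_congr rfl fun i _ => Finset.sum_congr rfl fun j _ => by ring

theorem linForms_gram (k l : K) : (linForms U V * (linForms U V)ᵀ) k l
    = inner ℝ (V k) (V l) + inner ℝ (U k) (U l) := by
  rw [inner_eq_dotProduct, inner_eq_dotProduct]
  simp [linForms, Matrix.mul_apply, Fintype.sum_sum_type, dotProduct]

end Forms

theorem measurable_blockZ {n p : ℕ} : Measurable (blockZ (n := n) (p := p)) :=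
  measurable_pi_iff.2 fun _ => measurable_pi_apply _

theorem measurable_blockG {n p : ℕ} : Measurable (blockG (n := n) (p := p)) :=
  measurable_pi_apply _

theorem measurable_blockL {n p : ℕ} : Measurable (blockL (n := n) (p := p)) :=
  (WithLp.measurable_toLp 2 _).comp (measurable_pi_iff.2 fun _ => measurable_pi_apply _)

theorem measurable_blockR {n p : ℕ} : Measurable (blockR (n := n) (p := p)) :=
  (WithLp.measurable_toLp 2 _).comp (measurable_pi_iff.2 fun _ => measurable_pi_apply _)

/-- A norm is the supremum of inner products along a dense sequence of the sphere. This lets finite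
families of vectors stand in for the sphere in the comparison inequality. -/
theorem exists_lt_inner_of_lt_norm {m : ℕ} {v : ℕ → Metric.sphere (0 : EuclideanSpace ℝ (Fin m)) 1}
    (hv : DenseRange v) {b : EuclideanSpace ℝ (Fin m)} {r : ℝ} (h : r < ‖b‖) :
    ∃ j, r < inner ℝ (v j).1 b := by
  have hopen : IsOpen {x : Metric.sphere (0 : EuclideanSpace ℝ (Fin m)) 1 | r < inner ℝ x.1 b} :=
    isOpen_lt continuous_const (by fun_prop)
  refine (hv.exists_mem_open hopen ?_)
  by_cases hb : b = 0
  · refine ⟨v 0, ?_⟩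
    subst hb
    simpa using h
  · have hb' : ‖b‖ ≠ 0 := norm_ne_zero_iff.2 hb
    refine ⟨⟨‖b‖⁻¹ • b, by simp [norm_smul, hb']⟩, ?_⟩
    change r < inner ℝ (‖b‖⁻¹ • b) b
    rw [real_inner_smul_left, real_inner_self_eq_norm_sq, pow_two, inv_mul_cancel_left₀ hb']
    exact h

section Sphere

variable {n p : ℕ}

/-- Gordon's inequality with rows indexed by u and columns by v. The covariances of ⟪v, Zu⟫ + g and
⟪b, v⟫ + ⟪a, u⟫ differ by (1 - ⟪v, v'⟫)(1 - ⟪u, u'⟫), which is nonnegative and vanishes for u = u';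
the scalar g supplies the constant 1. The comparison needs finite index sets, so first the number of
v's and then the number of u's tends to infinity. -/
theorem measure_lt_sub_le_min [Nontrivial (EuclideanSpace ℝ (Fin n))]
    [Nontrivial (EuclideanSpace ℝ (Fin p))] {s t : ℝ} (hst : s < t) :
    (stdPi (CmpIdx n p)).real {w | t < ‖blockL w‖ - ‖blockR w‖}
      ≤ (stdPi (CmpIdx n p)).real
        {w | ∀ u : EuclideanSpace ℝ (Fin p), ‖u‖ = 1 →
          s ≤ ‖mulE (entryMatrix (blockZ w)) u‖ + blockG w} := by
  have : Nonempty (Metric.sphere (0 : EuclideanSpace ℝ (Fin n)) 1) :=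
    (NormedSpace.sphere_nonempty.2 zero_le_one).to_subtype
  have : Nonempty (Metric.sphere (0 : EuclideanSpace ℝ (Fin p)) 1) :=
    (NormedSpace.sphere_nonempty.2 zero_le_one).to_subtype
  set v := TopologicalSpace.denseSeq (Metric.sphere (0 : EuclideanSpace ℝ (Fin n)) 1)
  set u := TopologicalSpace.denseSeq (Metric.sphere (0 : EuclideanSpace ℝ (Fin p)) 1)
  have hv : DenseRange v := TopologicalSpace.denseRange_denseSeq _
  have hu : DenseRange u := TopologicalSpace.denseRange_denseSeq _
  have nv : ∀ j, ‖(v j).1‖ = 1 := fun j => by simp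
  have nu : ∀ j, ‖(u j).1‖ = 1 := fun j => by simp
  have hL := measurable_blockL (n := n) (p := p)
  have hR := measurable_blockR (n := n) (p := p)
  have hG := measurable_blockG (n := n) (p := p)
  have hZ : ∀ x, Measurable fun w : CmpIdx n p → ℝ => mulE (entryMatrix (blockZ w)) x := fun x =>
    continuous_mulE.measurable.comp (measurable_blockZ.prodMk measurable_const)
  have step1 : ∀ N, (stdPi (CmpIdx n p)).real {w | t < ‖blockL w‖ - ‖blockR w‖}
      ≤ (stdPi (CmpIdx n p)).real
        {w | ∀ i : Fin N, s ≤ ‖mulE (entryMatrix (blockZ w)) (u i).1‖ + blockG w} := by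
    intro N
    have hfin : ∀ L : ℕ, (stdPi (CmpIdx n p)).real
        {w | ∀ i : Fin N, ∃ j : Fin L, t ≤ inner ℝ (v j).1 (blockL w) + inner ℝ (u i).1 (blockR w)}
        ≤ (stdPi (CmpIdx n p)).real
        {w | ∀ i : Fin N, s ≤ ‖mulE (entryMatrix (blockZ w)) (u i).1‖ + blockG w} := by
      intro L
      have := gordon_comparison hst
        (bilinForms (fun k : Fin N × Fin L => (u k.1).1) (fun k => (v k.2).1))
        (linForms (fun k : Fin N × Fin L => (u k.1).1) (fun k => (v k.2).1))
        (bilinForms_mul_linForms_transpose _ _)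
        (fun i j j' => by
          rw [bilinForms_gram, linForms_gram]
          simp only [real_inner_self_eq_norm_sq, nu]; ring)
        (fun i i' j j' => by
          rw [bilinForms_gram, linForms_gram]
          have h1 := real_inner_le_norm (v j).1 (v j').1
          have h2 := real_inner_le_norm (u i).1 (u i').1
          rw [nv, nv, mul_one] at h1
          rw [nu, nu, mul_one] at h2
          nlinarith [mul_nonneg (sub_nonneg.2 h1) (sub_nonneg.2 h2)])
      simp only [bilinForms_mulVec, linForms_mulVec] at this
      refine this.trans (measureReal_mono fun w hw i => ?_)
      obtain ⟨j, hj⟩ := hw i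
      refine hj.le.trans (add_le_add_left ?_ _)
      have := real_inner_le_norm (v j).1 (mulE (entryMatrix (blockZ w)) (u i).1)
      rwa [nv, one_mul] at this
    have hmono : Monotone fun L : ℕ => {w : CmpIdx n p → ℝ | ∀ i : Fin N, ∃ j : Fin L,
        t ≤ inner ℝ (v j).1 (blockL w) + inner ℝ (u i).1 (blockR w)} := by
      intro L L' hLL w hw i
      obtain ⟨j, hj⟩ := hw i
      exact ⟨Fin.castLE hLL j, hj⟩
    have hlim := tendsto_measure_iUnion_atTop (μ := stdPi (CmpIdx n p)) hmono
    have hle : stdPi (CmpIdx n p) {w | t < ‖blockL w‖ - ‖blockR w‖}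
        ≤ stdPi (CmpIdx n p) {w | ∀ i : Fin N,
          s ≤ ‖mulE (entryMatrix (blockZ w)) (u i).1‖ + blockG w} := by
      refine (measure_mono ?_).trans (le_of_tendsto' hlim fun L => ?_)
      · intro w hw
        have hw' : t < ‖blockL w‖ - ‖blockR w‖ := hw
        -- The strict inequality leaves room to replace the maximizing direction b/‖b‖ by a member
        -- of the dense sequence. Only finitely many rows occur, so one L serves them all.
        have : ∀ i : Fin N, ∃ j, t < inner ℝ (v j).1 (blockL w) + inner ℝ (u i).1 (blockR w) := by
          intro i
          have h1 := abs_real_inner_le_norm (u i).1 (blockR w)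
          rw [nu, one_mul] at h1
          obtain ⟨j, hj⟩ := exists_lt_inner_of_lt_norm hv
            (r := t - inner ℝ (u i).1 (blockR w)) (b := blockL w)
            (by linarith [neg_le_of_abs_le h1])
          exact ⟨j, by linarith⟩
        choose J hJ using this
        refine Set.mem_iUnion.2 ⟨(Finset.univ.sup J) + 1, fun i => ?_⟩
        exact ⟨⟨J i, Nat.lt_succ_of_le (Finset.le_sup (Finset.mem_univ i))⟩, (hJ i).le⟩
      · exact (ENNReal.toReal_le_toReal (measure_ne_top _ _) (measure_ne_top _ _)).1 (hfin L)
    exact ENNReal.toReal_mono (measure_ne_top _ _) hle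
  have hanti : Antitone fun N : ℕ => {w : CmpIdx n p → ℝ | ∀ i : Fin N,
      s ≤ ‖mulE (entryMatrix (blockZ w)) (u i).1‖ + blockG w} := by
    intro N N' hNN w hw i
    exact hw (Fin.castLE hNN i)
  have hlim := tendsto_measure_iInter_atTop (μ := stdPi (CmpIdx n p))
    (fun N => (by
      simp only [Set.ofPred_forall]
      exact MeasurableSet.iInter fun i => measurableSet_le measurable_const
        (((hZ _).norm).add hG) : MeasurableSet {w : CmpIdx n p → ℝ | ∀ i : Fin N,
      s ≤ ‖mulE (entryMatrix (blockZ w)) (u i).1‖ + blockG w}).nullMeasurableSet)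
    hanti ⟨0, measure_ne_top _ _⟩
  refine ENNReal.toReal_mono (measure_ne_top _ _) ((ge_of_tendsto' hlim fun N => ?_).trans
    (measure_mono ?_))
  · exact (ENNReal.toReal_le_toReal (measure_ne_top _ _) (measure_ne_top _ _)).1 (step1 N)
  · intro w hw x hx
    have hcl : IsClosed {x : Metric.sphere (0 : EuclideanSpace ℝ (Fin p)) 1 |
        s ≤ ‖mulE (entryMatrix (blockZ w)) x.1‖ + blockG w} := by
      refine isClosed_le continuous_const (Continuous.add (Continuous.norm ?_) continuous_const)
      exact continuous_mulE.comp (by fun_prop : Continuous fun x :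
        Metric.sphere (0 : EuclideanSpace ℝ (Fin p)) 1 => (blockZ w, x.1))
    have hsub : Set.range u ⊆ {x : Metric.sphere (0 : EuclideanSpace ℝ (Fin p)) 1 |
        s ≤ ‖mulE (entryMatrix (blockZ w)) x.1‖ + blockG w} := by
      rintro _ ⟨i, rfl⟩
      exact Set.mem_iInter.1 hw (i + 1) ⟨i, Nat.lt_succ_self i⟩
    have := hcl.closure_subset_iff.2 hsub (hu.closure_range ▸ Set.mem_univ
      (⟨x, by simpa using hx⟩ : Metric.sphere (0 : EuclideanSpace ℝ (Fin p)) 1))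
    exact this

/-- The Slepian case of the comparison: each pair (u, v) is a row with a single column, and both
families are negated, which turns lower bounds for some entry of each row into upper bounds for all
entries. -/
theorem measure_add_le_le_max [Nontrivial (EuclideanSpace ℝ (Fin n))]
    [Nontrivial (EuclideanSpace ℝ (Fin p))] {s t : ℝ} (hst : s < t) :
    (stdPi (CmpIdx n p)).real {w | ‖blockL w‖ + ‖blockR w‖ ≤ s}
      ≤ (stdPi (CmpIdx n p)).real
        {w | ∀ u : EuclideanSpace ℝ (Fin p), ‖u‖ = 1 →
          ‖mulE (entryMatrix (blockZ w)) u‖ + blockG w ≤ t} := by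
  have : Nonempty (Metric.sphere (0 : EuclideanSpace ℝ (Fin n)) 1) :=
    (NormedSpace.sphere_nonempty.2 zero_le_one).to_subtype
  have : Nonempty (Metric.sphere (0 : EuclideanSpace ℝ (Fin p)) 1) :=
    (NormedSpace.sphere_nonempty.2 zero_le_one).to_subtype
  set v := TopologicalSpace.denseSeq (Metric.sphere (0 : EuclideanSpace ℝ (Fin n)) 1)
  set u := TopologicalSpace.denseSeq (Metric.sphere (0 : EuclideanSpace ℝ (Fin p)) 1)
  have hv : DenseRange v := TopologicalSpace.denseRange_denseSeq _
  have hu : DenseRange u := TopologicalSpace.denseRange_denseSeq _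
  have nv : ∀ j, ‖(v j).1‖ = 1 := fun j => by simp
  have nu : ∀ j, ‖(u j).1‖ = 1 := fun j => by simp
  have hG := measurable_blockG (n := n) (p := p)
  have hZ : ∀ x, Measurable fun w : CmpIdx n p → ℝ => mulE (entryMatrix (blockZ w)) x := fun x =>
    continuous_mulE.measurable.comp (measurable_blockZ.prodMk measurable_const)
  have step1 : ∀ N, (stdPi (CmpIdx n p)).real {w | ‖blockL w‖ + ‖blockR w‖ ≤ s}
      ≤ (stdPi (CmpIdx n p)).real {w | ∀ k : Fin N × Fin N,
        inner ℝ (v k.2).1 (mulE (entryMatrix (blockZ w)) (u k.1).1) + blockG w ≤ t} := by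
    intro N
    have := gordon_comparison (neg_lt_neg hst)
      (-bilinForms (fun k : (Fin N × Fin N) × Unit => (u k.1.1).1) (fun k => (v k.1.2).1))
      (-linForms (fun k : (Fin N × Fin N) × Unit => (u k.1.1).1) (fun k => (v k.1.2).1))
      (by rw [Matrix.transpose_neg, Matrix.neg_mul, Matrix.mul_neg, neg_neg]; exact bilinForms_mul_linForms_transpose _ _)
      (fun i j j' => by
        simp only [Matrix.transpose_neg, Matrix.neg_mul, Matrix.mul_neg, neg_neg,
          bilinForms_gram, linForms_gram]
        simp only [real_inner_self_eq_norm_sq, nu, nv]; norm_num)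
      (fun i i' j j' => by
        simp only [Matrix.transpose_neg, Matrix.neg_mul, Matrix.mul_neg, neg_neg,
          bilinForms_gram, linForms_gram]
        have h1 := real_inner_le_norm (v i.2).1 (v i'.2).1
        have h2 := real_inner_le_norm (u i.1).1 (u i'.1).1
        rw [nv, nv, mul_one] at h1
        rw [nu, nu, mul_one] at h2
        nlinarith [mul_nonneg (sub_nonneg.2 h1) (sub_nonneg.2 h2)])
    simp only [Matrix.neg_mulVec, Pi.neg_apply, bilinForms_mulVec, linForms_mulVec, neg_le_neg_iff,
      neg_lt_neg_iff] at this
    refine le_trans (measureReal_mono ?_) (this.trans (measureReal_mono ?_))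
    · intro w hw i
      refine ⟨(), ?_⟩
      have h1 := real_inner_le_norm (v i.2).1 (blockL w)
      have h2 := real_inner_le_norm (u i.1).1 (blockR w)
      rw [nv, one_mul] at h1
      rw [nu, one_mul] at h2
      exact (add_le_add h1 h2).trans hw
    · intro w hw i
      obtain ⟨-, hj⟩ := hw i
      exact hj.le
  have hanti : Antitone fun N : ℕ => {w : CmpIdx n p → ℝ | ∀ k : Fin N × Fin N,
      inner ℝ (v k.2).1 (mulE (entryMatrix (blockZ w)) (u k.1).1) + blockG w ≤ t} := by
    intro N N' hNN w hw i
    exact hw (Fin.castLE hNN i.1, Fin.castLE hNN i.2)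
  have hlim := tendsto_measure_iInter_atTop (μ := stdPi (CmpIdx n p))
    (fun N => (by
      simp only [Set.ofPred_forall]
      exact MeasurableSet.iInter fun i => measurableSet_le
        ((measurable_const.inner (hZ _)).add hG) measurable_const :
      MeasurableSet {w : CmpIdx n p → ℝ | ∀ k : Fin N × Fin N,
      inner ℝ (v k.2).1 (mulE (entryMatrix (blockZ w)) (u k.1).1) + blockG w ≤ t}).nullMeasurableSet)
    hanti ⟨0, measure_ne_top _ _⟩
  refine ENNReal.toReal_mono (measure_ne_top _ _) ((ge_of_tendsto' hlim fun N => ?_).trans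
    (measure_mono ?_))
  · exact (ENNReal.toReal_le_toReal (measure_ne_top _ _) (measure_ne_top _ _)).1 (step1 N)
  · intro w hw x hx
    have hcl : IsClosed {x : Metric.sphere (0 : EuclideanSpace ℝ (Fin p)) 1 |
        ‖mulE (entryMatrix (blockZ w)) x.1‖ + blockG w ≤ t} := by
      refine isClosed_le (Continuous.add (Continuous.norm ?_) continuous_const) continuous_const
      exact continuous_mulE.comp (by fun_prop : Continuous fun x :
        Metric.sphere (0 : EuclideanSpace ℝ (Fin p)) 1 => (blockZ w, x.1))
    have hsub : Set.range u ⊆ {x : Metric.sphere (0 : EuclideanSpace ℝ (Fin p)) 1 |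
        ‖mulE (entryMatrix (blockZ w)) x.1‖ + blockG w ≤ t} := by
      rintro _ ⟨i, rfl⟩
      by_contra hcon
      have hcon' : t - blockG w < ‖mulE (entryMatrix (blockZ w)) (u i).1‖ := by
        have := not_le.1 (show ¬ ‖mulE (entryMatrix (blockZ w)) (u i).1‖ + blockG w ≤ t from hcon)
        linarith
      obtain ⟨j, hj⟩ := exists_lt_inner_of_lt_norm hv hcon'
      have := Set.mem_iInter.1 hw (max i j + 1) (⟨i, by omega⟩, ⟨j, by omega⟩)
      have h2 : inner ℝ (v j).1 (mulE (entryMatrix (blockZ w)) (u i).1) + blockG w ≤ t := this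
      linarith
    have := hcl.closure_subset_iff.2 hsub (hu.closure_range ▸ Set.mem_univ
      (⟨x, by simpa using hx⟩ : Metric.sphere (0 : EuclideanSpace ℝ (Fin p)) 1))
    exact this

end Sphere

theorem measurePreserving_sum_stdPi (I J : Type*) [Fintype I] [Fintype J] :
    MeasurePreserving (fun w : I ⊕ J → ℝ => (fun i => w (Sum.inl i), fun j => w (Sum.inr j)))
      (stdPi (I ⊕ J)) ((stdPi I).prod (stdPi J)) :=
  measurePreserving_sumPiEquivProdPi (X := fun _ : I ⊕ J => ℝ) (fun _ => gaussianReal 0 1)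

theorem measurePreserving_inl_stdPi (I J : Type*) [Fintype I] [Fintype J] :
    MeasurePreserving (fun (w : I ⊕ J → ℝ) i => w (Sum.inl i)) (stdPi (I ⊕ J)) (stdPi I) :=
  measurePreserving_fst.comp (measurePreserving_sum_stdPi I J)

theorem measurePreserving_inr_stdPi (I J : Type*) [Fintype I] [Fintype J] :
    MeasurePreserving (fun (w : I ⊕ J → ℝ) j => w (Sum.inr j)) (stdPi (I ⊕ J)) (stdPi J) :=
  measurePreserving_snd.comp (measurePreserving_sum_stdPi I J)

section Blocks

variable {n p : ℕ}

theorem measurePreserving_blockZ_blockG :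
    MeasurePreserving (fun w : CmpIdx n p → ℝ => (blockZ w, blockG w)) (stdPi (CmpIdx n p))
      ((stdPi (Fin n × Fin p)).prod (gaussianReal 0 1)) := by
  have h1 := measurePreserving_sum_stdPi (Fin n × Fin p) (Unit ⊕ (Fin n ⊕ Fin p))
  have h2 : MeasurePreserving (fun w : Unit ⊕ (Fin n ⊕ Fin p) → ℝ => w (Sum.inl ()))
      (stdPi (Unit ⊕ (Fin n ⊕ Fin p))) (gaussianReal 0 1) :=
    measurePreserving_eval (fun _ : Unit ⊕ (Fin n ⊕ Fin p) => gaussianReal 0 1) (Sum.inl ())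
  exact ((MeasurePreserving.id _).prod h2).comp h1

theorem measurePreserving_blockL_coord :
    MeasurePreserving (fun w : CmpIdx n p → ℝ => (blockL w).ofLp) (stdPi (CmpIdx n p))
      (stdPi (Fin n)) :=
  (measurePreserving_inl_stdPi _ _).comp
    ((measurePreserving_inr_stdPi _ _).comp (measurePreserving_inr_stdPi _ _))

theorem measurePreserving_blockR_coord :
    MeasurePreserving (fun w : CmpIdx n p → ℝ => (blockR w).ofLp) (stdPi (CmpIdx n p))
      (stdPi (Fin p)) :=
  (measurePreserving_inr_stdPi _ _).comp
    ((measurePreserving_inr_stdPi _ _).comp (measurePreserving_inr_stdPi _ _))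

end Blocks

theorem gaussianReal_real_pos {s : Set ℝ} (hs : 0 < (volume : Measure ℝ) s) :
    0 < (gaussianReal 0 1).real s := by
  refine ENNReal.toReal_pos (fun h => hs.ne' ?_) (measure_ne_top _ _)
  exact gaussianReal_absolutelyContinuous' 0 one_ne_zero h

/-- Chebyshev's inequality for the squared norm of a standard Gaussian vector. -/
theorem exists_sum_sq_concentration : ∃ V : ℝ, 0 ≤ V ∧ ∀ (m : ℕ) (c : ℝ), 0 < c →
    (stdPi (Fin m)).real {x | c ≤ |∑ i, x i ^ 2 - m|} ≤ m * V / c ^ 2 := by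
  have hm4 : MemLp (fun x : ℝ => x ^ 2) 2 (gaussianReal 0 1) := by
    have h4 : MemLp (id : ℝ → ℝ) 4 (gaussianReal 0 1) := memLp_id_gaussianReal' 4 (by norm_num)
    have := h4.norm_rpow_div (q := 2)
    have e : (4 : ℝ≥0∞) / 2 = 2 := by
      rw [show (4 : ℝ≥0∞) = 2 * 2 by norm_num]; exact ENNReal.mul_div_cancel_right (by norm_num) (by norm_num)
    rw [e] at this
    refine this.congr_norm (by fun_prop) (ae_of_all _ fun x => ?_)
    simp
  have hmean : ∫ x, x ^ 2 ∂(gaussianReal 0 1) = 1 := by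
    have h := variance_eq_sub (memLp_id_gaussianReal' (μ := 0) (v := 1) 2 (by norm_num))
    rw [variance_id_gaussianReal] at h
    simp only [id_eq, integral_id_gaussianReal] at h
    simpa using h.symm
  refine ⟨Var[fun x : ℝ => x ^ 2; gaussianReal 0 1], variance_nonneg _ _, fun m c hc => ?_⟩
  have hmp : ∀ i, MeasurePreserving (fun x : Fin m → ℝ => x i) (stdPi (Fin m)) (gaussianReal 0 1) :=
    fun i => measurePreserving_eval (fun _ : Fin m => gaussianReal 0 1) i
  have hL : ∀ i, MemLp (fun x : Fin m → ℝ => x i ^ 2) 2 (stdPi (Fin m)) := fun i =>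
    hm4.comp_measurePreserving (hmp i)
  have hsum : MemLp (fun x : Fin m → ℝ => ∑ i, x i ^ 2) 2 (stdPi (Fin m)) :=
    memLp_finsetSum _ fun i _ => hL i
  have hE : ∫ x, ∑ i, x i ^ 2 ∂(stdPi (Fin m)) = m := by
    rw [integral_finsetSum _ fun i _ => (hL i).integrable (by norm_num)]
    have : ∀ i, ∫ x, x i ^ 2 ∂(stdPi (Fin m)) = 1 := fun i => by
      rw [← hmean, ← (hmp i).map_eq, integral_map (hmp i).measurable.aemeasurable (by fun_prop)]
    simp [this]
  have hV : Var[fun x : Fin m → ℝ => ∑ i, x i ^ 2; stdPi (Fin m)]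
      = m * Var[fun x : ℝ => x ^ 2; gaussianReal 0 1] := by
    have := variance_sum_pi (μ := fun _ : Fin m => gaussianReal 0 1)
      (X := fun _ : Fin m => fun x : ℝ => x ^ 2) (fun i => hm4)
    simp only [Finset.sum_const, Finset.card_univ, Fintype.card_fin, nsmul_eq_mul] at this
    rw [← this]
    congr 1
    ext x; simp
  have := meas_ge_le_variance_div_sq hsum hc
  rw [hE, hV] at this
  refine ENNReal.toReal_le_of_le_ofReal ?_ this
  exact div_nonneg (mul_nonneg (Nat.cast_nonneg _) (variance_nonneg _ _)) (sq_nonneg _)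

section Extreme

variable {n p : ℕ}

theorem isClosed_forall_le_mulE (s : ℝ) : IsClosed {z : Fin n × Fin p → ℝ |
    ∀ u : EuclideanSpace ℝ (Fin p), ‖u‖ = 1 → s ≤ ‖mulE (entryMatrix z) u‖} := by
  simp only [Set.ofPred_forall]
  exact isClosed_iInter fun u => isClosed_iInter fun _ => isClosed_le continuous_const
    (continuous_mulE.comp (by fun_prop : Continuous fun z : Fin n × Fin p → ℝ => (z, u))).norm

theorem isClosed_forall_mulE_le (s : ℝ) : IsClosed {z : Fin n × Fin p → ℝ |
    ∀ u : EuclideanSpace ℝ (Fin p), ‖u‖ = 1 → ‖mulE (entryMatrix z) u‖ ≤ s} := by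
  simp only [Set.ofPred_forall]
  exact isClosed_iInter fun u => isClosed_iInter fun _ => isClosed_le
    (continuous_mulE.comp (by fun_prop : Continuous fun z : Fin n × Fin p → ℝ => (z, u))).norm
    continuous_const

/-- A product event of the blocks `Z` and `g` that is disjoint from an event of large probability
has small probability. -/
theorem measure_mul_le_of_disjoint {B : Set (Fin n × Fin p → ℝ)} {G : Set ℝ}
    {F E : Set (CmpIdx n p → ℝ)} (hB : MeasurableSet B) (hG : MeasurableSet G) (hE : MeasurableSet E)
    (hd : ∀ w ∈ F, blockZ w ∈ B → blockG w ∉ G)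
    (hEF : (stdPi (CmpIdx n p)).real E ≤ (stdPi (CmpIdx n p)).real F) :
    (stdPi (Fin n × Fin p)).real B * (gaussianReal 0 1).real G
      ≤ (stdPi (CmpIdx n p)).real Eᶜ := by
  have hmp := measurePreserving_blockZ_blockG (n := n) (p := p)
  have h1 : (stdPi (Fin n × Fin p)).real B * (gaussianReal 0 1).real G
      = (stdPi (CmpIdx n p)).real ((fun w => (blockZ w, blockG w)) ⁻¹' (B ×ˢ G)) := by
    rw [measureReal_def, measureReal_def, measureReal_def, ← ENNReal.toReal_mul,
      ← Measure.prod_prod, hmp.measure_preimage (hB.prod hG).nullMeasurableSet]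
  have h2 : Disjoint F ((fun w : CmpIdx n p → ℝ => (blockZ w, blockG w)) ⁻¹' (B ×ˢ G)) :=
    Set.disjoint_left.2 fun w hw hw' => hd w hw hw'.1 hw'.2
  have h3 := measureReal_union (μ := stdPi (CmpIdx n p)) h2 (hmp.measurable (hB.prod hG))
  have h4 : (stdPi (CmpIdx n p)).real
      (F ∪ ((fun w => (blockZ w, blockG w)) ⁻¹' (B ×ˢ G))) ≤ 1 := measureReal_le_one
  rw [probReal_compl_eq_one_sub hE, h1]
  linarith

/-- The event that the two vector blocks have nearly their expected norms. -/
def normEvent (n p : ℕ) (ε : ℝ) : Set (CmpIdx n p → ℝ) :=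
  {w | |‖blockL w‖ ^ 2 - n| < ε * n ∧ |‖blockR w‖ ^ 2 - p| < ε * n}

theorem measurableSet_normEvent (ε : ℝ) : MeasurableSet (normEvent n p ε) := by
  have hL := measurable_blockL (n := n) (p := p)
  have hR := measurable_blockR (n := n) (p := p)
  exact (measurableSet_lt (((hL.norm.pow_const 2).sub_const _).abs) measurable_const).inter
    (measurableSet_lt (((hR.norm.pow_const 2).sub_const _).abs) measurable_const)

end Extreme

/-- By Chebyshev's inequality the two deviations have probability at most nV/(εn)² and pV/(εn)², and
both vanish because p/n stays bounded. -/
theorem tendsto_normEvent_compl {τ : ℝ} {p : ℕ → ℕ}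
    (hpn : Tendsto (fun n => (p n : ℝ) / (n : ℝ)) atTop (𝓝 τ)) {ε : ℝ} (hε : 0 < ε) :
    Tendsto (fun n => (stdPi (CmpIdx n (p n))).real (normEvent n (p n) ε)ᶜ) atTop (𝓝 0) := by
  obtain ⟨V, hV0, hV⟩ := exists_sum_sq_concentration
  have hlim : Tendsto (fun n : ℕ => (1 + (p n : ℝ) / n) * (V / ε ^ 2) * ((n : ℝ))⁻¹) atTop (𝓝 0) := by
    have := ((hpn.const_add 1).mul_const (V / ε ^ 2)).mul (tendsto_inv_atTop_nhds_zero_nat (𝕜 := ℝ))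
    simpa using this
  refine tendsto_of_tendsto_of_tendsto_of_le_of_le' tendsto_const_nhds hlim
    (Eventually.of_forall fun n => measureReal_nonneg) ?_
  filter_upwards [eventually_gt_atTop 0] with n hn
  have hn' : (0 : ℝ) < n := by exact_mod_cast hn
  have hsub : (normEvent n (p n) ε)ᶜ ⊆
      ((fun w : CmpIdx n (p n) → ℝ => (blockL w).ofLp) ⁻¹' {x | ε * n ≤ |∑ i, x i ^ 2 - (n : ℝ)|}) ∪
      ((fun w : CmpIdx n (p n) → ℝ => (blockR w).ofLp) ⁻¹' {x | ε * n ≤ |∑ i, x i ^ 2 - (p n : ℝ)|}) := by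
    intro w hw
    simp only [normEvent, Set.mem_compl_iff, Set.mem_ofPred_eq, not_and_or, not_lt,
      EuclideanSpace.real_norm_sq_eq] at hw
    exact hw
  have hms : ∀ m : ℕ, ∀ c : ℝ, MeasurableSet {x : Fin m → ℝ | c ≤ |∑ i, x i ^ 2 - (m : ℝ)|} :=
    fun m c => (isClosed_le continuous_const (by fun_prop)).measurableSet
  have h1 := hV n (ε * n) (by positivity)
  have h2 := hV (p n) (ε * n) (by positivity)
  rw [← (measurePreserving_blockL_coord (n := n) (p := p n)).measureReal_preimage
    (hms _ _).nullMeasurableSet] at h1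
  rw [← (measurePreserving_blockR_coord (n := n) (p := p n)).measureReal_preimage
    (hms _ _).nullMeasurableSet] at h2
  refine (measureReal_mono hsub).trans ((measureReal_union_le _ _).trans
    ((add_le_add h1 h2).trans (le_of_eq ?_)))
  field_simp

theorem nontrivial_euclidean {m : ℕ} (hm : 0 < m) : Nontrivial (EuclideanSpace ℝ (Fin m)) := by
  have : Nonempty (Fin m) := ⟨⟨0, hm⟩⟩
  infer_instance

/-- The smallest singular value of an `n × p` Gaussian matrix is at least `r √n` for every
`r < 1 - √τ`, with probability tending to one. -/
theorem tendsto_min_singular {τ : ℝ} {p : ℕ → ℕ} (hp : ∀ n, 1 ≤ p n)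
    (hpn : Tendsto (fun n => (p n : ℝ) / (n : ℝ)) atTop (𝓝 τ)) {r : ℝ} (hr : r < 1 - √τ) :
    Tendsto (fun n => (stdPi (Fin n × Fin (p n))).real
      {z | ∀ u : EuclideanSpace ℝ (Fin (p n)), ‖u‖ = 1 → r * √n ≤ ‖mulE (entryMatrix z) u‖}ᶜ)
      atTop (𝓝 0) := by
  obtain ⟨r', hr1, hr2⟩ := exists_between hr
  -- On the norm event ‖b‖ ≥ √(1 - ε) √n and ‖a‖ ≤ √(τ + 2ε) √n. One ε in 2ε absorbs the distance of
  -- p/n from τ, the other the fluctuation of ‖a‖².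
  have hcont : Tendsto (fun ε : ℝ => √(1 - ε) - √(τ + 2 * ε)) (𝓝[>] 0) (𝓝 (1 - √τ)) := by
    have : Continuous fun ε : ℝ => √(1 - ε) - √(τ + 2 * ε) := by fun_prop
    have := (this.tendsto 0).mono_left (nhdsWithin_le_nhds (s := Set.Ioi 0))
    simpa using this
  obtain ⟨ε, hε1, hε0⟩ := ((hcont.eventually_const_lt hr2).and self_mem_nhdsWithin).exists
  have hε0 : 0 < ε := hε0
  have hE := tendsto_normEvent_compl hpn hε0
  -- This removes the auxiliary scalar g. It is independent of Z and nonpositive with probability c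
  -- > 0, and a small singular value together with g ≤ 0 violates the comparison event. So the bad
  -- event for Z has probability at most that of the failing norm event, divided by c.
  set c := (gaussianReal 0 1).real (Set.Iic 0)
  have hc : 0 < c := gaussianReal_real_pos (by simp)
  have hlim := hE.div_const c
  rw [zero_div] at hlim
  refine tendsto_of_tendsto_of_tendsto_of_le_of_le' tendsto_const_nhds hlim
    (Eventually.of_forall fun n => measureReal_nonneg) ?_
  filter_upwards [eventually_gt_atTop 0, hpn.eventually_lt_const (show τ < τ + ε by linarith)]
    with n hn hpn'
  have hn' : (0 : ℝ) < n := by exact_mod_cast hn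
  have hsn : 0 < √(n : ℝ) := Real.sqrt_pos.2 hn'
  have := nontrivial_euclidean hn
  have := nontrivial_euclidean (hp n)
  rw [le_div_iff₀ hc]
  rw [div_lt_iff₀ hn'] at hpn'
  refine measure_mul_le_of_disjoint (isClosed_forall_le_mulE _).measurableSet.compl measurableSet_Iic
    (measurableSet_normEvent ε) ?_ ((measureReal_mono ?_).trans
      (measure_lt_sub_le_min (s := r * √n) (t := r' * √n) (mul_lt_mul_of_pos_right hr1 hsn)))
  · intro w hw hb hg
    refine hb fun u hu => ?_
    have h1 := hw u hu
    have h2 : blockG w ≤ 0 := hg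
    linarith
  · rintro w ⟨h1, h2⟩
    rw [abs_lt] at h1 h2
    have h3 : √(1 - ε) * √n ≤ ‖blockL w‖ := by
      rw [← Real.sqrt_mul' _ hn'.le]
      exact Real.sqrt_le_iff.2 ⟨norm_nonneg _, by nlinarith⟩
    have h4 : ‖blockR w‖ ≤ √(τ + 2 * ε) * √n := by
      rw [← Real.sqrt_mul' _ hn'.le]
      exact Real.le_sqrt_of_sq_le (by nlinarith)
    have h5 := mul_lt_mul_of_pos_right hε1 hsn
    change r' * √n < ‖blockL w‖ - ‖blockR w‖
    nlinarith

/-- The largest singular value of an `n × p` Gaussian matrix is at most `r √n` for every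
`r > 1 + √τ`, with probability tending to one. -/
theorem tendsto_max_singular {τ : ℝ} {p : ℕ → ℕ} (hp : ∀ n, 1 ≤ p n)
    (hpn : Tendsto (fun n => (p n : ℝ) / (n : ℝ)) atTop (𝓝 τ)) {r : ℝ} (hr : 1 + √τ < r) :
    Tendsto (fun n => (stdPi (Fin n × Fin (p n))).real
      {z | ∀ u : EuclideanSpace ℝ (Fin (p n)), ‖u‖ = 1 → ‖mulE (entryMatrix z) u‖ ≤ r * √n}ᶜ)
      atTop (𝓝 0) := by
  obtain ⟨r', hr1, hr2⟩ := exists_between hr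
  have hcont : Tendsto (fun ε : ℝ => √(1 + ε) + √(τ + 2 * ε)) (𝓝[>] 0) (𝓝 (1 + √τ)) := by
    have : Continuous fun ε : ℝ => √(1 + ε) + √(τ + 2 * ε) := by fun_prop
    have := (this.tendsto 0).mono_left (nhdsWithin_le_nhds (s := Set.Ioi 0))
    simpa using this
  obtain ⟨ε, hε1, hε0⟩ := ((hcont.eventually_lt_const hr1).and self_mem_nhdsWithin).exists
  have hε0 : 0 < ε := hε0
  have hE := tendsto_normEvent_compl hpn hε0
  -- For the upper bound g is removed on the opposite half-line: a large singular value together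
  -- with g ≥ 0 violates the comparison event.
  set c := (gaussianReal 0 1).real (Set.Ici 0)
  have hc : 0 < c := gaussianReal_real_pos (by simp)
  have hlim := hE.div_const c
  rw [zero_div] at hlim
  refine tendsto_of_tendsto_of_tendsto_of_le_of_le' tendsto_const_nhds hlim
    (Eventually.of_forall fun n => measureReal_nonneg) ?_
  filter_upwards [eventually_gt_atTop 0, hpn.eventually_lt_const (show τ < τ + ε by linarith)]
    with n hn hpn'
  have hn' : (0 : ℝ) < n := by exact_mod_cast hn
  have hsn : 0 < √(n : ℝ) := Real.sqrt_pos.2 hn'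
  have := nontrivial_euclidean hn
  have := nontrivial_euclidean (hp n)
  rw [le_div_iff₀ hc]
  rw [div_lt_iff₀ hn'] at hpn'
  refine measure_mul_le_of_disjoint (isClosed_forall_mulE_le _).measurableSet.compl measurableSet_Ici
    (measurableSet_normEvent ε) ?_ ((measureReal_mono ?_).trans
      (measure_add_le_le_max (s := r' * √n) (t := r * √n) (mul_lt_mul_of_pos_right hr2 hsn)))
  · intro w hw hb hg
    refine hb fun u hu => ?_
    have h1 := hw u hu
    have h2 : 0 ≤ blockG w := hg
    linarith
  · rintro w ⟨h1, h2⟩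
    rw [abs_lt] at h1 h2
    have h3 : ‖blockL w‖ ≤ √(1 + ε) * √n := by
      rw [← Real.sqrt_mul' _ hn'.le]
      exact Real.le_sqrt_of_sq_le (by nlinarith)
    have h4 : ‖blockR w‖ ≤ √(τ + 2 * ε) * √n := by
      rw [← Real.sqrt_mul' _ hn'.le]
      exact Real.le_sqrt_of_sq_le (by nlinarith)
    have h5 := mul_lt_mul_of_pos_right hε1 hsn
    change ‖blockL w‖ + ‖blockR w‖ ≤ r' * √n
    nlinarith

/-! ### Spectral norms and the square root of the covariance -/

section Spectral

open scoped Matrix.Norms.L2Operator MatrixOrder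

theorem specNorm_eq_norm {m : ℕ} (A : Matrix (Fin m) (Fin m) ℝ) : specNorm A = ‖A‖ := rfl

theorem norm_mulE_le {n p : ℕ} (A : Matrix (Fin n) (Fin p) ℝ) (u : EuclideanSpace ℝ (Fin p)) :
    ‖mulE A u‖ ≤ ‖A‖ * ‖u‖ :=
  Matrix.l2_opNorm_mulVec A u

theorem norm_le_of_mulE_le {n p : ℕ} {A : Matrix (Fin n) (Fin p) ℝ} {r : ℝ} (hr : 0 ≤ r)
    (h : ∀ u, ‖mulE A u‖ ≤ r * ‖u‖) : ‖A‖ ≤ r := by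
  rw [Matrix.l2_opNorm_def]
  exact ContinuousLinearMap.opNorm_le_bound _ hr h

theorem norm_transpose_mul_self {n p : ℕ} (A : Matrix (Fin n) (Fin p) ℝ) :
    ‖Aᵀ * A‖ = ‖A‖ * ‖A‖ := by
  rw [← Matrix.l2_opNorm_conjTranspose_mul_self, Matrix.conjTranspose_eq_transpose_of_trivial]

theorem norm_transpose {n p : ℕ} (A : Matrix (Fin n) (Fin p) ℝ) : ‖Aᵀ‖ = ‖A‖ := by
  rw [← Matrix.l2_opNorm_conjTranspose, Matrix.conjTranspose_eq_transpose_of_trivial]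
  simp

/-- Conjugation by the eigenvector unitary preserves the operator norm, so both norms are read off
from diagonal matrices. The absolute value of b covers the empty matrix, for which nothing forces b
to be positive. -/
theorem spectral_bounds {m : ℕ} {A : Matrix (Fin m) (Fin m) ℝ} (h : A.IsHermitian) {a b : ℝ}
    (ha : 0 < a) (hab : ∀ i, a < h.eigenvalues i ∧ h.eigenvalues i < b) :
    A.PosDef ∧ specNorm A ≤ |b| ∧ specNorm A⁻¹ ≤ a⁻¹ := by
  have hpd : A.PosDef := h.posDef_iff_eigenvalues_pos.2 fun i => ha.trans (hab i).1
  set φ := Unitary.conjStarAlgAut ℝ (Matrix (Fin m) (Fin m) ℝ) h.eigenvectorUnitary with hφ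
  have hA : A = φ (Matrix.diagonal h.eigenvalues) := h.spectral_theorem
  have hnorm : ∀ B, ‖φ B‖ = ‖B‖ := fun B => by
    rw [hφ, Unitary.conjStarAlgAut_apply, CStarRing.norm_mul_mem_unitary,
      CStarRing.norm_coe_unitary_mul]
    exact Unitary.star_mem h.eigenvectorUnitary.2
  have hinv : A⁻¹ = φ (Matrix.diagonal fun i => (h.eigenvalues i)⁻¹) := by
    refine Matrix.inv_eq_left_inv ?_
    refine (congrArg (φ (Matrix.diagonal fun i => (h.eigenvalues i)⁻¹) * ·) hA).trans ?_
    rw [← map_mul, Matrix.diagonal_mul_diagonal]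
    have : (fun i => (h.eigenvalues i)⁻¹ * h.eigenvalues i) = fun _ => 1 := by
      ext i; exact inv_mul_cancel₀ (ha.trans (hab i).1).ne'
    rw [this, Matrix.diagonal_one, map_one]
  refine ⟨hpd, ?_, ?_⟩
  · rw [specNorm_eq_norm]
    conv_lhs => rw [hA]
    rw [hnorm, Matrix.l2_opNorm_diagonal]
    refine (pi_norm_le_iff_of_nonneg (abs_nonneg _)).2 fun i => ?_
    rw [Real.norm_eq_abs, abs_of_pos (ha.trans (hab i).1)]
    exact (hab i).2.le.trans (le_abs_self b)
  · rw [specNorm_eq_norm, hinv, hnorm, Matrix.l2_opNorm_diagonal]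
    refine (pi_norm_le_iff_of_nonneg (by positivity)).2 fun i => ?_
    rw [norm_inv, Real.norm_eq_abs, abs_of_pos (ha.trans (hab i).1)]
    exact inv_anti₀ ha (hab i).1.le

/-- The positive square root of the covariance matrix. -/
noncomputable def root {p : ℕ} (S : Matrix (Fin p) (Fin p) ℝ) : Matrix (Fin p) (Fin p) ℝ :=
  CFC.sqrt S

theorem root_transpose {p : ℕ} (S : Matrix (Fin p) (Fin p) ℝ) : (root S)ᵀ = root S := by
  have : (root S).IsHermitian := (Matrix.nonneg_iff_posSemidef.1 (CFC.sqrt_nonneg S)).isHermitian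
  rwa [Matrix.IsHermitian, Matrix.conjTranspose_eq_transpose_of_trivial] at this

theorem root_mul_root {p : ℕ} {S : Matrix (Fin p) (Fin p) ℝ} (hS : S.PosDef) :
    root S * root S = S :=
  CFC.sqrt_mul_sqrt_self S hS.posSemidef.nonneg

theorem isUnit_det_root {p : ℕ} {S : Matrix (Fin p) (Fin p) ℝ} (hS : S.PosDef) :
    IsUnit (root S).det := by
  have := hS.det_pos.ne'
  rw [← root_mul_root hS, Matrix.det_mul] at this
  exact (left_ne_zero_of_mul this).isUnit

theorem norm_root_sq {p : ℕ} {S : Matrix (Fin p) (Fin p) ℝ} (hS : S.PosDef) :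
    ‖root S‖ ^ 2 = specNorm S := by
  rw [pow_two, ← norm_transpose_mul_self, root_transpose, root_mul_root hS, specNorm_eq_norm]

theorem norm_root_inv_sq {p : ℕ} {S : Matrix (Fin p) (Fin p) ℝ} (hS : S.PosDef) :
    ‖(root S)⁻¹‖ ^ 2 = specNorm S⁻¹ := by
  rw [pow_two, ← norm_transpose_mul_self, Matrix.transpose_nonsing_inv, root_transpose,
    ← Matrix.mul_inv_rev, root_mul_root hS, specNorm_eq_norm]

theorem mulE_mul {n p q : ℕ} (A : Matrix (Fin n) (Fin p) ℝ) (B : Matrix (Fin p) (Fin q) ℝ)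
    (u : EuclideanSpace ℝ (Fin q)) : mulE (A * B) u = mulE A (mulE B u) := by
  simp [mulE, Matrix.mulVec_mulVec]

theorem mulE_one {p : ℕ} (u : EuclideanSpace ℝ (Fin p)) :
    mulE (1 : Matrix (Fin p) (Fin p) ℝ) u = u := by
  simp [mulE]

theorem inner_mulE_transpose {n p : ℕ} (A : Matrix (Fin n) (Fin p) ℝ)
    (u : EuclideanSpace ℝ (Fin p)) (v : EuclideanSpace ℝ (Fin n)) :
    inner ℝ u (mulE Aᵀ v) = inner ℝ (mulE A u) v := by
  rw [inner_mulE, Matrix.mulVec_transpose, dotProduct_comm, ← Matrix.dotProduct_mulVec,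
    ← inner_mulE, real_inner_comm]

theorem norm_mulE_sq {n p : ℕ} (A : Matrix (Fin n) (Fin p) ℝ) (u : EuclideanSpace ℝ (Fin p)) :
    ‖mulE A u‖ ^ 2 = inner ℝ u (mulE (Aᵀ * A) u) := by
  rw [mulE_mul, inner_mulE_transpose, real_inner_self_eq_norm_sq]

/-- A matrix bounded below has an invertible Gram matrix, with a bound for the inverse. -/
theorem isUnit_gram_of_le_mulE {n p : ℕ} {Z : Matrix (Fin n) (Fin p) ℝ} {s : ℝ} (hs : 0 < s)
    (h : ∀ u, s * ‖u‖ ≤ ‖mulE Z u‖) : IsUnit (Zᵀ * Z).det ∧ ‖(Zᵀ * Z)⁻¹‖ ≤ (s ^ 2)⁻¹ := by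
  have hunit : IsUnit (Zᵀ * Z).det := by
    rw [← Matrix.isUnit_iff_isUnit_det, ← Matrix.mulVec_injective_iff_isUnit]
    refine (injective_iff_map_eq_zero (Matrix.mulVecLin (Zᵀ * Z))).2 fun u hu => ?_
    have h1 : mulE (Zᵀ * Z) (WithLp.toLp 2 u) = 0 := by
      have h0 : (Zᵀ * Z) *ᵥ u = 0 := hu
      simp [mulE, h0]
    have h2 := norm_mulE_sq Z (WithLp.toLp 2 u)
    rw [h1, inner_zero_right] at h2
    have h3 := h (WithLp.toLp 2 u)
    rw [pow_eq_zero_iff two_ne_zero] at h2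
    rw [h2] at h3
    have h4 : ‖WithLp.toLp 2 u‖ = 0 :=
      le_antisymm (nonpos_of_mul_nonpos_right h3 hs) (norm_nonneg _)
    have h5 : (WithLp.toLp 2 u : EuclideanSpace ℝ (Fin p)) = 0 := norm_eq_zero.1 h4
    simpa using congrArg WithLp.ofLp h5
  refine ⟨hunit, norm_le_of_mulE_le (by positivity) fun x => ?_⟩
  set y := mulE (Zᵀ * Z)⁻¹ x with hy
  have hx : mulE (Zᵀ * Z) y = x := by
    rw [hy, ← mulE_mul, Matrix.mul_nonsing_inv _ hunit, mulE_one]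
  have h1 := h y
  have h2 := norm_mulE_sq Z y
  rw [hx] at h2
  have h3 := real_inner_le_norm y x
  have h4 : (s * ‖y‖) ^ 2 ≤ ‖y‖ * ‖x‖ :=
    (pow_le_pow_left₀ (by positivity) h1 2).trans (h2.le.trans h3)
  rw [inv_mul_eq_div, le_div_iff₀ (by positivity)]
  by_cases hy0 : ‖y‖ = 0
  · rw [hy0]; simp
  · have : 0 < ‖y‖ := lt_of_le_of_ne (norm_nonneg _) (Ne.symm hy0)
    nlinarith

end Spectral

/-! ### The design as a linear image of a standard Gaussian matrix -/

section Law

/-- The design with rows `root S * Zᵢ`. -/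
noncomputable def designOf {n p : ℕ} (S : Matrix (Fin p) (Fin p) ℝ) (z : Fin n × Fin p → ℝ) :
    Design n p :=
  fun i => Matrix.toEuclideanCLM (𝕜 := ℝ) (root S) (WithLp.toLp 2 fun j => z (i, j))

theorem measurable_designOf {n p : ℕ} (S : Matrix (Fin p) (Fin p) ℝ) :
    Measurable (designOf (n := n) S) := by
  refine measurable_pi_iff.2 fun i => ?_
  exact (Matrix.toEuclideanCLM (𝕜 := ℝ) (root S)).measurable.comp
    ((WithLp.measurable_toLp 2 _).comp (measurable_pi_iff.2 fun _ => measurable_pi_apply _))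

theorem designMatrix_designOf {n p : ℕ} (S : Matrix (Fin p) (Fin p) ℝ) (z : Fin n × Fin p → ℝ) :
    designMatrix (designOf S z) = entryMatrix z * root S := by
  ext i j
  have : (designOf S z i).ofLp j = (root S *ᵥ fun j => z (i, j)) j := by
    simp [designOf]
  simp only [designMatrix, Matrix.of_apply, this, Matrix.mul_apply, Matrix.mulVec, dotProduct,
    entryMatrix]
  refine Finset.sum_congr rfl fun k _ => ?_
  conv_lhs => rw [← root_transpose S, Matrix.transpose_apply]
  ring

theorem gram_designOf {n p : ℕ} (S : Matrix (Fin p) (Fin p) ℝ) (z : Fin n × Fin p → ℝ) :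
    gram (designOf S z) = root S * ((entryMatrix z)ᵀ * entryMatrix z) * root S := by
  rw [gram, designMatrix_designOf, Matrix.transpose_mul, root_transpose]
  simp only [Matrix.mul_assoc]

theorem map_curry_stdPi (n p : ℕ) :
    (stdPi (Fin n × Fin p)).map (fun z i j => z (i, j))
      = Measure.pi fun _ : Fin n => stdPi (Fin p) := by
  have hm : Measurable (fun (y : Fin n → Fin p → ℝ) (q : Fin n × Fin p) => y q.1 q.2) :=
    measurable_pi_iff.2 fun q => (measurable_pi_apply q.2).comp (measurable_pi_apply q.1)
  have hm' : Measurable (fun (z : Fin n × Fin p → ℝ) i j => z (i, j)) :=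
    measurable_pi_iff.2 fun i => measurable_pi_iff.2 fun j => measurable_pi_apply _
  have h : (Measure.pi fun _ : Fin n => stdPi (Fin p)).map (fun y q => y q.1 q.2)
      = stdPi (Fin n × Fin p) := by
    symm
    refine Measure.pi_eq fun s hs => ?_
    rw [Measure.map_apply hm (MeasurableSet.univ_pi hs)]
    have : (fun (y : Fin n → Fin p → ℝ) (q : Fin n × Fin p) => y q.1 q.2) ⁻¹' Set.univ.pi s
        = Set.univ.pi fun i => Set.univ.pi fun j => s (i, j) := by
      ext y; simp [Set.mem_pi]
    rw [this, Measure.pi_pi, Fintype.prod_prod_type]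
    simp [Measure.pi_pi]
  rw [← h, Measure.map_map hm' hm]
  exact Measure.map_id

/-- Writes the design as X = Z S^{1/2} with independent standard entries in Z. Every statement about
the law of the design is transferred to Z in this way. -/
theorem designLaw_eq_map {n p : ℕ} (S : Matrix (Fin p) (Fin p) ℝ) :
    designLaw n S = (stdPi (Fin n × Fin p)).map (designOf S) := by
  have hm' : Measurable (fun (z : Fin n × Fin p → ℝ) i j => z (i, j)) :=
    measurable_pi_iff.2 fun i => measurable_pi_iff.2 fun j => measurable_pi_apply _
  have h1 : ∀ _ : Fin n, Measurable fun x : Fin p → ℝ =>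
      Matrix.toEuclideanCLM (𝕜 := ℝ) (root S) (WithLp.toLp 2 x) := fun _ =>
    (Matrix.toEuclideanCLM (𝕜 := ℝ) (root S)).measurable.comp (WithLp.measurable_toLp 2 _)
  have h2 : multivariateGaussian 0 S = (stdPi (Fin p)).map fun x =>
      Matrix.toEuclideanCLM (𝕜 := ℝ) (root S) (WithLp.toLp 2 x) := by
    rw [multivariateGaussian, ← map_pi_eq_stdGaussian, Measure.map_map (by fun_prop) (by fun_prop)]
    congr 1
    ext x
    simp [root]
  have h3 : designOf (n := n) S = (fun (x : Fin n → Fin p → ℝ) i =>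
      Matrix.toEuclideanCLM (𝕜 := ℝ) (root S) (WithLp.toLp 2 (x i))) ∘
      (fun (z : Fin n × Fin p → ℝ) i j => z (i, j)) := rfl
  have h4 : Measurable fun (x : Fin n → Fin p → ℝ) i =>
      Matrix.toEuclideanCLM (𝕜 := ℝ) (root S) (WithLp.toLp 2 (x i)) :=
    measurable_pi_iff.2 fun i => (h1 i).comp (measurable_pi_apply i)
  rw [h3, ← Measure.map_map h4 hm',
    map_curry_stdPi, designLaw, h2,
    Measure.pi_map_pi (f := fun _ x => Matrix.toEuclideanCLM (𝕜 := ℝ) (root S) (WithLp.toLp 2 x))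
      (fun i => (h1 i).aemeasurable)]

instance isProbabilityMeasure_designLaw {n p : ℕ} (S : Matrix (Fin p) (Fin p) ℝ) :
    IsProbabilityMeasure (designLaw n S) := by
  unfold designLaw; infer_instance

theorem errorLaw_eq_map (n : ℕ) (σ : ℝ) :
    errorLaw n σ = (stdPi (Fin n)).map fun x => σ • x := by
  have h : gaussianReal 0 (Real.toNNReal (σ ^ 2)) = (gaussianReal 0 1).map fun x => σ * x := by
    rw [gaussianReal_map_const_mul]
    congr 1
    · simp
    · ext; simp [sq_nonneg]
  rw [errorLaw, h]
  exact (Measure.pi_map_pi (f := fun _ x => σ * x) (fun i => by fun_prop)).symm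

end Law

/-! ### The probability of the event K -/

section EventK

open scoped Matrix.Norms.L2Operator

/-- The identity (XᵀX)⁻¹ = S^{-1/2} (ZᵀZ)⁻¹ S^{-1/2} and ‖S^{-1/2}‖² = ‖S⁻¹‖ reduce the claim to the
singular values of Z. The margins 3/4 and 3/2 become 16/9 and 9/4 after inverting and squaring,
strictly below the factor 4 in the truncation levels. -/
theorem designOf_mem_eventK {n p : ℕ} (hn : 0 < n) (hp : 0 < p) {τ : ℝ} (hτ1 : τ < 1)
    {S : Matrix (Fin p) (Fin p) ℝ} (hS : S.PosDef) {z : Fin n × Fin p → ℝ}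
    (hmin : ∀ u : EuclideanSpace ℝ (Fin p), ‖u‖ = 1 →
      (3 / 4 * (1 - √τ)) * √n ≤ ‖mulE (entryMatrix z) u‖)
    (hmax : ∀ u : EuclideanSpace ℝ (Fin p), ‖u‖ = 1 →
      ‖mulE (entryMatrix z) u‖ ≤ (3 / 2 * (1 + √τ)) * √n) :
    designOf S z ∈ eventK n τ S := by
  have hn' : (0 : ℝ) < n := by exact_mod_cast hn
  have hsn : 0 < √(n : ℝ) := Real.sqrt_pos.2 hn'
  have hsq : √(n : ℝ) ^ 2 = n := Real.sq_sqrt hn'.le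
  have ht0 : 0 ≤ √τ := Real.sqrt_nonneg _
  have ht1 : √τ < 1 := by rw [Real.sqrt_lt' one_pos]; simpa using hτ1
  have hne : Nonempty (Fin p) := ⟨⟨0, hp⟩⟩
  set Z := entryMatrix z
  have hscale : ∀ u : EuclideanSpace ℝ (Fin p), u ≠ 0 →
      ‖mulE Z u‖ = ‖u‖ * ‖mulE Z (‖u‖⁻¹ • u)‖ := by
    intro u hu
    have : ‖u‖ ≠ 0 := norm_ne_zero_iff.2 hu
    rw [mulE_smul, norm_smul, norm_inv, norm_norm, mul_inv_cancel_left₀ this]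
  have hunit1 : ∀ u : EuclideanSpace ℝ (Fin p), u ≠ 0 → ‖‖u‖⁻¹ • u‖ = 1 := fun u hu => by
    rw [norm_smul, norm_inv, norm_norm, inv_mul_cancel₀ (norm_ne_zero_iff.2 hu)]
  have hlow : ∀ u, ((3 / 4 * (1 - √τ)) * √n) * ‖u‖ ≤ ‖mulE Z u‖ := by
    intro u
    by_cases hu : u = 0
    · simp [hu]
    rw [hscale u hu, mul_comm]
    exact mul_le_mul_of_nonneg_left (hmin _ (hunit1 u hu)) (norm_nonneg _)
  have hup : ‖Z‖ ≤ (3 / 2 * (1 + √τ)) * √n := by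
    refine norm_le_of_mulE_le (by positivity) fun u => ?_
    by_cases hu : u = 0
    · simp [hu, mulE]
    rw [hscale u hu, mul_comm _ ‖u‖]
    exact mul_le_mul_of_nonneg_left (hmax _ (hunit1 u hu)) (norm_nonneg _)
  have hspos : 0 < (3 / 4 * (1 - √τ)) * √n := mul_pos (by linarith) hsn
  obtain ⟨hW, hWinv⟩ := isUnit_gram_of_le_mulE hspos hlow
  have hR := isUnit_det_root hS
  have hG : IsUnit (gram (designOf S z)).det := by
    rw [gram_designOf, Matrix.det_mul, Matrix.det_mul]
    exact (hR.mul hW).mul hR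
  have hSpos : 0 < specNorm S := by
    rw [← norm_root_sq hS]
    refine pow_pos (norm_pos_iff.2 fun h0 => ?_) 2
    rw [h0, Matrix.det_zero] at hR
    exact not_isUnit_zero hR
  have hSipos : 0 < specNorm S⁻¹ := by
    rw [← norm_root_inv_sq hS]
    refine pow_pos (norm_pos_iff.2 fun h0 => ?_) 2
    have := Matrix.isUnit_nonsing_inv_det _ hR
    rw [h0, Matrix.det_zero] at this
    exact not_isUnit_zero this
  have hninv : IsUnit ((n : ℝ)⁻¹) := (inv_ne_zero hn'.ne').isUnit
  refine ⟨?_, ?_, ?_⟩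
  · rw [Matrix.det_smul]
    exact (hninv.pow _).mul hG
  · have e : ((n : ℝ)⁻¹ • gram (designOf S z))⁻¹
        = (n : ℝ) • ((root S)⁻¹ * ((Zᵀ * Z)⁻¹ * (root S)⁻¹)) := by
      refine Matrix.inv_eq_left_inv ?_
      rw [Matrix.smul_mul, Matrix.mul_smul, smul_smul, mul_inv_cancel₀ hn'.ne', one_smul,
        gram_designOf]
      have := Matrix.nonsing_inv_mul _ hR
      calc (root S)⁻¹ * ((Zᵀ * Z)⁻¹ * (root S)⁻¹) * (root S * (Zᵀ * Z) * root S)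
          = (root S)⁻¹ * ((Zᵀ * Z)⁻¹ * ((root S)⁻¹ * root S) * (Zᵀ * Z)) * root S := by
            simp only [Matrix.mul_assoc]
        _ = 1 := by
            rw [Matrix.nonsing_inv_mul _ hR, Matrix.mul_one, Matrix.nonsing_inv_mul _ hW,
              Matrix.mul_one, Matrix.nonsing_inv_mul _ hR]
    rw [e, specNorm_eq_norm, norm_smul, Real.norm_eq_abs, abs_of_pos hn', lowerLevel, inv_div]
    have h1 : ‖(root S)⁻¹ * ((Zᵀ * Z)⁻¹ * (root S)⁻¹)‖
        ≤ specNorm S⁻¹ * (((3 / 4 * (1 - √τ)) * √n) ^ 2)⁻¹ := by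
      rw [← norm_root_inv_sq hS]
      calc _ ≤ ‖(root S)⁻¹‖ * (‖(Zᵀ * Z)⁻¹‖ * ‖(root S)⁻¹‖) :=
            (Matrix.l2_opNorm_mul _ _).trans
              (mul_le_mul_of_nonneg_left (Matrix.l2_opNorm_mul _ _) (norm_nonneg _))
        _ ≤ ‖(root S)⁻¹‖ * ((((3 / 4 * (1 - √τ)) * √n) ^ 2)⁻¹ * ‖(root S)⁻¹‖) := by gcongr
        _ = _ := by ring
    have h2 : 0 < 1 - √τ := by linarith
    calc _ ≤ (n : ℝ) * (specNorm S⁻¹ * (((3 / 4 * (1 - √τ)) * √n) ^ 2)⁻¹) := by gcongr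
      _ = 16 / 9 * specNorm S⁻¹ / (1 - √τ) ^ 2 := by
          rw [mul_pow, hsq]; field_simp; norm_num
      _ < 4 * specNorm S⁻¹ / (1 - √τ) ^ 2 := by
          gcongr
          norm_num
  · rw [specNorm_eq_norm, norm_smul, Real.norm_eq_abs, abs_of_pos (inv_pos.2 hn'), upperLevel]
    have h1 : ‖gram (designOf S z)‖ ≤ ((3 / 2 * (1 + √τ)) * √n) ^ 2 * specNorm S := by
      rw [gram, norm_transpose_mul_self, ← pow_two, ← norm_root_sq hS, ← mul_pow,
        designMatrix_designOf]
      refine pow_le_pow_left₀ (norm_nonneg _) ((Matrix.l2_opNorm_mul _ _).trans ?_) 2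
      gcongr
    calc _ ≤ (n : ℝ)⁻¹ * (((3 / 2 * (1 + √τ)) * √n) ^ 2 * specNorm S) := by gcongr
      _ = 9 / 4 * (1 + √τ) ^ 2 * specNorm S := by
          rw [mul_pow, hsq]; field_simp; norm_num
      _ < 4 * (1 + √τ) ^ 2 * specNorm S := by
          gcongr
          norm_num

/-- The event `K` has probability at least one half for all large `n`. -/
theorem eventually_half_le_eventK {τ : ℝ} (hτ1 : τ < 1) {p : ℕ → ℕ}
    (hp : ∀ n, 1 ≤ p n) (hpn : Tendsto (fun n => (p n : ℝ) / (n : ℝ)) atTop (𝓝 τ))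
    {S : ∀ n, Matrix (Fin (p n)) (Fin (p n)) ℝ} (hS : ∀ n, (S n).PosDef) :
    ∀ᶠ n in atTop, 1 / 2 ≤ (designLaw n (S n)).real (eventK n τ (S n)) := by
  have ht1 : √τ < 1 := by rw [Real.sqrt_lt' one_pos]; simpa using hτ1
  have ht0 : 0 ≤ √τ := Real.sqrt_nonneg _
  have h1 := tendsto_min_singular hp hpn (r := 3 / 4 * (1 - √τ)) (by linarith)
  have h2 := tendsto_max_singular hp hpn (r := 3 / 2 * (1 + √τ)) (by linarith)
  filter_upwards [eventually_gt_atTop 0, h1.eventually_lt_const (show (0 : ℝ) < 1 / 4 by norm_num),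
    h2.eventually_lt_const (show (0 : ℝ) < 1 / 4 by norm_num)] with n hn g1 g2
  set A := {z : Fin n × Fin (p n) → ℝ | ∀ u : EuclideanSpace ℝ (Fin (p n)), ‖u‖ = 1 →
    3 / 4 * (1 - √τ) * √n ≤ ‖mulE (entryMatrix z) u‖} with hA
  set B := {z : Fin n × Fin (p n) → ℝ | ∀ u : EuclideanSpace ℝ (Fin (p n)), ‖u‖ = 1 →
    ‖mulE (entryMatrix z) u‖ ≤ 3 / 2 * (1 + √τ) * √n} with hB
  have hAm : MeasurableSet A := (isClosed_forall_le_mulE _).measurableSet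
  have hBm : MeasurableSet B := (isClosed_forall_mulE_le _).measurableSet
  have h3 : (stdPi (Fin n × Fin (p n))).real (A ∩ B)ᶜ < 1 / 2 := by
    rw [Set.compl_inter]
    refine (measureReal_union_le _ _).trans_lt ?_
    linarith
  rw [probReal_compl_eq_one_sub (hAm.inter hBm)] at h3
  have h4 : (stdPi (Fin n × Fin (p n))).real (A ∩ B)
      ≤ (designLaw n (S n)).real (eventK n τ (S n)) := by
    refine ENNReal.toReal_mono (measure_ne_top _ _) ?_
    rw [designLaw_eq_map]
    -- Only a lower bound for the image measure is needed, so measurability of the event plays no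
    -- role here.
    refine (measure_mono ?_).trans (Measure.le_map_apply (measurable_designOf _).aemeasurable _)
    rintro z ⟨hz1, hz2⟩
    exact designOf_mem_eventK hn (hp n) hτ1 (hS n) hz1 hz2
  linarith

end EventK

/-! ### Algebra and derivatives of the regularized inverse -/

/-- The regularized inverse `(Zᵀ Z + δ)⁻¹`. -/
noncomputable def resolv {n p : ℕ} (δ : ℝ) (z : Fin n × Fin p → ℝ) : Matrix (Fin p) (Fin p) ℝ :=
  ((entryMatrix z)ᵀ * entryMatrix z + δ • (1 : Matrix (Fin p) (Fin p) ℝ))⁻¹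

section Algebra

open scoped Matrix.Norms.L2Operator

variable {n p : ℕ} {δ : ℝ}

theorem posDef_regularized (hδ : 0 < δ) (Z : Matrix (Fin n) (Fin p) ℝ) :
    (Zᵀ * Z + δ • (1 : Matrix (Fin p) (Fin p) ℝ)).PosDef := by
  have h1 : (Zᵀ * Z).PosSemidef := by
    have := Matrix.posSemidef_conjTranspose_mul_self Z
    rwa [Matrix.conjTranspose_eq_transpose_of_trivial] at this
  exact Matrix.PosDef.posSemidef_add h1 (Matrix.PosDef.one.smul hδ)

theorem posDef_resolv (hδ : 0 < δ) (z : Fin n × Fin p → ℝ) : (resolv δ z).PosDef :=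
  (posDef_regularized hδ _).inv

theorem resolv_transpose (hδ : 0 < δ) (z : Fin n × Fin p → ℝ) : (resolv δ z)ᵀ = resolv δ z := by
  have := (posDef_resolv hδ z).isHermitian
  rwa [Matrix.IsHermitian, Matrix.conjTranspose_eq_transpose_of_trivial] at this

theorem isUnit_det_regularized (hδ : 0 < δ) (z : Fin n × Fin p → ℝ) :
    IsUnit ((entryMatrix z)ᵀ * entryMatrix z + δ • (1 : Matrix (Fin p) (Fin p) ℝ)).det :=
  (posDef_regularized hδ _).det_pos.ne'.isUnit

theorem gram_mul_resolv (hδ : 0 < δ) (z : Fin n × Fin p → ℝ) : (entryMatrix z)ᵀ * entryMatrix z * resolv δ z = 1 - δ • resolv δ z := by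
  have := Matrix.mul_nonsing_inv _ (isUnit_det_regularized hδ z)
  rw [Matrix.add_mul, Matrix.smul_mul, Matrix.one_mul] at this
  exact eq_sub_of_add_eq this

theorem continuous_resolv (hδ : 0 < δ) : Continuous (resolv (n := n) (p := p) δ) := by
  have h1 : Continuous fun z : Fin n × Fin p → ℝ =>
      (entryMatrix z)ᵀ * entryMatrix z + δ • (1 : Matrix (Fin p) (Fin p) ℝ) := by
    have : Continuous (entryMatrix (n := n) (p := p)) :=
      continuous_pi fun i => continuous_pi fun j => continuous_apply _
    fun_prop
  unfold resolv
  simp only [Matrix.inv_def, Ring.inverse_eq_inv]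
  exact (h1.matrix_det.inv₀ fun z => (isUnit_det_regularized hδ z).ne_zero).smul h1.matrix_adjugate

/-- The derivative of the regularized inverse in an entry of the matrix. -/
theorem hasDerivAt_resolv (hδ : 0 < δ) (z : Fin n × Fin p → ℝ) (i : Fin n) (j k l : Fin p) :
    HasDerivAt (fun t => resolv δ (Function.update z (i, j) t) k l)
      (-(resolv δ z k j * (entryMatrix z * resolv δ z) i l
        + (entryMatrix z * resolv δ z) i k * resolv δ z j l)) (z (i, j)) := by
  set Z := entryMatrix z
  set E : Matrix (Fin n) (Fin p) ℝ := Matrix.single i j 1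
  set R := resolv δ z with hR
  have hZ : ∀ t, entryMatrix (Function.update z (i, j) t) = Z + (t - z (i, j)) • E := by
    intro t
    ext a b
    by_cases h : (a, b) = (i, j)
    · obtain ⟨rfl, rfl⟩ := Prod.mk.inj h
      simp [entryMatrix, Z, E]
    · have h' : ¬(i = a ∧ j = b) := fun h'' => h (by rw [h''.1, h''.2])
      simp [entryMatrix, Z, E, Function.update_of_ne h, Matrix.single_apply_of_ne _ _ _ _ _ h']
  -- Along one entry the regularized Gram matrix is a quadratic polynomial in the increment; the
  -- squared term does not contribute to the derivative at the base point.
  have hA : ∀ t, (entryMatrix (Function.update z (i, j) t))ᵀ * entryMatrix (Function.update z (i, j) t)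
      + δ • (1 : Matrix (Fin p) (Fin p) ℝ)
      = (Zᵀ * Z + δ • (1 : Matrix (Fin p) (Fin p) ℝ)) + (t - z (i, j)) • (Eᵀ * Z + Zᵀ * E)
        + (t - z (i, j)) ^ 2 • (Eᵀ * E) := by
    intro t
    rw [hZ t]
    simp only [Matrix.transpose_add, Matrix.transpose_smul, Matrix.add_mul, Matrix.mul_add,
      Matrix.smul_mul, Matrix.mul_smul]
    module
  have hs : HasDerivAt (fun t => t - z (i, j)) 1 (z (i, j)) := (hasDerivAt_id _).sub_const _
  have hd : HasDerivAt (fun t => (entryMatrix (Function.update z (i, j) t))ᵀ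
      * entryMatrix (Function.update z (i, j) t) + δ • (1 : Matrix (Fin p) (Fin p) ℝ))
      (Eᵀ * Z + Zᵀ * E) (z (i, j)) := by
    simp only [hA]
    have := ((hs.smul_const (Eᵀ * Z + Zᵀ * E)).const_add
      (Zᵀ * Z + δ • (1 : Matrix (Fin p) (Fin p) ℝ))).add ((hs.pow 2).smul_const (Eᵀ * E))
    refine this.congr_deriv ?_
    simp
  have hu : IsUnit (Zᵀ * Z + δ • (1 : Matrix (Fin p) (Fin p) ℝ)) :=
    (Matrix.isUnit_iff_isUnit_det _).2 (isUnit_det_regularized hδ z)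
  obtain ⟨x, hx⟩ := hu
  have hxR : (↑x⁻¹ : Matrix (Fin p) (Fin p) ℝ) = R := by
    rw [← Ring.inverse_unit, hx, hR, resolv, Matrix.nonsing_inv_eq_ringInverse]
  have h1 := hasFDerivAt_ringInverse (𝕜 := ℝ) x
  have h2 : (fun t => (entryMatrix (Function.update z (i, j) t))ᵀ
      * entryMatrix (Function.update z (i, j) t) + δ • (1 : Matrix (Fin p) (Fin p) ℝ)) (z (i, j)) = x := by
    rw [hx]; simp [Z]
  rw [← h2] at h1
  have h3 := h1.comp_hasDerivAt (z (i, j)) hd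
  rw [hxR] at h3
  have h4 := ((Matrix.entryLinearMap ℝ ℝ k l).toContinuousLinearMap).hasFDerivAt.comp_hasDerivAt _ h3
  have h5 : (fun t => resolv δ (Function.update z (i, j) t) k l)
      = (Matrix.entryLinearMap ℝ ℝ k l).toContinuousLinearMap ∘ (Ring.inverse ∘
        (fun t => (entryMatrix (Function.update z (i, j) t))ᵀ
        * entryMatrix (Function.update z (i, j) t) + δ • (1 : Matrix (Fin p) (Fin p) ℝ))) := by
    ext t
    simp [resolv, Matrix.nonsing_inv_eq_ringInverse]
  rw [h5]
  refine h4.congr_deriv ?_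
  have hRt := resolv_transpose hδ z
  have e : ∀ k l, (R * (Eᵀ * Z) * R) k l = R k j * (Z * R) i l := by
    intro k l
    rw [Matrix.mul_assoc, Matrix.mul_assoc, Matrix.mul_apply, Finset.sum_eq_single j]
    · rw [Matrix.mul_apply, Finset.sum_eq_single i]
      · simp [E]
      · intro b _ hb; simp [E, hb.symm]
      · simp
    · intro b _ hb
      rw [Matrix.mul_apply, Finset.sum_eq_zero, mul_zero]
      intro c _
      simp [E, hb.symm]
    · simp
  have e2 : (R * (Zᵀ * E) * R) k l = (Z * R) i k * R j l := by
    have : R * (Zᵀ * E) * R = (R * (Eᵀ * Z) * R)ᵀ := by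
      simp only [Matrix.transpose_mul, Matrix.transpose_transpose, hR, hRt, Matrix.mul_assoc]
    rw [this, Matrix.transpose_apply]
    rw [e, mul_comm]
    congr 1
    rw [← Matrix.transpose_apply R, hR, hRt]
  rw [← e, ← e2, ← Matrix.add_apply]
  simp [Matrix.mul_add, Matrix.add_mul]

/-- With R the regularized inverse, pairing ZᵀZ Rx = x - δRx with Rx gives ‖ZRx‖² + δ‖Rx‖² = ⟪Rx,
x⟫, and both bounds follow by Cauchy–Schwarz. They are uniform in Z, which is what makes the
integrands of Stein's identity bounded. -/
theorem norm_mulE_resolv_le (hδ : 0 < δ) (z : Fin n × Fin p → ℝ) (x : EuclideanSpace ℝ (Fin p)) :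
    δ * ‖mulE (resolv δ z) x‖ ≤ ‖x‖ ∧ δ * ‖mulE (entryMatrix z * resolv δ z) x‖ ^ 2 ≤ ‖x‖ ^ 2 := by
  set y := mulE (resolv δ z) x with hy
  have h1 : mulE ((entryMatrix z)ᵀ * entryMatrix z) y = x - δ • y := by
    rw [hy, ← mulE_mul, gram_mul_resolv hδ]
    simp [mulE, Matrix.sub_mulVec, Matrix.smul_mulVec]
  have h2 := norm_mulE_sq (entryMatrix z) y
  rw [h1, inner_sub_right, real_inner_smul_right, real_inner_self_eq_norm_sq] at h2
  have h3 := real_inner_le_norm y x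
  have h4 : δ * ‖y‖ ≤ ‖x‖ := by
    by_cases hy0 : ‖y‖ = 0
    · rw [hy0, mul_zero]; exact norm_nonneg _
    · have : 0 < ‖y‖ := lt_of_le_of_ne (norm_nonneg _) (Ne.symm hy0)
      have := sq_nonneg ‖mulE (entryMatrix z) y‖
      nlinarith
  refine ⟨h4, ?_⟩
  rw [mulE_mul, ← hy]
  calc δ * ‖mulE (entryMatrix z) y‖ ^ 2 = δ * inner ℝ y x - (δ * ‖y‖) ^ 2 := by rw [h2]; ring
    _ ≤ δ * inner ℝ y x := sub_le_self _ (sq_nonneg _)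
    _ ≤ δ * (‖y‖ * ‖x‖) := mul_le_mul_of_nonneg_left h3 hδ.le
    _ = (δ * ‖y‖) * ‖x‖ := by ring
    _ ≤ ‖x‖ * ‖x‖ := mul_le_mul_of_nonneg_right h4 (norm_nonneg _)
    _ = ‖x‖ ^ 2 := by ring

theorem norm_resolv_le (hδ : 0 < δ) (z : Fin n × Fin p → ℝ) : ‖resolv δ z‖ ≤ δ⁻¹ := by
  refine norm_le_of_mulE_le (by positivity) fun x => ?_
  rw [inv_mul_eq_div, le_div_iff₀ hδ, mul_comm]
  exact (norm_mulE_resolv_le hδ z x).1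

theorem norm_mul_resolv_le (hδ : 0 < δ) (z : Fin n × Fin p → ℝ) : ‖entryMatrix z * resolv δ z‖ ≤ (√δ)⁻¹ := by
  refine norm_le_of_mulE_le (by positivity) fun x => ?_
  rw [inv_mul_eq_div, le_div_iff₀ (Real.sqrt_pos.2 hδ)]
  refine le_of_sq_le_sq ?_ (norm_nonneg _)
  rw [mul_pow, Real.sq_sqrt hδ.le, mul_comm]
  exact (norm_mulE_resolv_le hδ z x).2

/-- For y = R Zᵀx the same computation gives ‖Zy‖² + δ‖y‖² = ⟪Zy, x⟫, so ‖Zy‖ ≤ ‖x‖ whatever δ is.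
-/
theorem norm_mul_resolv_mul_le (hδ : 0 < δ) (z : Fin n × Fin p → ℝ) :
    ‖entryMatrix z * resolv δ z * (entryMatrix z)ᵀ‖ ≤ 1 := by
  refine norm_le_of_mulE_le zero_le_one fun x => ?_
  set w := mulE (entryMatrix z)ᵀ x with hw
  set y := mulE (resolv δ z) w with hy
  have h1 : mulE ((entryMatrix z)ᵀ * entryMatrix z) y = w - δ • y := by
    rw [hy, ← mulE_mul, gram_mul_resolv hδ]
    simp [mulE, Matrix.sub_mulVec, Matrix.smul_mulVec]
  have h2 := norm_mulE_sq (entryMatrix z) y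
  rw [h1, inner_sub_right, real_inner_smul_right, real_inner_self_eq_norm_sq, hw,
    inner_mulE_transpose] at h2
  have h3 := real_inner_le_norm (mulE (entryMatrix z) y) x
  rw [mulE_mul, mulE_mul, ← hw, ← hy, one_mul]
  have h4 : 0 ≤ δ * ‖y‖ ^ 2 := by positivity
  by_cases hy0 : ‖mulE (entryMatrix z) y‖ = 0
  · rw [hy0]; exact norm_nonneg _
  · have : 0 < ‖mulE (entryMatrix z) y‖ := lt_of_le_of_ne (norm_nonneg _) (Ne.symm hy0)
    nlinarith

end Algebra

section Entries

open scoped Matrix.Norms.L2Operator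

theorem abs_entry_le_norm {n p : ℕ} (A : Matrix (Fin n) (Fin p) ℝ) (i : Fin n) (j : Fin p) :
    |A i j| ≤ ‖A‖ := by
  have h1 := norm_mulE_le A (EuclideanSpace.single j 1)
  have h2 := PiLp.norm_apply_le (mulE A (EuclideanSpace.single j 1)) i
  have h3 : (mulE A (EuclideanSpace.single j 1)) i = A i j := by
    simp [mulE]
  rw [h3] at h2
  simpa using h2.trans h1

end Entries

/-- Bounded continuous real functions. -/
def BddCont {X : Type*} [TopologicalSpace X] (f : X → ℝ) : Prop :=
  Continuous f ∧ ∃ C, ∀ x, |f x| ≤ C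

namespace BddCont

variable {X : Type*} [TopologicalSpace X] {f g : X → ℝ}

theorem const (a : ℝ) : BddCont (fun _ : X => a) := ⟨continuous_const, |a|, fun _ => le_rfl⟩

theorem add (hf : BddCont f) (hg : BddCont g) : BddCont fun x => f x + g x := by
  obtain ⟨C, hC⟩ := hf.2
  obtain ⟨D, hD⟩ := hg.2
  exact ⟨hf.1.add hg.1, C + D, fun x => (abs_add_le _ _).trans (add_le_add (hC x) (hD x))⟩

theorem neg (hf : BddCont f) : BddCont fun x => -f x := by
  obtain ⟨C, hC⟩ := hf.2
  exact ⟨hf.1.neg, C, fun x => by rw [abs_neg]; exact hC x⟩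

theorem sub (hf : BddCont f) (hg : BddCont g) : BddCont fun x => f x - g x := by
  simpa [sub_eq_add_neg] using hf.add hg.neg

theorem mul (hf : BddCont f) (hg : BddCont g) : BddCont fun x => f x * g x := by
  obtain ⟨C, hC⟩ := hf.2
  obtain ⟨D, hD⟩ := hg.2
  refine ⟨hf.1.mul hg.1, C * D, fun x => ?_⟩
  rw [abs_mul]
  exact mul_le_mul (hC x) (hD x) (abs_nonneg _) ((abs_nonneg _).trans (hC x))

theorem pow (hf : BddCont f) (k : ℕ) : BddCont fun x => f x ^ k := by
  induction k with
  | zero => simpa using const 1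
  | succ k ih => simpa [pow_succ] using ih.mul hf

theorem sum {ι : Type*} (s : Finset ι) {F : ι → X → ℝ} (h : ∀ i, BddCont (F i)) :
    BddCont fun x => ∑ i ∈ s, F i x := by
  classical
  induction s using Finset.induction_on with
  | empty => simpa using const 0
  | insert a s ha ih => simpa [Finset.sum_insert ha] using (h a).add ih

theorem integrable [MeasurableSpace X] [BorelSpace X] [SecondCountableTopology X] {μ : Measure X}
    [IsFiniteMeasure μ] (hf : BddCont f) : Integrable f μ := by
  obtain ⟨C, hC⟩ := hf.2
  exact integrable_of_continuous_bounded hf.1 hC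

end BddCont

/-! ### Stein's identity and moments of the regularized inverse -/

section Stein

open scoped Matrix.Norms.L2Operator

variable {n p : ℕ} {δ : ℝ}

theorem continuous_entryMatrix : Continuous (entryMatrix (n := n) (p := p)) :=
  continuous_pi fun _ => continuous_pi fun _ => continuous_apply _

theorem bddCont_entry {X : Type*} [TopologicalSpace X] {a b : ℕ} {F : X → Matrix (Fin a) (Fin b) ℝ}
    (hF : Continuous F) {C : ℝ} (hC : ∀ x, ‖F x‖ ≤ C) (k : Fin a) (l : Fin b) :
    BddCont fun x => F x k l :=
  ⟨hF.matrix_elem k l, C, fun x => (abs_entry_le_norm _ _ _).trans (hC x)⟩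

theorem bddCont_resolv (hδ : 0 < δ) (k l : Fin p) :
    BddCont fun z : Fin n × Fin p → ℝ => resolv δ z k l :=
  bddCont_entry (continuous_resolv hδ) (norm_resolv_le hδ) k l

theorem bddCont_mul_resolv (hδ : 0 < δ) (k : Fin n) (l : Fin p) :
    BddCont fun z : Fin n × Fin p → ℝ => (entryMatrix z * resolv δ z) k l :=
  bddCont_entry (continuous_entryMatrix.matrix_mul (continuous_resolv hδ))
    (norm_mul_resolv_le hδ) k l

theorem bddCont_mul_resolv_mul (hδ : 0 < δ) (k l : Fin n) :
    BddCont fun z : Fin n × Fin p → ℝ =>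
      (entryMatrix z * resolv δ z * (entryMatrix z)ᵀ) k l :=
  bddCont_entry ((continuous_entryMatrix.matrix_mul (continuous_resolv hδ)).matrix_mul
    continuous_entryMatrix.matrix_transpose) (norm_mul_resolv_mul_le hδ) k l

/-- The product rule for the i-th row of Z R. Only entries in the row of the varying coordinate are
needed, because the identity uses the divergence of the field. The three terms come from
differentiating Z and from the two terms in the derivative of R. -/
theorem hasDerivAt_mul_resolv (hδ : 0 < δ) (z : Fin n × Fin p → ℝ) (i : Fin n) (j l : Fin p) :
    HasDerivAt (fun t => (entryMatrix (Function.update z (i, j) t)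
        * resolv δ (Function.update z (i, j) t)) i l)
      (resolv δ z j l - (entryMatrix z * resolv δ z) i j * (entryMatrix z * resolv δ z) i l
        - (entryMatrix z * resolv δ z * (entryMatrix z)ᵀ) i i * resolv δ z j l) (z (i, j)) := by
  simp only [Matrix.mul_apply (M := entryMatrix (Function.update z (i, j) _))]
  have h1 : ∀ k, HasDerivAt (fun t => entryMatrix (Function.update z (i, j) t) i k)
      (if k = j then 1 else 0) (z (i, j)) := by
    intro k
    have := (hasDerivAt_pi.1 (hasDerivAt_update z (i, j) (z (i, j)))) (i, k)
    simpa [entryMatrix, Pi.single_apply] using this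
  have h2 := HasDerivAt.fun_sum (u := Finset.univ) fun k _ =>
    (h1 k).mul (hasDerivAt_resolv hδ z i j k l)
  refine h2.congr_deriv ?_
  simp only [Function.update_eq_self]
  rw [Finset.sum_add_distrib]
  have e1 : ∑ k, (if k = j then (1 : ℝ) else 0) * resolv δ z k l = resolv δ z j l := by simp
  have e2 : (entryMatrix z * resolv δ z) i j = ∑ k, entryMatrix z i k * resolv δ z k j :=
    Matrix.mul_apply
  have e3 : (entryMatrix z * resolv δ z * (entryMatrix z)ᵀ) i i
      = ∑ k, entryMatrix z i k * (entryMatrix z * resolv δ z) i k := by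
    rw [Matrix.mul_apply]
    exact Finset.sum_congr rfl fun k _ => by rw [Matrix.transpose_apply, mul_comm]
  rw [e1]
  have e4 : ∑ k, entryMatrix z i k * -(resolv δ z k j * (entryMatrix z * resolv δ z) i l
      + (entryMatrix z * resolv δ z) i k * resolv δ z j l)
      = -((∑ k, entryMatrix z i k * resolv δ z k j) * (entryMatrix z * resolv δ z) i l)
        - (∑ k, entryMatrix z i k * (entryMatrix z * resolv δ z) i k) * resolv δ z j l := by
    rw [Finset.sum_mul, Finset.sum_mul, ← Finset.sum_neg_distrib, ← Finset.sum_sub_distrib]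
    exact Finset.sum_congr rfl fun k _ => by ring
  rw [e4, ← e2, ← e3]
  ring

/-- Gaussian integration by parts for the matrix field `Z (ZᵀZ + δ)⁻¹ M(Z)`, entrywise. -/
theorem stein_resolv_entry (hδ : 0 < δ) {M : (Fin n × Fin p → ℝ) → Matrix (Fin p) (Fin p) ℝ}
    {N : Fin n → Fin p → (Fin n × Fin p → ℝ) → Fin p → ℝ} (hM : ∀ k l, BddCont fun z => M z k l)
    (hN : ∀ i j l, BddCont fun z => N i j z l)
    (hder : ∀ z i j l, HasDerivAt (fun t => M (Function.update z (i, j) t) l j) (N i j z l)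
      (z (i, j))) (i : Fin n) (j : Fin p) :
    Integrable (fun z => z (i, j) * (entryMatrix z * resolv δ z * M z) i j) (stdPi (Fin n × Fin p)) ∧
    BddCont (fun z => (resolv δ z * M z) j j
        - (entryMatrix z * resolv δ z) i j * (entryMatrix z * resolv δ z * M z) i j
        - (entryMatrix z * resolv δ z * (entryMatrix z)ᵀ) i i * (resolv δ z * M z) j j
        + ∑ l, (entryMatrix z * resolv δ z) i l * N i j z l) ∧
    ∫ z, z (i, j) * (entryMatrix z * resolv δ z * M z) i j ∂(stdPi (Fin n × Fin p))
      = ∫ z, ((resolv δ z * M z) j j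
        - (entryMatrix z * resolv δ z) i j * (entryMatrix z * resolv δ z * M z) i j
        - (entryMatrix z * resolv δ z * (entryMatrix z)ᵀ) i i * (resolv δ z * M z) j j
        + ∑ l, (entryMatrix z * resolv δ z) i l * N i j z l) ∂(stdPi (Fin n × Fin p)) := by
  have b1 : BddCont fun z => (entryMatrix z * resolv δ z * M z) i j := by
    simp only [Matrix.mul_apply (N := M _)]
    exact BddCont.sum _ fun k => (bddCont_mul_resolv hδ i k).mul (hM k j)
  have b2 : BddCont fun z : Fin n × Fin p → ℝ => (resolv δ z * M z) j j := by
    simp only [Matrix.mul_apply]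
    exact BddCont.sum _ fun k => (bddCont_resolv hδ j k).mul (hM k j)
  have b3 := ((b2.sub ((bddCont_mul_resolv hδ i j).mul b1)).sub
    ((bddCont_mul_resolv_mul hδ i i).mul b2)).add
      (BddCont.sum Finset.univ fun l => (bddCont_mul_resolv hδ i l).mul (hN i j l))
  obtain ⟨C, hC⟩ := b1.2
  have b0 := integrable_coord_mul_stdPi (i, j) b1.1 hC
  refine ⟨b0, b3, integral_coord_mul_stdPi (F := fun z => (entryMatrix z * resolv δ z * M z) i j)
    (i, j) (fun z => ?_) b1.integrable b0 b3.integrable⟩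
  simp only [Matrix.mul_apply (N := M _)]
  have h2 := HasDerivAt.fun_sum (u := Finset.univ) fun l _ =>
    (hasDerivAt_mul_resolv hδ z i j l).mul (hder z i j l)
  refine h2.congr_deriv ?_
  simp only [Function.update_eq_self]
  rw [Matrix.mul_apply, Finset.sum_add_distrib, Finset.mul_sum, Finset.mul_sum,
    ← Finset.sum_sub_distrib, ← Finset.sum_sub_distrib]
  congr 1
  exact Finset.sum_congr rfl fun l _ => by ring

theorem trace_transpose_mul {a b : ℕ} (A B : Matrix (Fin a) (Fin b) ℝ) :
    (Aᵀ * B).trace = ∑ i, ∑ j, A i j * B i j := by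
  simp only [Matrix.trace, Matrix.diag, Matrix.mul_apply, Matrix.transpose_apply]
  exact Finset.sum_comm

theorem transpose_mul_mul_resolv (hδ : 0 < δ) (z : Fin n × Fin p → ℝ) :
    (entryMatrix z * resolv δ z)ᵀ * (entryMatrix z * resolv δ z)
      = resolv δ z - δ • resolv δ z ^ 2 := by
  rw [Matrix.transpose_mul, resolv_transpose hδ, Matrix.mul_assoc, ← Matrix.mul_assoc _ _ (resolv δ z),
    gram_mul_resolv hδ, Matrix.mul_sub, Matrix.mul_one, Matrix.mul_smul, pow_two]

theorem bddCont_trace {X : Type*} [TopologicalSpace X] {F : X → Matrix (Fin p) (Fin p) ℝ}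
    (hF : ∀ k l, BddCont fun x => F x k l) : BddCont fun x => (F x).trace :=
  BddCont.sum _ fun k => hF k k

/-- Gaussian integration by parts for the matrix field `Z (ZᵀZ + δ)⁻¹ M(Z)`, in terms of traces. -/
theorem stein_resolv (hδ : 0 < δ) {M : (Fin n × Fin p → ℝ) → Matrix (Fin p) (Fin p) ℝ}
    {N : Fin n → Fin p → (Fin n × Fin p → ℝ) → Fin p → ℝ} (hM : ∀ k l, BddCont fun z => M z k l)
    (hN : ∀ i j l, BddCont fun z => N i j z l)
    (hder : ∀ z i j l, HasDerivAt (fun t => M (Function.update z (i, j) t) l j) (N i j z l)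
      (z (i, j))) :
    ∫ z, ((M z).trace - δ * (resolv δ z * M z).trace) ∂(stdPi (Fin n × Fin p))
      = ∫ z, ((n - p - 1 + δ * (resolv δ z).trace) * (resolv δ z * M z).trace
        + δ * (resolv δ z ^ 2 * M z).trace
        + ∑ i, ∑ j, ∑ l, (entryMatrix z * resolv δ z) i l * N i j z l)
          ∂(stdPi (Fin n × Fin p)) := by
  have key := fun i j => stein_resolv_entry hδ hM hN hder i j
  have hsum : ∫ z, ∑ i, ∑ j, z (i, j) * (entryMatrix z * resolv δ z * M z) i j
        ∂(stdPi (Fin n × Fin p))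
      = ∫ z, ∑ i, ∑ j, ((resolv δ z * M z) j j
        - (entryMatrix z * resolv δ z) i j * (entryMatrix z * resolv δ z * M z) i j
        - (entryMatrix z * resolv δ z * (entryMatrix z)ᵀ) i i * (resolv δ z * M z) j j
        + ∑ l, (entryMatrix z * resolv δ z) i l * N i j z l) ∂(stdPi (Fin n × Fin p)) := by
    rw [integral_finsetSum _ fun i _ => integrable_finsetSum _ fun j _ => (key i j).1,
      integral_finsetSum _ fun i _ => integrable_finsetSum _ fun j _ => (key i j).2.1.integrable]
    refine Finset.sum_congr rfl fun i _ => ?_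
    rw [integral_finsetSum _ fun j _ => (key i j).1,
      integral_finsetSum _ fun j _ => (key i j).2.1.integrable]
    exact Finset.sum_congr rfl fun j _ => (key i j).2.2
  have e1 : ∀ z : Fin n × Fin p → ℝ, ∑ i, ∑ j, z (i, j) * (entryMatrix z * resolv δ z * M z) i j
      = (M z).trace - δ * (resolv δ z * M z).trace := by
    intro z
    have : ∑ i, ∑ j, z (i, j) * (entryMatrix z * resolv δ z * M z) i j
        = ((entryMatrix z)ᵀ * (entryMatrix z * resolv δ z * M z)).trace :=
      (trace_transpose_mul _ _).symm
    rw [this, ← Matrix.mul_assoc, ← Matrix.mul_assoc, gram_mul_resolv hδ, Matrix.sub_mul,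
      Matrix.one_mul, Matrix.smul_mul, Matrix.trace_sub, Matrix.trace_smul, smul_eq_mul]
  have e2 : ∀ z : Fin n × Fin p → ℝ, ∑ i, ∑ j, ((resolv δ z * M z) j j
        - (entryMatrix z * resolv δ z) i j * (entryMatrix z * resolv δ z * M z) i j
        - (entryMatrix z * resolv δ z * (entryMatrix z)ᵀ) i i * (resolv δ z * M z) j j
        + ∑ l, (entryMatrix z * resolv δ z) i l * N i j z l)
      = (n - p - 1 + δ * (resolv δ z).trace) * (resolv δ z * M z).trace
        + δ * (resolv δ z ^ 2 * M z).trace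
        + ∑ i, ∑ j, ∑ l, (entryMatrix z * resolv δ z) i l * N i j z l := by
    intro z
    simp only [Finset.sum_add_distrib, Finset.sum_sub_distrib]
    congr 1
    -- The coefficient n - p - 1 arises here: n counts the rows, 1 comes from (ZR)ᵀZR = R - δR², and
    -- p from tr ZRZᵀ = p - δ tr R.
    have f1 : ∑ _i : Fin n, ∑ j, (resolv δ z * M z) j j = n * (resolv δ z * M z).trace := by
      simp [Matrix.trace]
    have f2 : ∑ i, ∑ j, (entryMatrix z * resolv δ z) i j * (entryMatrix z * resolv δ z * M z) i j
        = (resolv δ z * M z).trace - δ * (resolv δ z ^ 2 * M z).trace := by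
      rw [← trace_transpose_mul, ← Matrix.mul_assoc, transpose_mul_mul_resolv hδ, Matrix.sub_mul,
        Matrix.smul_mul, Matrix.trace_sub, Matrix.trace_smul, smul_eq_mul]
    have f3 : ∑ i, ∑ j, (entryMatrix z * resolv δ z * (entryMatrix z)ᵀ) i i * (resolv δ z * M z) j j
        = (p - δ * (resolv δ z).trace) * (resolv δ z * M z).trace := by
      rw [← Finset.sum_mul_sum]
      congr 1
      change (entryMatrix z * resolv δ z * (entryMatrix z)ᵀ).trace = _
      rw [Matrix.trace_mul_comm, ← Matrix.mul_assoc, gram_mul_resolv hδ, Matrix.trace_sub,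
        Matrix.trace_smul, Matrix.trace_one, Fintype.card_fin, smul_eq_mul]
    rw [f1, f2, f3]
    ring
  simpa only [e1, e2] using hsum

theorem resolv_trace_nonneg (hδ : 0 < δ) (z : Fin n × Fin p → ℝ) : 0 ≤ (resolv δ z).trace :=
  (posDef_resolv hδ z).posSemidef.trace_nonneg

theorem resolv_sq_trace (hδ : 0 < δ) (z : Fin n × Fin p → ℝ) :
    (resolv δ z ^ 2).trace = ∑ i, ∑ j, resolv δ z i j ^ 2 := by
  have := trace_transpose_mul (resolv δ z) (resolv δ z)
  rw [resolv_transpose hδ, ← pow_two] at this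
  rw [this]
  exact Finset.sum_congr rfl fun i _ => Finset.sum_congr rfl fun j _ => (pow_two _).symm

theorem resolv_sq_trace_nonneg (hδ : 0 < δ) (z : Fin n × Fin p → ℝ) :
    0 ≤ (resolv δ z ^ 2).trace := by
  rw [resolv_sq_trace hδ]; positivity

theorem resolv_cube_trace_nonneg (hδ : 0 < δ) (z : Fin n × Fin p → ℝ) :
    0 ≤ (resolv δ z ^ 3).trace := by
  have h := (posDef_resolv hδ z).posSemidef.conjTranspose_mul_mul_same (resolv δ z)
  rw [Matrix.conjTranspose_eq_transpose_of_trivial, resolv_transpose hδ] at h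
  have := h.trace_nonneg
  rwa [← pow_two, ← pow_succ] at this

/-- A positive definite A is the Gram matrix of the rows of its square root, so Cauchy–Schwarz gives
A_ij² ≤ A_ii A_jj. -/
theorem sum_sq_le_trace_sq {A : Matrix (Fin p) (Fin p) ℝ} (hA : A.PosDef) :
    ∑ i, ∑ j, A i j ^ 2 ≤ A.trace ^ 2 := by
  have hij : ∀ i j, A i j = ∑ k, root A i k * root A j k := fun i j => by
    conv_lhs => rw [← root_mul_root hA]
    rw [Matrix.mul_apply]
    refine Finset.sum_congr rfl fun k _ => ?_
    rw [← Matrix.transpose_apply (root A) k j, root_transpose]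
  calc ∑ i, ∑ j, A i j ^ 2 ≤ ∑ i, ∑ j, A i i * A j j :=
        Finset.sum_le_sum fun i _ => Finset.sum_le_sum fun j _ => by
          rw [hij i j, hij i i, hij j j]
          simpa [pow_two] using Finset.sum_mul_sq_le_sq_mul_sq Finset.univ (root A i) (root A j)
    _ = A.trace ^ 2 := by rw [← Finset.sum_mul_sum, pow_two]; rfl

/-- The mean of a diagonal quadratic form of the regularized inverse Gram matrix. -/
theorem integral_quadForm_resolv_le (hδ : 0 < δ) (γ : Fin p → ℝ) :
    ((n : ℝ) - p - 1) * ∫ z, γ ⬝ᵥ (resolv δ z *ᵥ γ) ∂(stdPi (Fin n × Fin p)) ≤ γ ⬝ᵥ γ := by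
  -- The constant field γγᵀ has no derivative term, and every remaining term carrying δ has a sign
  -- that allows it to be discarded.
  have hst := stein_resolv (n := n) hδ (M := fun _ => Matrix.vecMulVec γ γ) (N := fun _ _ _ _ => 0)
    (fun k l => BddCont.const _) (fun _ _ _ => BddCont.const _)
    (fun z i j l => hasDerivAt_const _ _)
  have e1 : ∀ A : Matrix (Fin p) (Fin p) ℝ, (A * Matrix.vecMulVec γ γ).trace = γ ⬝ᵥ (A *ᵥ γ) := by
    intro A
    rw [Matrix.mul_vecMulVec, Matrix.trace_vecMulVec, dotProduct_comm]
  simp only [e1, Matrix.trace_vecMulVec, mul_zero, Finset.sum_const_zero, add_zero] at hst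
  have hq1 : BddCont fun z : Fin n × Fin p → ℝ => γ ⬝ᵥ (resolv δ z *ᵥ γ) := by
    simp only [dotProduct, Matrix.mulVec]
    exact BddCont.sum _ fun k => (BddCont.const _).mul (BddCont.sum _ fun l =>
      (bddCont_resolv hδ k l).mul (BddCont.const _))
  have hT : BddCont fun z : Fin n × Fin p → ℝ => (resolv δ z).trace :=
    bddCont_trace (bddCont_resolv hδ)
  have hq2 : BddCont fun z : Fin n × Fin p → ℝ => γ ⬝ᵥ (resolv δ z ^ 2 *ᵥ γ) := by
    simp only [dotProduct, Matrix.mulVec, pow_two, Matrix.mul_apply]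
    exact BddCont.sum _ fun k => (BddCont.const _).mul (BddCont.sum _ fun l =>
      (BddCont.sum _ fun m => (bddCont_resolv hδ k m).mul (bddCont_resolv hδ m l)).mul
        (BddCont.const _))
  have hn1 : ∀ z : Fin n × Fin p → ℝ, 0 ≤ γ ⬝ᵥ (resolv δ z *ᵥ γ) := fun z => by
    simpa using (posDef_resolv hδ z).posSemidef.dotProduct_mulVec_nonneg γ
  have hn2 : ∀ z : Fin n × Fin p → ℝ, 0 ≤ γ ⬝ᵥ (resolv δ z ^ 2 *ᵥ γ) := fun z => by
    have : γ ⬝ᵥ (resolv δ z ^ 2 *ᵥ γ) = (resolv δ z *ᵥ γ) ⬝ᵥ (resolv δ z *ᵥ γ) := by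
      rw [pow_two, ← Matrix.mulVec_mulVec, Matrix.dotProduct_mulVec, ← Matrix.mulVec_transpose,
        resolv_transpose hδ]
    rw [this]
    exact Finset.sum_nonneg fun i _ => mul_self_nonneg _
  rw [← integral_const_mul]
  calc ∫ z, ((n : ℝ) - p - 1) * (γ ⬝ᵥ (resolv δ z *ᵥ γ)) ∂(stdPi (Fin n × Fin p))
      ≤ ∫ z, ((n - p - 1 + δ * (resolv δ z).trace) * (γ ⬝ᵥ (resolv δ z *ᵥ γ))
        + δ * (γ ⬝ᵥ (resolv δ z ^ 2 *ᵥ γ))) ∂(stdPi (Fin n × Fin p)) := by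
        refine integral_mono ((BddCont.const _).mul hq1).integrable
          ((((BddCont.const _).add ((BddCont.const _).mul hT)).mul hq1).add
            ((BddCont.const _).mul hq2)).integrable fun z => ?_
        have := mul_nonneg (mul_nonneg hδ.le (resolv_trace_nonneg hδ z)) (hn1 z)
        have := mul_nonneg hδ.le (hn2 z)
        simp only
        nlinarith
    _ = ∫ z, (γ ⬝ᵥ γ - δ * (γ ⬝ᵥ (resolv δ z *ᵥ γ))) ∂(stdPi (Fin n × Fin p)) := hst.symm
    _ ≤ ∫ _z, γ ⬝ᵥ γ ∂(stdPi (Fin n × Fin p)) := by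
        refine integral_mono ((BddCont.const _).sub ((BddCont.const _).mul hq1)).integrable
          (BddCont.const _).integrable fun z => ?_
        exact sub_le_self _ (mul_nonneg hδ.le (hn1 z))
    _ = γ ⬝ᵥ γ := by simp

theorem integral_trace_resolv_le (hδ : 0 < δ) :
    ((n : ℝ) - p - 1) * ∫ z, (resolv δ z).trace ∂(stdPi (Fin n × Fin p)) ≤ p := by
  have e1 : ∀ z : Fin n × Fin p → ℝ, (resolv δ z).trace
      = ∑ j, Pi.single j (1 : ℝ) ⬝ᵥ (resolv δ z *ᵥ Pi.single j 1) := fun z => by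
    simp [Matrix.trace]
  have hint : ∀ j : Fin p, Integrable (fun z : Fin n × Fin p → ℝ =>
      Pi.single j (1 : ℝ) ⬝ᵥ (resolv δ z *ᵥ Pi.single j 1)) (stdPi (Fin n × Fin p)) := fun j => by
    simpa using (bddCont_resolv (n := n) hδ j j).integrable
  simp only [e1]
  rw [integral_finsetSum _ fun j _ => hint j, Finset.mul_sum]
  calc _ ≤ ∑ j : Fin p, Pi.single j (1 : ℝ) ⬝ᵥ Pi.single j 1 :=
        Finset.sum_le_sum fun j _ => integral_quadForm_resolv_le hδ _
    _ = p := by simp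

theorem bddCont_resolv_pow (hδ : 0 < δ) (m : ℕ) (k l : Fin p) :
    BddCont fun z : Fin n × Fin p → ℝ => (resolv δ z ^ m) k l := by
  induction m generalizing k l with
  | zero => simpa using BddCont.const _
  | succ m ih =>
    simp only [pow_succ, Matrix.mul_apply]
    exact BddCont.sum _ fun j => (ih k j).mul (bddCont_resolv hδ j l)

theorem sum_mul_resolv_sq (hδ : 0 < δ) (z : Fin n × Fin p → ℝ) :
    ∑ i, ∑ j, (entryMatrix z * resolv δ z) i j * (entryMatrix z * resolv δ z * resolv δ z) i j
      = (resolv δ z ^ 2).trace - δ * (resolv δ z ^ 3).trace := by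
  rw [← trace_transpose_mul, ← Matrix.mul_assoc, transpose_mul_mul_resolv hδ, Matrix.sub_mul,
    Matrix.smul_mul, Matrix.trace_sub, Matrix.trace_smul, smul_eq_mul, ← pow_succ, ← pow_two]

theorem resolv_apply_comm (hδ : 0 < δ) (z : Fin n × Fin p → ℝ) (j k : Fin p) :
    resolv δ z j k = resolv δ z k j := by
  conv_lhs => rw [← resolv_transpose hδ, Matrix.transpose_apply]

/-- Stein's identity for the field (tr R) · 1. The derivative of tr R in the entry (i, j) is -2
(ZR²)_ij, and its contraction with ZR produces the term 2 tr R². -/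
theorem integral_trace_sq_resolv_le (hδ : 0 < δ) :
    ((n : ℝ) - p - 1) * ∫ z, (resolv δ z).trace ^ 2 ∂(stdPi (Fin n × Fin p))
      ≤ p * ∫ z, (resolv δ z).trace ∂(stdPi (Fin n × Fin p))
        + 2 * ∫ z, (resolv δ z ^ 2).trace ∂(stdPi (Fin n × Fin p)) := by
  have hT : BddCont fun z : Fin n × Fin p → ℝ => (resolv δ z).trace :=
    bddCont_trace (bddCont_resolv hδ)
  have hT2 : BddCont fun z : Fin n × Fin p → ℝ => (resolv δ z ^ 2).trace :=
    bddCont_trace (bddCont_resolv_pow hδ 2)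
  have hT3 : BddCont fun z : Fin n × Fin p → ℝ => (resolv δ z ^ 3).trace :=
    bddCont_trace (bddCont_resolv_pow hδ 3)
  have hb : ∀ (i : Fin n) (j : Fin p), BddCont fun z : Fin n × Fin p → ℝ =>
      (entryMatrix z * resolv δ z * resolv δ z) i j := fun i j => by
    have e : ∀ z : Fin n × Fin p → ℝ, (entryMatrix z * resolv δ z * resolv δ z) i j
        = ∑ k, (entryMatrix z * resolv δ z) i k * resolv δ z k j := fun z => Matrix.mul_apply
    simp only [e]
    exact BddCont.sum _ fun k => (bddCont_mul_resolv hδ i k).mul (bddCont_resolv hδ k j)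
  have hst := stein_resolv (n := n) hδ
    (M := fun z => (resolv δ z).trace • (1 : Matrix (Fin p) (Fin p) ℝ))
    (N := fun i j z l => (-2 * (entryMatrix z * resolv δ z * resolv δ z) i j)
      * (1 : Matrix (Fin p) (Fin p) ℝ) l j)
    (fun k l => by simpa using hT.mul (BddCont.const _))
    (fun i j l => ((BddCont.const _).mul (hb i j)).mul (BddCont.const _))
    (fun z i j l => by
      simp only [Matrix.smul_apply, smul_eq_mul]
      refine HasDerivAt.mul_const ?_ _
      have := HasDerivAt.fun_sum (u := Finset.univ) fun k _ => hasDerivAt_resolv hδ z i j k k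
      refine this.congr_deriv ?_
      rw [Matrix.mul_apply, Finset.mul_sum]
      refine Finset.sum_congr rfl fun k _ => ?_
      rw [resolv_apply_comm hδ z j k]; ring)
  have e1 : ∀ z : Fin n × Fin p → ℝ, ∑ i, ∑ j, ∑ l, (entryMatrix z * resolv δ z) i l
      * ((-2 * (entryMatrix z * resolv δ z * resolv δ z) i j) * (1 : Matrix (Fin p) (Fin p) ℝ) l j)
      = -2 * (resolv δ z ^ 2).trace + 2 * δ * (resolv δ z ^ 3).trace := by
    intro z
    have := sum_mul_resolv_sq hδ z
    rw [show -2 * (resolv δ z ^ 2).trace + 2 * δ * (resolv δ z ^ 3).trace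
      = -2 * ((resolv δ z ^ 2).trace - δ * (resolv δ z ^ 3).trace) by ring, ← this, Finset.mul_sum]
    refine Finset.sum_congr rfl fun i _ => ?_
    rw [Finset.mul_sum]
    refine Finset.sum_congr rfl fun j _ => ?_
    rw [Finset.sum_eq_single j]
    · simp; ring
    · intro b _ hb; simp [hb]
    · simp
  simp only [e1, Matrix.trace_smul, Matrix.trace_one, Fintype.card_fin, Matrix.mul_smul,
    Matrix.mul_one, smul_eq_mul] at hst
  rw [← integral_const_mul, ← integral_const_mul, ← integral_const_mul, ← integral_add
    ((BddCont.const _).mul hT).integrable ((BddCont.const _).mul hT2).integrable]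
  have hL : BddCont fun z : Fin n × Fin p → ℝ => (resolv δ z).trace * p
      - δ * ((resolv δ z).trace * (resolv δ z).trace) :=
    (hT.mul (BddCont.const _)).sub ((BddCont.const _).mul (hT.mul hT))
  have hR : BddCont fun z : Fin n × Fin p → ℝ => (n - p - 1 + δ * (resolv δ z).trace)
      * ((resolv δ z).trace * (resolv δ z).trace) + δ * ((resolv δ z).trace * (resolv δ z ^ 2).trace)
      + (-2 * (resolv δ z ^ 2).trace + 2 * δ * (resolv δ z ^ 3).trace) :=
    ((((BddCont.const _).add ((BddCont.const _).mul hT)).mul (hT.mul hT)).add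
      ((BddCont.const _).mul (hT.mul hT2))).add
      (((BddCont.const _).mul hT2).add ((BddCont.const _).mul hT3))
  -- Stein's identity says that the last bracket integrates to zero. Subtracting it leaves only
  -- products of δ with nonnegative traces, so the integrand is pointwise nonnegative.
  have hdiff : 0 ≤ ∫ z, (((p * (resolv δ z).trace + 2 * (resolv δ z ^ 2).trace)
      - ((n : ℝ) - p - 1) * (resolv δ z).trace ^ 2)
      - (((resolv δ z).trace * p - δ * ((resolv δ z).trace * (resolv δ z).trace))
      - ((n - p - 1 + δ * (resolv δ z).trace)
      * ((resolv δ z).trace * (resolv δ z).trace) + δ * ((resolv δ z).trace * (resolv δ z ^ 2).trace)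
      + (-2 * (resolv δ z ^ 2).trace + 2 * δ * (resolv δ z ^ 3).trace))))
      ∂(stdPi (Fin n × Fin p)) := by
    refine integral_nonneg fun z => ?_
    have t1 := resolv_trace_nonneg hδ z
    have t2 := resolv_sq_trace_nonneg hδ z
    have t3 := mul_nonneg hδ.le (resolv_cube_trace_nonneg hδ z)
    have t4 := mul_nonneg hδ.le (pow_nonneg t1 3)
    have t5 := mul_nonneg hδ.le (mul_nonneg t1 t2)
    have t6 := mul_nonneg hδ.le (pow_nonneg t1 2)
    simp only [Pi.zero_apply]
    nlinarith
  rw [integral_sub ((((BddCont.const _).mul hT).add ((BddCont.const _).mul hT2)).sub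
    ((BddCont.const _).mul (hT.pow 2))).integrable (hL.sub hR).integrable,
    integral_sub hL.integrable hR.integrable, hst, sub_self, sub_zero,
    integral_sub (((BddCont.const _).mul hT).add ((BddCont.const _).mul hT2)).integrable
      ((BddCont.const _).mul (hT.pow 2)).integrable] at hdiff
  linarith

/-- Stein's identity for the field R. Differentiating R contributes -tr R², which lowers n - p - 1
to n - p - 2, and -(tr R)², which moves to the right-hand side. -/
theorem integral_sq_trace_resolv_le (hδ : 0 < δ) :
    ((n : ℝ) - p - 2) * ∫ z, (resolv δ z ^ 2).trace ∂(stdPi (Fin n × Fin p))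
      ≤ ∫ z, (resolv δ z).trace ∂(stdPi (Fin n × Fin p))
        + ∫ z, (resolv δ z).trace ^ 2 ∂(stdPi (Fin n × Fin p)) := by
  have hT : BddCont fun z : Fin n × Fin p → ℝ => (resolv δ z).trace :=
    bddCont_trace (bddCont_resolv hδ)
  have hT2 : BddCont fun z : Fin n × Fin p → ℝ => (resolv δ z ^ 2).trace :=
    bddCont_trace (bddCont_resolv_pow hδ 2)
  have hT3 : BddCont fun z : Fin n × Fin p → ℝ => (resolv δ z ^ 3).trace :=
    bddCont_trace (bddCont_resolv_pow hδ 3)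
  have hst := stein_resolv (n := n) (p := p) hδ (M := fun z => resolv δ z)
    (N := fun i j z l => -(resolv δ z l j * (entryMatrix z * resolv δ z) i j
        + (entryMatrix z * resolv δ z) i l * resolv δ z j j))
    (bddCont_resolv hδ)
    (fun i j l => (((bddCont_resolv hδ l j).mul (bddCont_mul_resolv hδ i j)).add
      ((bddCont_mul_resolv hδ i l).mul (bddCont_resolv hδ j j))).neg)
    (fun z i j l => hasDerivAt_resolv hδ z i j l j)
  have e1 : ∀ z : Fin n × Fin p → ℝ, ∑ i, ∑ j, ∑ l, (entryMatrix z * resolv δ z) i l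
      * -(resolv δ z l j * (entryMatrix z * resolv δ z) i j
        + (entryMatrix z * resolv δ z) i l * resolv δ z j j)
      = -((resolv δ z ^ 2).trace - δ * (resolv δ z ^ 3).trace)
        - ((resolv δ z).trace - δ * (resolv δ z ^ 2).trace) * (resolv δ z).trace := by
    intro z
    have h1 := sum_mul_resolv_sq hδ z
    have h2 : ∑ i, ∑ l, (entryMatrix z * resolv δ z) i l * (entryMatrix z * resolv δ z) i l
        = (resolv δ z).trace - δ * (resolv δ z ^ 2).trace := by
      rw [← trace_transpose_mul, transpose_mul_mul_resolv hδ, Matrix.trace_sub, Matrix.trace_smul,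
        smul_eq_mul]
    rw [← h1, ← h2, Finset.sum_mul, ← Finset.sum_neg_distrib, ← Finset.sum_sub_distrib]
    refine Finset.sum_congr rfl fun i _ => ?_
    rw [Matrix.trace, Finset.mul_sum, ← Finset.sum_neg_distrib, ← Finset.sum_sub_distrib]
    refine Finset.sum_congr rfl fun j _ => ?_
    rw [Matrix.mul_apply (M := entryMatrix z * resolv δ z), Finset.mul_sum, Finset.sum_mul,
      ← Finset.sum_neg_distrib, ← Finset.sum_sub_distrib]
    refine Finset.sum_congr rfl fun l _ => ?_
    rw [Matrix.diag]
    ring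
  simp only [e1, ← pow_two, ← pow_succ] at hst
  rw [← integral_const_mul, ← integral_add hT.integrable (hT.pow 2).integrable]
  have hL : BddCont fun z : Fin n × Fin p → ℝ => (resolv δ z).trace - δ * (resolv δ z ^ 2).trace :=
    hT.sub ((BddCont.const _).mul hT2)
  have hR : BddCont fun z : Fin n × Fin p → ℝ => (n - p - 1 + δ * (resolv δ z).trace)
      * (resolv δ z ^ 2).trace + δ * (resolv δ z ^ (2 + 1)).trace
      + (-((resolv δ z ^ 2).trace - δ * (resolv δ z ^ 3).trace)
        - ((resolv δ z).trace - δ * (resolv δ z ^ 2).trace) * (resolv δ z).trace) :=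
    ((((BddCont.const _).add ((BddCont.const _).mul hT)).mul hT2).add
      ((BddCont.const _).mul hT3)).add ((hT2.sub ((BddCont.const _).mul hT3)).neg.sub (hL.mul hT))
  have hdiff : 0 ≤ ∫ z, ((((resolv δ z).trace + (resolv δ z).trace ^ 2)
      - ((n : ℝ) - p - 2) * (resolv δ z ^ 2).trace)
      - (((resolv δ z).trace - δ * (resolv δ z ^ 2).trace)
      - ((n - p - 1 + δ * (resolv δ z).trace)
      * (resolv δ z ^ 2).trace + δ * (resolv δ z ^ (2 + 1)).trace
      + (-((resolv δ z ^ 2).trace - δ * (resolv δ z ^ 3).trace)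
        - ((resolv δ z).trace - δ * (resolv δ z ^ 2).trace) * (resolv δ z).trace))))
      ∂(stdPi (Fin n × Fin p)) := by
    refine integral_nonneg fun z => ?_
    have t1 := resolv_trace_nonneg hδ z
    have t2 := resolv_sq_trace_nonneg hδ z
    have t3 := mul_nonneg hδ.le (resolv_cube_trace_nonneg hδ z)
    have t5 := mul_nonneg hδ.le (mul_nonneg t1 t2)
    have t6 := mul_nonneg hδ.le t2
    simp only [Pi.zero_apply, show 2 + 1 = 3 from rfl]
    nlinarith
  rw [integral_sub ((hT.add (hT.pow 2)).sub ((BddCont.const _).mul hT2)).integrable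
    (hL.sub hR).integrable,
    integral_sub hL.integrable hR.integrable, hst, sub_self, sub_zero,
    integral_sub (hT.add (hT.pow 2)).integrable ((BddCont.const _).mul hT2).integrable] at hdiff
  linarith

end Stein

/-! ### Removing the regularization -/

section Limit

variable {n p : ℕ}

/-- The squared Frobenius norm. -/
def frobSq {a b : ℕ} (A : Matrix (Fin a) (Fin b) ℝ) : ℝ := ∑ i, ∑ j, A i j ^ 2

theorem frobSq_nonneg {a b : ℕ} (A : Matrix (Fin a) (Fin b) ℝ) : 0 ≤ frobSq A := by
  unfold frobSq; positivity

theorem continuous_frobSq {a b : ℕ} : Continuous (frobSq (a := a) (b := b)) := by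
  unfold frobSq
  exact continuous_finsetSum _ fun i _ => continuous_finsetSum _ fun j _ =>
    (continuous_id.matrix_elem i j).pow 2

theorem tendsto_resolv {z : Fin n × Fin p → ℝ}
    (h : IsUnit ((entryMatrix z)ᵀ * entryMatrix z).det) :
    Tendsto (fun k : ℕ => resolv (1 / ((k : ℝ) + 1)) z) atTop
      (𝓝 ((entryMatrix z)ᵀ * entryMatrix z)⁻¹) := by
  have hc : ContinuousAt (fun δ : ℝ => resolv δ z) 0 := by
    have h1 : Continuous fun δ : ℝ =>
      (entryMatrix z)ᵀ * entryMatrix z + δ • (1 : Matrix (Fin p) (Fin p) ℝ) := by fun_prop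
    unfold resolv
    simp only [Matrix.inv_def, Ring.inverse_eq_inv]
    refine (h1.matrix_det.continuousAt.inv₀ ?_).smul h1.matrix_adjugate.continuousAt
    simpa using h.ne_zero
  have := hc.tendsto.comp tendsto_one_div_add_atTop_nhds_zero_nat
  simpa [resolv, Function.comp_def] using this

/-- Passage to the limit in bounds for functions of the regularized inverse Gram matrix. -/
theorem lintegral_inv_le_of_resolv {q : Matrix (Fin p) (Fin p) ℝ → ℝ} (hq : Continuous q)
    (hq0 : q 0 = 0) (hq1 : ∀ δ > 0, ∀ z : Fin n × Fin p → ℝ, 0 ≤ q (resolv δ z)) {B : ℝ}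
    (hint : ∀ δ > 0, Integrable (fun z : Fin n × Fin p → ℝ => q (resolv δ z)) (stdPi (Fin n × Fin p)))
    (hB : ∀ δ > 0, ∫ z, q (resolv δ z) ∂(stdPi (Fin n × Fin p)) ≤ B) :
    ∫⁻ z, ENNReal.ofReal (q ((entryMatrix z)ᵀ * entryMatrix z)⁻¹) ∂(stdPi (Fin n × Fin p))
      ≤ ENNReal.ofReal B := by
  have hδ : ∀ k : ℕ, (0 : ℝ) < 1 / ((k : ℝ) + 1) := fun k => by positivity
  calc ∫⁻ z, ENNReal.ofReal (q ((entryMatrix z)ᵀ * entryMatrix z)⁻¹) ∂(stdPi (Fin n × Fin p))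
      ≤ ∫⁻ z, liminf (fun k : ℕ => ENNReal.ofReal (q (resolv (1 / ((k : ℝ) + 1)) z))) atTop
          ∂(stdPi (Fin n × Fin p)) := by
        refine lintegral_mono fun z => ?_
        by_cases h : IsUnit ((entryMatrix z)ᵀ * entryMatrix z).det
        · have := (ENNReal.tendsto_ofReal (hq.continuousAt.tendsto.comp (tendsto_resolv h)))
          exact this.liminf_eq.ge
        -- A singular Gram matrix has inverse 0 by convention and q vanishes there, so almost sure
        -- invertibility is not needed for the bound.
        · rw [Matrix.nonsing_inv_apply_not_isUnit _ h, hq0]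
          simp
    _ ≤ liminf (fun k : ℕ => ∫⁻ z, ENNReal.ofReal (q (resolv (1 / ((k : ℝ) + 1)) z))
          ∂(stdPi (Fin n × Fin p))) atTop :=
        lintegral_liminf_le fun k => (hq.comp (continuous_resolv (hδ k))).measurable.ennreal_ofReal
    _ ≤ liminf (fun _ : ℕ => ENNReal.ofReal B) atTop := by
        refine liminf_le_liminf (Eventually.of_forall fun k => ?_)
        rw [← ofReal_integral_eq_lintegral_ofReal (hint _ (hδ k)) (ae_of_all _ (hq1 _ (hδ k)))]
        exact ENNReal.ofReal_le_ofReal (hB _ (hδ k))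
    _ = ENNReal.ofReal B := liminf_const _

theorem continuous_quadForm (γ : Fin p → ℝ) :
    Continuous fun A : Matrix (Fin p) (Fin p) ℝ => γ ⬝ᵥ (A *ᵥ γ) := by fun_prop

theorem lintegral_quadForm_inv_le (h : p + 3 < n) (γ : Fin p → ℝ) :
    ∫⁻ z, ENNReal.ofReal (γ ⬝ᵥ (((entryMatrix z)ᵀ * entryMatrix z)⁻¹ *ᵥ γ)) ∂(stdPi (Fin n × Fin p))
      ≤ ENNReal.ofReal (γ ⬝ᵥ γ / ((n : ℝ) - p - 1)) := by
  have h' : (p : ℝ) + 3 < n := by exact_mod_cast h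
  refine lintegral_inv_le_of_resolv (q := fun A => γ ⬝ᵥ (A *ᵥ γ)) (continuous_quadForm γ) (by simp)
    (fun δ hδ z => by simpa using (posDef_resolv hδ z).posSemidef.dotProduct_mulVec_nonneg γ)
    (fun δ hδ => ?_) (fun δ hδ => ?_)
  · have : BddCont fun z : Fin n × Fin p → ℝ => γ ⬝ᵥ (resolv δ z *ᵥ γ) := by
      simp only [dotProduct, Matrix.mulVec]
      exact BddCont.sum _ fun k => (BddCont.const _).mul (BddCont.sum _ fun l =>
        (bddCont_resolv hδ k l).mul (BddCont.const _))
    exact this.integrable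
  · rw [le_div_iff₀ (by linarith), mul_comm]
    exact integral_quadForm_resolv_le hδ γ

/-- The bound for the mean of `tr (ZᵀZ)⁻²`. -/
noncomputable def invSqBound (n p : ℕ) : ℝ :=
  (p / ((n : ℝ) - p - 3) + p ^ 2 / ((n : ℝ) - p - 3) ^ 2) / ((n : ℝ) - p - 3)

/-- The three trace inequalities form a closed system. Let a, b, c be the means of tr R, (tr R)² and
tr R². Since c ≤ b, the term 2c in the bound for b is absorbed on the left, lowering n - p - 1 to m
= n - p - 3. Then a ≤ p/m, b ≤ p²/m² and mc ≤ a + b. -/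
theorem integral_frobSq_resolv_le (h : p + 3 < n) {δ : ℝ} (hδ : 0 < δ) :
    ∫ z, frobSq (resolv δ z) ∂(stdPi (Fin n × Fin p)) ≤ invSqBound n p := by
  have h' : (p : ℝ) + 3 < n := by exact_mod_cast h
  have hT : BddCont fun z : Fin n × Fin p → ℝ => (resolv δ z).trace :=
    bddCont_trace (bddCont_resolv hδ)
  have hT2 : BddCont fun z : Fin n × Fin p → ℝ => (resolv δ z ^ 2).trace :=
    bddCont_trace (bddCont_resolv_pow hδ 2)
  have e : ∀ z : Fin n × Fin p → ℝ, frobSq (resolv δ z) = (resolv δ z ^ 2).trace := fun z =>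
    (resolv_sq_trace hδ z).symm
  simp only [e]
  have h1 := integral_trace_resolv_le (n := n) (p := p) hδ
  have h2 := integral_trace_sq_resolv_le (n := n) (p := p) hδ
  have h3 := integral_sq_trace_resolv_le (n := n) (p := p) hδ
  have h4 : ∫ z, (resolv δ z ^ 2).trace ∂(stdPi (Fin n × Fin p))
      ≤ ∫ z, (resolv δ z).trace ^ 2 ∂(stdPi (Fin n × Fin p)) :=
    integral_mono hT2.integrable (hT.pow 2).integrable fun z => by
      simp only
      rw [resolv_sq_trace hδ]
      exact sum_sq_le_trace_sq (posDef_resolv hδ z)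
  have h5 : 0 ≤ ∫ z, (resolv δ z).trace ∂(stdPi (Fin n × Fin p)) :=
    integral_nonneg fun z => resolv_trace_nonneg hδ z
  have h6 : 0 ≤ ∫ z, (resolv δ z ^ 2).trace ∂(stdPi (Fin n × Fin p)) :=
    integral_nonneg fun z => resolv_sq_trace_nonneg hδ z
  set a := ∫ z, (resolv δ z).trace ∂(stdPi (Fin n × Fin p))
  set b := ∫ z, (resolv δ z).trace ^ 2 ∂(stdPi (Fin n × Fin p))
  set c := ∫ z, (resolv δ z ^ 2).trace ∂(stdPi (Fin n × Fin p))
  set m := (n : ℝ) - p - 3 with hm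
  have hm0 : 0 < m := by rw [hm]; linarith
  have hp0 : (0 : ℝ) ≤ p := Nat.cast_nonneg _
  have ha : a ≤ p / m := by rw [le_div_iff₀ hm0]; nlinarith
  have hb : b ≤ p ^ 2 / m ^ 2 := by
    have : m * b ≤ p * a := by nlinarith
    have : b ≤ p * (p / m) / m := by
      rw [le_div_iff₀ hm0]
      nlinarith [mul_le_mul_of_nonneg_left ha hp0]
    refine this.trans (le_of_eq ?_)
    field_simp
  rw [invSqBound, ← hm, le_div_iff₀ hm0]
  nlinarith

theorem lintegral_frobSq_inv_le (h : p + 3 < n) :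
    ∫⁻ z, ENNReal.ofReal (frobSq ((entryMatrix z)ᵀ * entryMatrix z)⁻¹) ∂(stdPi (Fin n × Fin p))
      ≤ ENNReal.ofReal (invSqBound n p) := by
  refine lintegral_inv_le_of_resolv continuous_frobSq (by simp [frobSq])
    (fun δ hδ z => frobSq_nonneg _) (fun δ hδ => ?_) (fun δ hδ => integral_frobSq_resolv_le h hδ)
  have : BddCont fun z : Fin n × Fin p → ℝ => frobSq (resolv δ z) :=
    BddCont.sum _ fun i => BddCont.sum _ fun j => (bddCont_resolv hδ i j).pow 2
  exact this.integrable

theorem norm_sq_mulE_le_frobSq {a b : ℕ} (A : Matrix (Fin a) (Fin b) ℝ)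
    (u : EuclideanSpace ℝ (Fin b)) : ‖mulE A u‖ ^ 2 ≤ frobSq A * ‖u‖ ^ 2 := by
  rw [EuclideanSpace.real_norm_sq_eq, EuclideanSpace.real_norm_sq_eq, frobSq, Finset.sum_mul]
  refine Finset.sum_le_sum fun i _ => ?_
  have := Finset.sum_mul_sq_le_sq_mul_sq Finset.univ (A i) u.ofLp
  simpa [mulE, Matrix.mulVec, dotProduct] using this

/-- A Gaussian matrix with enough rows has almost surely an invertible Gram matrix. -/
theorem ae_isUnit_gram (h : p + 3 < n) :
    ∀ᵐ z ∂(stdPi (Fin n × Fin p)), IsUnit ((entryMatrix z)ᵀ * entryMatrix z).det := by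
  set E := {z : Fin n × Fin p → ℝ | ¬ IsUnit ((entryMatrix z)ᵀ * entryMatrix z).det} with hE
  have hc : Continuous fun z : Fin n × Fin p → ℝ => ((entryMatrix z)ᵀ * entryMatrix z).det :=
    (continuous_entryMatrix.matrix_transpose.matrix_mul continuous_entryMatrix).matrix_det
  have hEm : MeasurableSet E := by
    have : E = (fun z : Fin n × Fin p → ℝ => ((entryMatrix z)ᵀ * entryMatrix z).det) ⁻¹' {0} := by
      ext z; simp [hE]
    rw [this]
    exact hc.measurable (measurableSet_singleton 0)
  -- On a null vector of ZᵀZ the regularized inverse acts as δ⁻¹, so its squared Frobenius norm is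
  -- at least δ⁻². Its mean is bounded uniformly in δ, which forces singularity to have probability
  -- zero as δ → 0.
  have hlow : ∀ δ > 0, ∀ z ∈ E, (δ ^ 2)⁻¹ ≤ frobSq (resolv δ z) := by
    intro δ hδ z hz
    have hz' : ((entryMatrix z)ᵀ * entryMatrix z).det = 0 := by simpa [hE] using hz
    obtain ⟨v, hv0, hv⟩ := Matrix.exists_mulVec_eq_zero_iff.2 hz'
    set u : EuclideanSpace ℝ (Fin p) := WithLp.toLp 2 v
    have hu0 : ‖u‖ ≠ 0 := by simpa [u] using hv0
    have h1 : mulE (resolv δ z) u = δ⁻¹ • u := by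
      have h2 : mulE ((entryMatrix z)ᵀ * entryMatrix z + δ • (1 : Matrix (Fin p) (Fin p) ℝ)) u
          = δ • u := by
        simp [mulE, Matrix.add_mulVec, u, hv, Matrix.smul_mulVec]
      have h3 : mulE (resolv δ z) (δ • u) = u := by
        rw [← h2, ← mulE_mul, resolv, Matrix.nonsing_inv_mul _ (isUnit_det_regularized hδ z),
          mulE_one]
      rw [mulE_smul] at h3
      rw [← h3, smul_smul, inv_mul_cancel₀ hδ.ne', one_smul, h3]
    have h2 := norm_sq_mulE_le_frobSq (resolv δ z) u
    rw [h1, norm_smul, mul_pow, Real.norm_eq_abs, abs_of_pos (inv_pos.2 hδ), inv_pow] at h2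
    exact le_of_mul_le_mul_right h2 (by positivity)
  have hbound : ∀ δ > 0, (stdPi (Fin n × Fin p)).real E ≤ δ ^ 2 * invSqBound n p := by
    intro δ hδ
    have hint : BddCont fun z : Fin n × Fin p → ℝ => frobSq (resolv δ z) :=
      BddCont.sum _ fun i => BddCont.sum _ fun j => (bddCont_resolv hδ i j).pow 2
    have h1 : (δ ^ 2)⁻¹ * (stdPi (Fin n × Fin p)).real E
        ≤ ∫ z, frobSq (resolv δ z) ∂(stdPi (Fin n × Fin p)) := by
      calc (δ ^ 2)⁻¹ * (stdPi (Fin n × Fin p)).real E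
          = ∫ _z in E, (δ ^ 2)⁻¹ ∂(stdPi (Fin n × Fin p)) := by
            rw [setIntegral_const, smul_eq_mul, mul_comm]
        _ ≤ ∫ z in E, frobSq (resolv δ z) ∂(stdPi (Fin n × Fin p)) :=
            setIntegral_mono_on (integrable_const _).integrableOn hint.integrable.integrableOn hEm
              (hlow δ hδ)
        _ ≤ ∫ z, frobSq (resolv δ z) ∂(stdPi (Fin n × Fin p)) :=
            setIntegral_le_integral hint.integrable (ae_of_all _ fun z => frobSq_nonneg _)
    rw [inv_mul_eq_div, div_le_iff₀ (by positivity)] at h1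
    refine h1.trans ?_
    rw [mul_comm]
    exact mul_le_mul_of_nonneg_left (integral_frobSq_resolv_le h hδ) (by positivity)
  have hlim : Tendsto (fun δ : ℝ => δ ^ 2 * invSqBound n p) (𝓝[>] 0) (𝓝 0) := by
    have : Continuous fun δ : ℝ => δ ^ 2 * invSqBound n p := by fun_prop
    have := (this.tendsto 0).mono_left (nhdsWithin_le_nhds (s := Set.Ioi 0))
    simpa using this
  have h0 : (stdPi (Fin n × Fin p)).real E ≤ 0 :=
    ge_of_tendsto hlim (by filter_upwards [self_mem_nhdsWithin] with δ hδ using hbound δ hδ)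
  have h1 : (stdPi (Fin n × Fin p)).real E = 0 := le_antisymm h0 measureReal_nonneg
  rw [measureReal_eq_zero_iff] at h1
  exact h1

end Limit

/-! ### Inverse moments for a general covariance -/

section DesignMoments

open scoped Matrix.Norms.L2Operator

variable {n p : ℕ}

theorem continuous_designMatrix : Continuous (designMatrix (n := n) (p := p)) :=
  continuous_pi fun i => continuous_pi fun j => by
    simp only [designMatrix, Matrix.of_apply]; fun_prop

theorem continuous_gram : Continuous (gram (n := n) (p := p)) :=
  continuous_designMatrix.matrix_transpose.matrix_mul continuous_designMatrix

theorem measurable_gram_inv_apply (i j : Fin p) :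
    Measurable fun X : Design n p => (gram X)⁻¹ i j := by
  simp only [Matrix.inv_def, Ring.inverse_eq_inv]
  have h1 : Measurable fun X : Design n p => (gram X).det :=
    continuous_gram.matrix_det.measurable
  have h2 : Measurable fun X : Design n p => (gram X).adjugate i j :=
    (continuous_gram.matrix_adjugate.matrix_elem i j).measurable
  exact h1.inv.mul h2

theorem gram_inv_designOf (S : Matrix (Fin p) (Fin p) ℝ) (z : Fin n × Fin p → ℝ) :
    (gram (designOf S z))⁻¹
      = (root S)⁻¹ * (((entryMatrix z)ᵀ * entryMatrix z)⁻¹ * (root S)⁻¹) := by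
  rw [gram_designOf, Matrix.mul_inv_rev, Matrix.mul_inv_rev]

theorem frobSq_transpose {a b : ℕ} (A : Matrix (Fin a) (Fin b) ℝ) : frobSq Aᵀ = frobSq A := by
  unfold frobSq
  rw [Finset.sum_comm]
  rfl

theorem frobSq_eq_sum_col {a b : ℕ} (A : Matrix (Fin a) (Fin b) ℝ) :
    frobSq A = ∑ j, ‖mulE A (EuclideanSpace.single j 1)‖ ^ 2 := by
  unfold frobSq
  rw [Finset.sum_comm]
  refine Finset.sum_congr rfl fun j _ => ?_
  rw [EuclideanSpace.real_norm_sq_eq]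
  refine Finset.sum_congr rfl fun i _ => ?_
  simp [mulE]

theorem frobSq_mul_le {a b c : ℕ} (A : Matrix (Fin a) (Fin b) ℝ) (B : Matrix (Fin b) (Fin c) ℝ) :
    frobSq (A * B) ≤ ‖A‖ ^ 2 * frobSq B := by
  rw [frobSq_eq_sum_col, frobSq_eq_sum_col, Finset.mul_sum]
  refine Finset.sum_le_sum fun j _ => ?_
  rw [mulE_mul, ← mul_pow]
  exact pow_le_pow_left₀ (norm_nonneg _) (norm_mulE_le _ _) 2

theorem frobSq_mul_le' {a b c : ℕ} (A : Matrix (Fin a) (Fin b) ℝ) (B : Matrix (Fin b) (Fin c) ℝ) :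
    frobSq (A * B) ≤ frobSq A * ‖B‖ ^ 2 := by
  rw [← frobSq_transpose, Matrix.transpose_mul, mul_comm, ← norm_transpose B, ← frobSq_transpose A]
  exact frobSq_mul_le _ _

/-- Substituting γ = S^{-1/2}β turns the form into the one for white rows, and ‖γ‖² ≤ ‖S⁻¹‖ ‖β‖². -/
theorem lintegral_quadForm_gram_inv_le (h : p + 3 < n) {S : Matrix (Fin p) (Fin p) ℝ}
    (hS : S.PosDef) (β : EuclideanSpace ℝ (Fin p)) :
    ∫⁻ X, ENNReal.ofReal (β.ofLp ⬝ᵥ ((gram X)⁻¹ *ᵥ β.ofLp)) ∂(designLaw n S)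
      ≤ ENNReal.ofReal (specNorm S⁻¹ * ‖β‖ ^ 2 / ((n : ℝ) - p - 1)) := by
  have h' : (p : ℝ) + 3 < n := by exact_mod_cast h
  have hm : Measurable fun X : Design n p =>
      ENNReal.ofReal (β.ofLp ⬝ᵥ ((gram X)⁻¹ *ᵥ β.ofLp)) := by
    refine Measurable.ennreal_ofReal ?_
    simp only [dotProduct, Matrix.mulVec]
    exact Finset.measurable_sum _ fun i _ => measurable_const.mul (Finset.measurable_sum _
      fun j _ => (measurable_gram_inv_apply i j).mul_const _)
  rw [designLaw_eq_map, lintegral_map hm (measurable_designOf S)]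
  set γ := (root S)⁻¹ *ᵥ β.ofLp with hγ
  have hrt : ((root S)⁻¹)ᵀ = (root S)⁻¹ := by rw [Matrix.transpose_nonsing_inv, root_transpose]
  have e : ∀ z : Fin n × Fin p → ℝ, β.ofLp ⬝ᵥ ((gram (designOf S z))⁻¹ *ᵥ β.ofLp)
      = γ ⬝ᵥ (((entryMatrix z)ᵀ * entryMatrix z)⁻¹ *ᵥ γ) := by
    intro z
    rw [gram_inv_designOf, ← Matrix.mulVec_mulVec, ← Matrix.mulVec_mulVec, ← hγ,
      Matrix.dotProduct_mulVec, ← Matrix.mulVec_transpose, hrt]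
  simp only [e]
  refine (lintegral_quadForm_inv_le h γ).trans (ENNReal.ofReal_le_ofReal ?_)
  refine div_le_div_of_nonneg_right ?_ (by linarith)
  have h1 : γ ⬝ᵥ γ = ‖mulE (root S)⁻¹ β‖ ^ 2 := by
    rw [← real_inner_self_eq_norm_sq, inner_eq_dotProduct]; rfl
  rw [h1, ← norm_root_inv_sq hS, ← mul_pow]
  exact pow_le_pow_left₀ (norm_nonneg _) (norm_mulE_le _ _) 2

theorem lintegral_frobSq_gram_inv_le (h : p + 3 < n) {S : Matrix (Fin p) (Fin p) ℝ}
    (hS : S.PosDef) :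
    ∫⁻ X, ENNReal.ofReal (frobSq (gram X)⁻¹) ∂(designLaw n S)
      ≤ ENNReal.ofReal (specNorm S⁻¹ ^ 2 * invSqBound n p) := by
  have hm : Measurable fun X : Design n p => ENNReal.ofReal (frobSq (gram X)⁻¹) := by
    refine Measurable.ennreal_ofReal ?_
    exact Finset.measurable_sum _ fun i _ => Finset.measurable_sum _ fun j _ =>
      (measurable_gram_inv_apply i j).pow_const 2
  rw [designLaw_eq_map, lintegral_map hm (measurable_designOf S)]
  have hpos : 0 ≤ specNorm S⁻¹ ^ 2 := sq_nonneg _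
  calc _ ≤ ∫⁻ z, ENNReal.ofReal (specNorm S⁻¹ ^ 2)
        * ENNReal.ofReal (frobSq ((entryMatrix z)ᵀ * entryMatrix z)⁻¹) ∂(stdPi (Fin n × Fin p)) := by
        refine lintegral_mono fun z => ?_
        rw [← ENNReal.ofReal_mul hpos]
        refine ENNReal.ofReal_le_ofReal ?_
        rw [gram_inv_designOf]
        refine (frobSq_mul_le _ _).trans ?_
        refine (mul_le_mul_of_nonneg_left (frobSq_mul_le' _ _) (sq_nonneg _)).trans (le_of_eq ?_)
        rw [norm_root_inv_sq hS]
        ring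
    _ ≤ _ := by
        rw [lintegral_const_mul' _ _ ENNReal.ofReal_ne_top, ENNReal.ofReal_mul hpos]
        exact mul_le_mul_right (lintegral_frobSq_inv_le h) _

theorem ae_isUnit_gram_designLaw (h : p + 3 < n) {S : Matrix (Fin p) (Fin p) ℝ} (hS : S.PosDef) :
    ∀ᵐ X ∂(designLaw n S), IsUnit (gram X).det := by
  rw [designLaw_eq_map]
  have hm : MeasurableSet {X : Design n p | IsUnit (gram X).det} := by
    have : Measurable fun X : Design n p => (gram X).det :=
      continuous_gram.matrix_det.measurable
    simp only [isUnit_iff_ne_zero]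
    exact (this (measurableSet_singleton 0)).compl
  rw [ae_map_iff (measurable_designOf S).aemeasurable hm]
  filter_upwards [ae_isUnit_gram h] with z hz
  rw [gram_designOf, Matrix.det_mul, Matrix.det_mul]
  exact ((isUnit_det_root hS).mul hz).mul (isUnit_det_root hS)

end DesignMoments

/-! ### Second moments of Gaussian linear and quadratic forms -/

section GaussianPolynomials

variable {I : Type*} [Fintype I]

/-- All moments of `f` under the standard Gaussian law are finite. -/
def AllMoments (f : (I → ℝ) → ℝ) : Prop := ∀ r : ℝ≥0∞, r ≠ ∞ → MemLp f r (stdPi I)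

theorem AllMoments.const (c : ℝ) : AllMoments fun _ : I → ℝ => c := fun _ _ => memLp_const c

theorem AllMoments.coord (i : I) : AllMoments fun x : I → ℝ => x i := fun r hr =>
  (memLp_id_gaussianReal' r hr).comp_measurePreserving
    (measurePreserving_eval (fun _ : I => gaussianReal 0 1) i)

theorem AllMoments.add {f g : (I → ℝ) → ℝ} (hf : AllMoments f) (hg : AllMoments g) :
    AllMoments fun x => f x + g x := fun r hr => (hf r hr).add (hg r hr)

theorem AllMoments.mul {f g : (I → ℝ) → ℝ} (hf : AllMoments f) (hg : AllMoments g) :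
    AllMoments fun x => f x * g x := fun r hr => by
  have h2 : 2 * r ≠ ∞ := ENNReal.mul_ne_top (by simp) hr
  have : ENNReal.HolderTriple (2 * r) (2 * r) r := ⟨by
    rw [ENNReal.mul_inv (by simp) (by simp), ← add_mul, ENNReal.inv_two_add_inv_two, one_mul]⟩
  exact (hg _ h2).mul' (hf _ h2)

theorem AllMoments.sum {K : Type*} (s : Finset K) {f : K → (I → ℝ) → ℝ}
    (hf : ∀ k, AllMoments (f k)) : AllMoments fun x => ∑ k ∈ s, f k x := fun r hr =>
  memLp_finsetSum s fun k _ => hf k r hr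

theorem AllMoments.sq {f : (I → ℝ) → ℝ} (hf : AllMoments f) : AllMoments fun x => f x ^ 2 := by
  simpa only [pow_two] using hf.mul hf

theorem AllMoments.integrable {f : (I → ℝ) → ℝ} (hf : AllMoments f) : Integrable f (stdPi I) :=
  memLp_one_iff_integrable.1 (hf 1 (by simp))

theorem AllMoments.linear (v : I → ℝ) : AllMoments fun x => v ⬝ᵥ x :=
  AllMoments.sum _ fun i => (AllMoments.const (v i)).mul (AllMoments.coord i)

theorem AllMoments.mulVec_apply (Q : Matrix I I ℝ) (i : I) : AllMoments fun x => (Q *ᵥ x) i :=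
  AllMoments.linear (Q i)

theorem AllMoments.quadForm (Q : Matrix I I ℝ) : AllMoments fun x => x ⬝ᵥ (Q *ᵥ x) :=
  AllMoments.sum _ fun i => (AllMoments.coord i).mul (AllMoments.mulVec_apply Q i)

theorem hasDerivAt_dotProduct {u v : ℝ → I → ℝ} {u' v' : I → ℝ} {t : ℝ} (hu : HasDerivAt u u' t)
    (hv : HasDerivAt v v' t) : HasDerivAt (fun t => u t ⬝ᵥ v t) (u' ⬝ᵥ v t + u t ⬝ᵥ v') t := by
  have := HasDerivAt.fun_sum (u := Finset.univ) fun i (_ : i ∈ Finset.univ) =>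
    (hasDerivAt_pi.1 hu i).mul (hasDerivAt_pi.1 hv i)
  refine this.congr_deriv ?_
  simp [dotProduct, Finset.sum_add_distrib]

theorem integral_linear_sq (v : I → ℝ) : ∫ x, (v ⬝ᵥ x) ^ 2 ∂(stdPi I) = v ⬝ᵥ v := by
  classical
  have hl := AllMoments.linear v
  have e : ∀ x : I → ℝ, (v ⬝ᵥ x) ^ 2 = ∑ i, x i * (v i * (v ⬝ᵥ x)) := fun x => by
    rw [pow_two]
    conv_lhs => enter [1]; rw [dotProduct]
    rw [Finset.sum_mul]
    exact Finset.sum_congr rfl fun i _ => by ring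
  simp only [e]
  rw [integral_finsetSum _ fun i _ =>
    ((AllMoments.coord i).mul ((AllMoments.const (v i)).mul hl)).integrable]
  rw [dotProduct]
  refine Finset.sum_congr rfl fun i _ => ?_
  rw [integral_coord_mul_stdPi (F' := fun _ => v i * v i) i (fun x => ?_)
    ((AllMoments.const (v i)).mul hl).integrable
    ((AllMoments.coord i).mul ((AllMoments.const (v i)).mul hl)).integrable (integrable_const _)]
  · simp
  · have := (hasDerivAt_dotProduct (hasDerivAt_const (x i) v)
      (hasDerivAt_update x i (x i))).const_mul (v i)
    refine this.congr_deriv ?_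
    simp

/-- Integrating by parts against the factor x_i gives Q_ii E[xᵀQx] + 2 E[(Qx)_i²]. The first terms
sum to zero because the trace vanishes, and E[(Qx)_i²] is the squared norm of the i-th row. -/
theorem integral_quadForm_sq {Q : Matrix I I ℝ} (hQ : Qᵀ = Q) (h0 : Q.trace = 0) :
    ∫ x, (x ⬝ᵥ (Q *ᵥ x)) ^ 2 ∂(stdPi I) = 2 * ∑ i, ∑ j, Q i j ^ 2 := by
  classical
  have hq := AllMoments.quadForm Q
  have hL := AllMoments.mulVec_apply Q
  have e : ∀ x : I → ℝ, (x ⬝ᵥ (Q *ᵥ x)) ^ 2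
      = ∑ i, x i * ((Q *ᵥ x) i * (x ⬝ᵥ (Q *ᵥ x))) := fun x => by
    rw [pow_two]
    conv_lhs => enter [1]; rw [dotProduct]
    rw [Finset.sum_mul]
    exact Finset.sum_congr rfl fun i _ => by ring
  simp only [e]
  rw [integral_finsetSum _ fun i _ => ((AllMoments.coord i).mul ((hL i).mul hq)).integrable]
  have step : ∀ i, ∫ x, x i * ((Q *ᵥ x) i * (x ⬝ᵥ (Q *ᵥ x))) ∂(stdPi I)
      = Q i i * ∫ x, x ⬝ᵥ (Q *ᵥ x) ∂(stdPi I) + 2 * ∑ j, Q i j ^ 2 := by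
    intro i
    have hF' : AllMoments fun x : I → ℝ => Q i i * (x ⬝ᵥ (Q *ᵥ x)) + 2 * (Q *ᵥ x) i ^ 2 :=
      ((AllMoments.const _).mul hq).add ((AllMoments.const 2).mul (hL i).sq)
    rw [integral_coord_mul_stdPi
      (F' := fun x => Q i i * (x ⬝ᵥ (Q *ᵥ x)) + 2 * (Q *ᵥ x) i ^ 2) i (fun x => ?_)
      ((hL i).mul hq).integrable ((AllMoments.coord i).mul ((hL i).mul hq)).integrable
      hF'.integrable]
    · rw [integral_add ((AllMoments.const _).mul hq).integrable
        ((AllMoments.const 2).mul (hL i).sq).integrable, integral_const_mul, integral_const_mul,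
        show ∫ x, (Q *ᵥ x) i ^ 2 ∂(stdPi I) = ∑ j, Q i j ^ 2 by
          refine (integral_linear_sq fun j => Q i j).trans ?_
          simp [dotProduct, pow_two]]
    · have h1 := hasDerivAt_mulVec_update Q x i (x i)
      have h2 := hasDerivAt_dotProduct (hasDerivAt_update x i (x i)) h1
      have h3 := (hasDerivAt_pi.1 h1 i).mul h2
      refine h3.congr_deriv ?_
      have h4 : x ⬝ᵥ Q.col i = (Q *ᵥ x) i := by
        rw [dotProduct_comm]
        simp only [Matrix.mulVec, dotProduct, Matrix.col_apply]
        exact Finset.sum_congr rfl fun k _ => by rw [← hQ, Matrix.transpose_apply, hQ]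
      simp only [Function.update_eq_self, h4, single_dotProduct, one_mul, Matrix.col_apply]
      ring
  rw [Finset.sum_congr rfl fun i _ => step i, Finset.sum_add_distrib, ← Finset.sum_mul,
    ← Finset.mul_sum]
  have : ∑ i, Q i i = 0 := h0
  rw [this]
  ring

/-- The second moment of a linear plus a traceless quadratic form of a Gaussian vector. -/
theorem integral_linear_add_quadForm_sq_le {Q : Matrix I I ℝ} (hQ : Qᵀ = Q) (h0 : Q.trace = 0)
    (w : I → ℝ) (s t : ℝ) :
    Integrable (fun x => (s * (w ⬝ᵥ x) + t * (x ⬝ᵥ (Q *ᵥ x))) ^ 2) (stdPi I) ∧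
    ∫ x, (s * (w ⬝ᵥ x) + t * (x ⬝ᵥ (Q *ᵥ x))) ^ 2 ∂(stdPi I)
      ≤ 2 * s ^ 2 * (w ⬝ᵥ w) + 4 * t ^ 2 * ∑ i, ∑ j, Q i j ^ 2 := by
  have h1 := AllMoments.linear w
  have h2 := AllMoments.quadForm Q
  have h3 : AllMoments fun x => (s * (w ⬝ᵥ x) + t * (x ⬝ᵥ (Q *ᵥ x))) ^ 2 :=
    (((AllMoments.const s).mul h1).add ((AllMoments.const t).mul h2)).sq
  have h4 : AllMoments fun x => 2 * s ^ 2 * (w ⬝ᵥ x) ^ 2 := (AllMoments.const _).mul h1.sq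
  have h5 : AllMoments fun x => 2 * t ^ 2 * (x ⬝ᵥ (Q *ᵥ x)) ^ 2 := (AllMoments.const _).mul h2.sq
  refine ⟨h3.integrable, ?_⟩
  calc _ ≤ ∫ x, (2 * s ^ 2 * (w ⬝ᵥ x) ^ 2 + 2 * t ^ 2 * (x ⬝ᵥ (Q *ᵥ x)) ^ 2) ∂(stdPi I) :=
        integral_mono h3.integrable (h4.add h5).integrable fun x => by
          simp only
          nlinarith [sq_nonneg (s * (w ⬝ᵥ x) - t * (x ⬝ᵥ (Q *ᵥ x)))]
    _ = _ := by
        rw [integral_add h4.integrable h5.integrable, integral_const_mul, integral_const_mul,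
          integral_linear_sq, integral_quadForm_sq hQ h0]
        ring

end GaussianPolynomials

/-! ### The bias-corrected estimator for a fixed design -/

section FixedDesign

variable {n p : ℕ}

theorem frobSq_eq_trace {a b : ℕ} (A : Matrix (Fin a) (Fin b) ℝ) : frobSq A = (Aᵀ * A).trace := by
  rw [trace_transpose_mul]
  simp [frobSq, pow_two]

theorem gram_transpose (X : Design n p) : (gram X)ᵀ = gram X := by simp [gram]

theorem gram_inv_transpose (X : Design n p) : ((gram X)⁻¹)ᵀ = (gram X)⁻¹ := by
  rw [Matrix.transpose_nonsing_inv, gram_transpose]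

/-- The matrix `(XᵀX)⁻¹ Xᵀ` of the least squares estimator. -/
noncomputable def olsMatrix (X : Design n p) : Matrix (Fin p) (Fin n) ℝ :=
  (gram X)⁻¹ * (designMatrix X)ᵀ

/-- The residual projection `I - X (XᵀX)⁻¹ Xᵀ`. -/
noncomputable def residMatrix (X : Design n p) : Matrix (Fin n) (Fin n) ℝ :=
  1 - designMatrix X * olsMatrix X

/-- The matrix of the quadratic part of the bias-corrected estimator. -/
noncomputable def biasQuad (X : Design n p) : Matrix (Fin n) (Fin n) ℝ :=
  (olsMatrix X)ᵀ * olsMatrix X - (((gram X)⁻¹).trace / ((n : ℝ) - p)) • residMatrix X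

variable {X : Design n p}

theorem olsMatrix_transpose : (olsMatrix X)ᵀ = designMatrix X * (gram X)⁻¹ := by
  rw [olsMatrix, Matrix.transpose_mul, gram_inv_transpose, Matrix.transpose_transpose]

theorem olsMatrix_mul_design (h : IsUnit (gram X).det) : olsMatrix X * designMatrix X = 1 := by
  rw [olsMatrix, Matrix.mul_assoc, ← gram, Matrix.nonsing_inv_mul _ h]

theorem olsMatrix_mul_transpose (h : IsUnit (gram X).det) :
    olsMatrix X * (olsMatrix X)ᵀ = (gram X)⁻¹ := by
  rw [olsMatrix_transpose, ← Matrix.mul_assoc, olsMatrix_mul_design h, Matrix.one_mul]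

theorem residMatrix_transpose : (residMatrix X)ᵀ = residMatrix X := by
  rw [residMatrix, Matrix.transpose_sub, Matrix.transpose_one, Matrix.transpose_mul,
    olsMatrix_transpose, olsMatrix, Matrix.mul_assoc]

theorem residMatrix_sq (h : IsUnit (gram X).det) :
    residMatrix X * residMatrix X = residMatrix X := by
  have : designMatrix X * olsMatrix X * (designMatrix X * olsMatrix X)
      = designMatrix X * olsMatrix X := by
    rw [Matrix.mul_assoc, ← Matrix.mul_assoc (olsMatrix X), olsMatrix_mul_design h, Matrix.one_mul]
  rw [residMatrix, mul_sub, sub_mul, sub_mul, this]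
  simp

theorem residMatrix_trace (h : IsUnit (gram X).det) : (residMatrix X).trace = n - p := by
  rw [residMatrix, Matrix.trace_sub, Matrix.trace_mul_comm, olsMatrix_mul_design h]
  simp

theorem biasQuad_transpose : (biasQuad X)ᵀ = biasQuad X := by
  rw [biasQuad, Matrix.transpose_sub, Matrix.transpose_smul, residMatrix_transpose,
    Matrix.transpose_mul, Matrix.transpose_transpose]

/-- This is the unbiasedness of the estimator: with A the least squares matrix, tr AᵀA = tr (XᵀX)⁻¹,
while the residual projection has trace n - p. -/
theorem biasQuad_trace (hpn : p < n) (h : IsUnit (gram X).det) : (biasQuad X).trace = 0 := by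
  have hpn' : (p : ℝ) < n := by exact_mod_cast hpn
  have hne : (n : ℝ) - p ≠ 0 := by linarith
  rw [biasQuad, Matrix.trace_sub, Matrix.trace_smul, residMatrix_trace h, Matrix.trace_mul_comm,
    olsMatrix_mul_transpose h, smul_eq_mul]
  field_simp
  ring

theorem trace_sq_le_frobSq (A : Matrix (Fin p) (Fin p) ℝ) : A.trace ^ 2 ≤ p * frobSq A := by
  have h1 := sq_sum_le_card_mul_sum_sq (s := (Finset.univ : Finset (Fin p))) (f := fun i => A i i)
  rw [Finset.card_univ, Fintype.card_fin] at h1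
  refine h1.trans (mul_le_mul_of_nonneg_left ?_ (Nat.cast_nonneg _))
  exact Finset.sum_le_sum fun i _ =>
    Finset.single_le_sum (f := fun j => A i j ^ 2) (fun j _ => sq_nonneg _) (Finset.mem_univ i)

theorem frobSq_sub_smul_le {a b : ℕ} (A B : Matrix (Fin a) (Fin b) ℝ) (t : ℝ) :
    frobSq (A - t • B) ≤ 2 * frobSq A + 2 * t ^ 2 * frobSq B := by
  unfold frobSq
  simp only [Finset.mul_sum, ← Finset.sum_add_distrib]
  refine Finset.sum_le_sum fun i _ => Finset.sum_le_sum fun j _ => ?_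
  simp only [Matrix.sub_apply, Matrix.smul_apply, smul_eq_mul]
  nlinarith [sq_nonneg (A i j + t * B i j)]

/-- The matrix AᵀA has the Frobenius norm of AAᵀ = (XᵀX)⁻¹. The squared Frobenius norm of the
residual projection is its trace n - p, and tr² ≤ p · (squared Frobenius norm) bounds its
coefficient. -/
theorem frobSq_biasQuad_le (hpn : p < n) (h : IsUnit (gram X).det) :
    frobSq (biasQuad X) ≤ 2 * (1 + p / ((n : ℝ) - p)) * frobSq (gram X)⁻¹ := by
  have hpn' : (p : ℝ) < n := by exact_mod_cast hpn
  have hne : 0 < (n : ℝ) - p := by linarith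
  have h1 : frobSq ((olsMatrix X)ᵀ * olsMatrix X) = frobSq (gram X)⁻¹ := by
    rw [frobSq_eq_trace, frobSq_eq_trace, gram_inv_transpose, Matrix.transpose_mul,
      Matrix.transpose_transpose, Matrix.mul_assoc, Matrix.trace_mul_comm,
      Matrix.mul_assoc, Matrix.mul_assoc, olsMatrix_mul_transpose h, ← Matrix.mul_assoc,
      olsMatrix_mul_transpose h]
  have h2 : frobSq (residMatrix X) = n - p := by
    rw [frobSq_eq_trace, residMatrix_transpose, residMatrix_sq h, residMatrix_trace h]
  refine (frobSq_sub_smul_le _ _ _).trans ?_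
  rw [h1, h2]
  have h3 := trace_sq_le_frobSq (gram X)⁻¹
  have e : 2 * (((gram X)⁻¹).trace / ((n : ℝ) - p)) ^ 2 * ((n : ℝ) - p)
      = 2 * (((gram X)⁻¹).trace ^ 2 / ((n : ℝ) - p)) := by field_simp
  rw [e]
  have h4 : ((gram X)⁻¹).trace ^ 2 / ((n : ℝ) - p) ≤ p * frobSq (gram X)⁻¹ / ((n : ℝ) - p) :=
    div_le_div_of_nonneg_right h3 hne.le
  calc _ ≤ 2 * frobSq (gram X)⁻¹ + 2 * (p * frobSq (gram X)⁻¹ / ((n : ℝ) - p)) := by linarith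
    _ = _ := by ring

theorem ols_eq (h : IsUnit (gram X).det) (β : Fin p → ℝ) (ε : Fin n → ℝ) :
    ols (designMatrix X *ᵥ β + ε, X) = β + olsMatrix X *ᵥ ε := by
  simp only [ols]
  rw [Matrix.mulVec_mulVec, ← olsMatrix, Matrix.mulVec_add, Matrix.mulVec_mulVec,
    olsMatrix_mul_design h, Matrix.one_mulVec]

theorem sum_sq_mulVec {a b : ℕ} (A : Matrix (Fin a) (Fin b) ℝ) (x : Fin b → ℝ) :
    ∑ i, (A *ᵥ x) i ^ 2 = x ⬝ᵥ ((Aᵀ * A) *ᵥ x) := by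
  rw [← Matrix.mulVec_mulVec, Matrix.dotProduct_mulVec, Matrix.vecMul_transpose]
  simp [dotProduct, pow_two]

/-- Least squares returns β + Aε and the residual is Pε with P a symmetric projection, so ‖β‖²
cancels and only terms linear and quadratic in ε remain. -/
theorem biasCorrected_eq (h : IsUnit (gram X).det) (β : EuclideanSpace ℝ (Fin p))
    (ε : Fin n → ℝ) :
    biasCorrected (designMatrix X *ᵥ β.ofLp + ε, X) - ‖β‖ ^ 2
      = 2 * (((olsMatrix X)ᵀ *ᵥ β.ofLp) ⬝ᵥ ε) + ε ⬝ᵥ (biasQuad X *ᵥ ε) := by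
  have hr : designMatrix X *ᵥ β.ofLp + ε - designMatrix X *ᵥ (β.ofLp + olsMatrix X *ᵥ ε)
      = residMatrix X *ᵥ ε := by
    rw [residMatrix, Matrix.sub_mulVec, Matrix.one_mulVec, Matrix.mulVec_add,
      Matrix.mulVec_mulVec]
    abel
  have hs : sigmaSqHat (designMatrix X *ᵥ β.ofLp + ε, X)
      = (ε ⬝ᵥ (residMatrix X *ᵥ ε)) / ((n : ℝ) - p) := by
    rw [sigmaSqHat, ols_eq h]
    congr 1
    have : ∀ i, ((designMatrix X *ᵥ β.ofLp + ε) i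
        - (designMatrix X *ᵥ (β.ofLp + olsMatrix X *ᵥ ε)) i) = (residMatrix X *ᵥ ε) i := fun i => by
      rw [← hr]; rfl
    simp only [this]
    rw [sum_sq_mulVec, residMatrix_transpose, residMatrix_sq h]
  rw [biasCorrected, hs, ols_eq h, EuclideanSpace.real_norm_sq_eq, biasQuad, Matrix.sub_mulVec,
    Matrix.smul_mulVec, dotProduct_sub, dotProduct_smul, ← sum_sq_mulVec]
  have e1 : ∑ j, (β.ofLp + olsMatrix X *ᵥ ε) j ^ 2 = ∑ j, β.ofLp j ^ 2
      + 2 * (β.ofLp ⬝ᵥ (olsMatrix X *ᵥ ε)) + ∑ j, (olsMatrix X *ᵥ ε) j ^ 2 := by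
    simp only [dotProduct, Finset.mul_sum, ← Finset.sum_add_distrib, Pi.add_apply]
    exact Finset.sum_congr rfl fun j _ => by ring
  have e2 : ((olsMatrix X)ᵀ *ᵥ β.ofLp) ⬝ᵥ ε = β.ofLp ⬝ᵥ (olsMatrix X *ᵥ ε) := by
    rw [Matrix.mulVec_transpose, ← Matrix.dotProduct_mulVec]
  rw [e1, e2, smul_eq_mul]
  ring

/-- The risk of the bias-corrected estimator for a fixed design. -/
theorem lintegral_biasCorrected_le (hpn : p < n) (h : IsUnit (gram X).det)
    (β : EuclideanSpace ℝ (Fin p)) (σ : ℝ) :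
    ∫⁻ g, ENNReal.ofReal ((biasCorrected (designMatrix X *ᵥ β.ofLp + σ • g, X) - ‖β‖ ^ 2) ^ 2)
        ∂(stdPi (Fin n))
      ≤ ENNReal.ofReal (8 * σ ^ 2 * (β.ofLp ⬝ᵥ ((gram X)⁻¹ *ᵥ β.ofLp)))
        + ENNReal.ofReal (8 * σ ^ 4 * (1 + p / ((n : ℝ) - p)) * frobSq (gram X)⁻¹) := by
  have hpn' : (p : ℝ) < n := by exact_mod_cast hpn
  have hne : 0 < (n : ℝ) - p := by linarith
  have e : ∀ g : Fin n → ℝ, biasCorrected (designMatrix X *ᵥ β.ofLp + σ • g, X) - ‖β‖ ^ 2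
      = 2 * σ * (((olsMatrix X)ᵀ *ᵥ β.ofLp) ⬝ᵥ g) + σ ^ 2 * (g ⬝ᵥ (biasQuad X *ᵥ g)) := by
    intro g
    rw [biasCorrected_eq h, Matrix.mulVec_smul, dotProduct_smul, dotProduct_smul, smul_dotProduct]
    simp only [smul_eq_mul]
    ring
  simp only [e]
  obtain ⟨h1, h2⟩ := integral_linear_add_quadForm_sq_le (biasQuad_transpose (X := X))
    (biasQuad_trace hpn h) ((olsMatrix X)ᵀ *ᵥ β.ofLp) (2 * σ) (σ ^ 2)
  rw [← ofReal_integral_eq_lintegral_ofReal h1 (ae_of_all _ fun _ => sq_nonneg _)]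
  have h3 : ((olsMatrix X)ᵀ *ᵥ β.ofLp) ⬝ᵥ ((olsMatrix X)ᵀ *ᵥ β.ofLp)
      = β.ofLp ⬝ᵥ ((gram X)⁻¹ *ᵥ β.ofLp) := by
    have := sum_sq_mulVec (olsMatrix X)ᵀ β.ofLp
    rw [Matrix.transpose_transpose, olsMatrix_mul_transpose h] at this
    rw [← this]
    simp [dotProduct, pow_two]
  have h4 := frobSq_biasQuad_le hpn h
  have h5 : 0 ≤ 4 * (σ ^ 2) ^ 2 := by positivity
  have h6 := mul_le_mul_of_nonneg_left h4 h5
  rw [h3] at h2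
  have h7 : 0 ≤ β.ofLp ⬝ᵥ ((gram X)⁻¹ *ᵥ β.ofLp) := by
    rw [← h3]; simp only [dotProduct]; exact Finset.sum_nonneg fun i _ => mul_self_nonneg _
  rw [← ENNReal.ofReal_add (by positivity)
    (mul_nonneg (by positivity) (frobSq_nonneg _))]
  refine ENNReal.ofReal_le_ofReal (h2.trans ?_)
  unfold frobSq at h6 ⊢
  linarith

end FixedDesign

/-! ### The upper bound for the risk -/

section Upper

variable {n p : ℕ}

theorem measurable_designMatrix_apply (i : Fin n) (j : Fin p) :
    Measurable fun X : Design n p => designMatrix X i j :=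
  (continuous_designMatrix.matrix_elem i j).measurable

theorem measurable_ols_apply (j : Fin p) : Measurable fun d : Data n p => ols d j := by
  simp only [ols, Matrix.mulVec, dotProduct, Matrix.transpose_apply]
  refine Finset.measurable_sum _ fun k _ =>
    ((measurable_gram_inv_apply j k).comp measurable_snd).mul (Finset.measurable_sum _ fun i _ =>
      ((measurable_designMatrix_apply i k).comp measurable_snd).mul
        ((measurable_pi_apply i).comp measurable_fst))

theorem measurable_biasCorrected : Measurable (biasCorrected (n := n) (p := p)) := by
  unfold biasCorrected sigmaSqHat
  refine (Finset.measurable_sum _ fun j _ => (measurable_ols_apply j).pow_const 2).sub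
    (Measurable.mul ?_ ?_)
  · simp only [Matrix.trace, Matrix.diag]
    exact Finset.measurable_sum _ fun j _ => (measurable_gram_inv_apply j j).comp measurable_snd
  · refine (Finset.measurable_sum _ fun i _ => Measurable.pow_const ?_ 2).div_const _
    refine ((measurable_pi_apply i).comp measurable_fst).sub ?_
    simp only [Matrix.mulVec, dotProduct]
    exact Finset.measurable_sum _ fun k _ =>
      ((measurable_designMatrix_apply i k).comp measurable_snd).mul (measurable_ols_apply k)

theorem measurable_model (β : EuclideanSpace ℝ (Fin p)) :
    Measurable fun q : Design n p × (Fin n → ℝ) =>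
      ((designMatrix q.1 *ᵥ (fun j => β j) + q.2, q.1) : Data n p) := by
  refine Measurable.prodMk (measurable_pi_iff.2 fun i => ?_) measurable_fst
  simp only [Pi.add_apply, Matrix.mulVec, dotProduct]
  exact (Finset.measurable_sum _ fun k _ =>
    ((measurable_designMatrix_apply i k).comp measurable_fst).mul_const _).add
      ((measurable_pi_apply i).comp measurable_snd)

theorem risk_eq (S : Matrix (Fin p) (Fin p) ℝ) (σ : ℝ) {T : Data n p → ℝ} (hT : Measurable T)
    (β : EuclideanSpace ℝ (Fin p)) :
    risk S σ T β = ∫⁻ X, ∫⁻ g, ENNReal.ofReal ((T (designMatrix X *ᵥ β.ofLp + σ • g, X)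
      - ‖β‖ ^ 2) ^ 2) ∂(stdPi (Fin n)) ∂(designLaw n S) := by
  have h1 : Measurable fun d : Data n p => ENNReal.ofReal ((T d - ‖β‖ ^ 2) ^ 2) :=
    ((hT.sub_const _).pow_const 2).ennreal_ofReal
  have h2 : Measurable fun g : Fin n → ℝ => σ • g := measurable_id.const_smul σ
  have h3 := h1.comp (measurable_model β)
  have : IsProbabilityMeasure (errorLaw n σ) := by unfold errorLaw; infer_instance
  rw [risk, dataLaw, lintegral_map h1 (measurable_model β)]
  refine (lintegral_prod _ h3.aemeasurable).trans (lintegral_congr fun X => ?_)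
  rw [errorLaw_eq_map]
  exact lintegral_map (h3.comp measurable_prodMk_left) h2

/-- Conditions on the design, applies the fixed-design bound on the almost sure event of
invertibility, and then integrates the two inverse moments over the whole space rather than over K.
-/
theorem risk_biasCorrected_le (h : p + 3 < n) {S : Matrix (Fin p) (Fin p) ℝ} (hS : S.PosDef)
    (σ : ℝ) (β : EuclideanSpace ℝ (Fin p)) :
    risk S σ (biasCorrected (n := n)) β
      ≤ ENNReal.ofReal (8 * σ ^ 2 * (specNorm S⁻¹ * ‖β‖ ^ 2 / ((n : ℝ) - p - 1))
        + 8 * σ ^ 4 * (1 + p / ((n : ℝ) - p)) * (specNorm S⁻¹ ^ 2 * invSqBound n p)) := by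
  have h' : (p : ℝ) + 3 < n := by exact_mod_cast h
  have hL : 0 ≤ specNorm S⁻¹ := norm_nonneg _
  have hb : 0 ≤ invSqBound n p := by
    have : 0 < (n : ℝ) - p - 3 := by linarith
    unfold invSqBound; positivity
  have h0 : 0 < (n : ℝ) - p := by linarith
  have h1 : 0 < (n : ℝ) - p - 1 := by linarith
  have hc1 : 0 ≤ 8 * σ ^ 2 := by positivity
  have hc2 : 0 ≤ 8 * σ ^ 4 * (1 + p / ((n : ℝ) - p)) := by positivity
  have hm : Measurable fun X : Design n p =>
      ENNReal.ofReal (8 * σ ^ 2 * (β.ofLp ⬝ᵥ ((gram X)⁻¹ *ᵥ β.ofLp))) := by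
    refine (Measurable.const_mul ?_ _).ennreal_ofReal
    simp only [dotProduct, Matrix.mulVec]
    exact Finset.measurable_sum _ fun i _ => measurable_const.mul (Finset.measurable_sum _
      fun j _ => (measurable_gram_inv_apply i j).mul_const _)
  rw [risk_eq S σ measurable_biasCorrected β]
  calc _ ≤ ∫⁻ X, (ENNReal.ofReal (8 * σ ^ 2 * (β.ofLp ⬝ᵥ ((gram X)⁻¹ *ᵥ β.ofLp)))
        + ENNReal.ofReal (8 * σ ^ 4 * (1 + p / ((n : ℝ) - p)) * frobSq (gram X)⁻¹))
          ∂(designLaw n S) := by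
        refine lintegral_mono_ae ?_
        filter_upwards [ae_isUnit_gram_designLaw h hS] with X hX
        exact lintegral_biasCorrected_le (by omega) hX β σ
    _ = ENNReal.ofReal (8 * σ ^ 2) * ∫⁻ X, ENNReal.ofReal (β.ofLp ⬝ᵥ ((gram X)⁻¹ *ᵥ β.ofLp))
          ∂(designLaw n S) + ENNReal.ofReal (8 * σ ^ 4 * (1 + p / ((n : ℝ) - p)))
          * ∫⁻ X, ENNReal.ofReal (frobSq (gram X)⁻¹) ∂(designLaw n S) := by
        rw [lintegral_add_left hm, ← lintegral_const_mul' _ _ ENNReal.ofReal_ne_top,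
          ← lintegral_const_mul' _ _ ENNReal.ofReal_ne_top]
        simp only [ENNReal.ofReal_mul hc1, ENNReal.ofReal_mul hc2]
    _ ≤ _ := by
        rw [ENNReal.ofReal_add (by positivity) (by positivity), ENNReal.ofReal_mul hc1,
          ENNReal.ofReal_mul hc2]
        gcongr
        · exact lintegral_quadForm_gram_inv_le h hS β
        · exact lintegral_frobSq_gram_inv_le h hS

/-- The rate of estimation. -/
noncomputable def rate (n : ℕ) {p : ℕ} (σ : ℝ) (β₀ : EuclideanSpace ℝ (Fin p)) : ℝ :=
  σ ^ 2 * ‖β₀‖ ^ 2 / n + σ ^ 4 * p / (n : ℝ) ^ 2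

theorem invSqBound_le {κ : ℝ} (hκ : 0 < κ) (hn : 0 < n)
    (hκn : κ * n ≤ (n : ℝ) - p - 3) : invSqBound n p ≤ (1 / κ ^ 2 + 1 / κ ^ 3) * (p / (n : ℝ) ^ 2) := by
  have hn' : (0 : ℝ) < n := by exact_mod_cast hn
  have hm : 0 < κ * n := by positivity
  have hpn : (p : ℝ) ≤ n := by linarith
  have h1 : invSqBound n p ≤ (p / (κ * n) + p ^ 2 / (κ * n) ^ 2) / (κ * n) := by
    unfold invSqBound; gcongr
  have h2 : (p : ℝ) ^ 2 / (κ * n) ^ 2 ≤ p * n / (κ * n) ^ 2 := by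
    rw [pow_two]; gcongr
  calc invSqBound n p ≤ (p / (κ * n) + p * n / (κ * n) ^ 2) / (κ * n) := h1.trans (by gcongr)
    _ = _ := by field_simp

theorem supRisk_biasCorrected_le {S : Matrix (Fin p) (Fin p) ℝ} (hS : S.PosDef) {L : ℝ}
    (hL : specNorm S⁻¹ ≤ L) {κ : ℝ} (hκ : 0 < κ) (hn : 0 < n)
    (hκn : κ * n ≤ (n : ℝ) - p - 3) (σ C c : ℝ) (β₀ : EuclideanSpace ℝ (Fin p)) :
    supRisk S σ (paramClass n C c σ β₀) (biasCorrected (n := n))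
      ≤ ENNReal.ofReal ((16 * c ^ 2 * L / κ + 8 * (1 + 1 / κ) * L ^ 2 * (1 / κ ^ 2 + 1 / κ ^ 3))
        * rate n σ β₀) := by
  have hn' : (0 : ℝ) < n := by exact_mod_cast hn
  have hm : 0 < κ * n := by positivity
  have hpn : (p : ℝ) ≤ n := by linarith
  have hL0 : 0 ≤ specNorm S⁻¹ := norm_nonneg _
  have hL0' : 0 ≤ L := hL0.trans hL
  have h : p + 3 < n := by
    have : (p : ℝ) + 3 < n := by linarith
    exact_mod_cast this
  unfold supRisk
  refine iSup₂_le fun β hβ => ?_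
  refine (risk_biasCorrected_le h hS σ β).trans (ENNReal.ofReal_le_ofReal ?_)
  -- Squaring the radius of the class by (x + y)² ≤ 2x² + 2y². Multiplied by σ²/n, the bracket is
  -- exactly the rate.
  have hβ2 : ‖β‖ ^ 2 ≤ 2 * c ^ 2 * (‖β₀‖ ^ 2 + σ ^ 2 * p / n) := by
    have h1 := pow_le_pow_left₀ (norm_nonneg β) hβ.2 2
    refine h1.trans ?_
    have e : (σ * √(p : ℝ) / √(n : ℝ)) ^ 2 = σ ^ 2 * p / n := by
      rw [div_pow, mul_pow, Real.sq_sqrt (Nat.cast_nonneg _), Real.sq_sqrt (Nat.cast_nonneg _)]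
    rw [mul_pow, ← e]
    nlinarith [sq_nonneg (c * (‖β₀‖ - σ * √(p : ℝ) / √(n : ℝ)))]
  have hA : 8 * σ ^ 2 * (specNorm S⁻¹ * ‖β‖ ^ 2 / ((n : ℝ) - p - 1))
      ≤ 8 * σ ^ 2 * (L * (2 * c ^ 2 * (‖β₀‖ ^ 2 + σ ^ 2 * p / n)) / (κ * n)) := by
    gcongr
    linarith
  have hB : 8 * σ ^ 4 * (1 + p / ((n : ℝ) - p)) * (specNorm S⁻¹ ^ 2 * invSqBound n p)
      ≤ 8 * σ ^ 4 * (1 + 1 / κ) * (L ^ 2 * ((1 / κ ^ 2 + 1 / κ ^ 3) * (p / (n : ℝ) ^ 2))) := by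
    have h1 := invSqBound_le hκ hn hκn
    have h2 : (p : ℝ) / ((n : ℝ) - p) ≤ 1 / κ := by
      rw [div_le_div_iff₀ (by linarith) hκ]
      nlinarith
    have h3 : 0 ≤ invSqBound n p := by
      have : 0 < (n : ℝ) - p - 3 := by linarith
      unfold invSqBound; positivity
    gcongr
  refine (add_le_add hA hB).trans ?_
  have e1 : 8 * σ ^ 2 * (L * (2 * c ^ 2 * (‖β₀‖ ^ 2 + σ ^ 2 * p / n)) / (κ * n))
      = 16 * c ^ 2 * L / κ * rate n σ β₀ := by
    unfold rate; field_simp; ring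
  rw [e1, add_mul (16 * c ^ 2 * L / κ)]
  refine add_le_add le_rfl ?_
  have h4 : σ ^ 4 * (p / (n : ℝ) ^ 2) ≤ rate n σ β₀ := by
    unfold rate
    have : 0 ≤ σ ^ 2 * ‖β₀‖ ^ 2 / n := by positivity
    rw [← mul_div_assoc]; linarith
  calc _ = 8 * (1 + 1 / κ) * L ^ 2 * (1 / κ ^ 2 + 1 / κ ^ 3) * (σ ^ 4 * (p / (n : ℝ) ^ 2)) := by ring
    _ ≤ _ := by gcongr

/-- Since τ < 1, the degrees of freedom stay proportional to n even after subtracting the 3 required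
by the second inverse moment. -/
theorem eventually_mul_le_sub {τ : ℝ} (hτ : τ < 1) {p : ℕ → ℕ}
    (hpn : Tendsto (fun n => (p n : ℝ) / (n : ℝ)) atTop (𝓝 τ)) :
    ∀ᶠ n : ℕ in atTop, (1 - τ) / 2 * n ≤ (n : ℝ) - p n - 3 := by
  have h1 : Tendsto (fun n : ℕ => (p n : ℝ) / n + 3 * ((n : ℝ))⁻¹) atTop (𝓝 τ) := by
    simpa using hpn.add ((tendsto_inv_atTop_nhds_zero_nat (𝕜 := ℝ)).const_mul 3)
  filter_upwards [h1.eventually_le_const (show τ < (1 + τ) / 2 by linarith), eventually_gt_atTop 0]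
    with n hn hn0
  have hn' : (0 : ℝ) < n := by exact_mod_cast hn0
  have e : (p n : ℝ) / n + 3 * ((n : ℝ))⁻¹ = (p n + 3) / n := by field_simp
  rw [e, div_le_iff₀ hn'] at hn
  linarith

end Upper

/-! ### Testing a point against a mixture of Gaussian shifts -/

section Mixture

variable {I ι : Type*} [Fintype I] [Fintype ι]

/-- The density of the shifted standard Gaussian law. -/
noncomputable def shiftDensity (m x : I → ℝ) : ℝ := Real.exp (m ⬝ᵥ x - m ⬝ᵥ m / 2)

theorem shiftDensity_nonneg (m x : I → ℝ) : 0 ≤ shiftDensity m x := (Real.exp_pos _).le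

theorem continuous_shiftDensity (m : I → ℝ) : Continuous (shiftDensity m) := by
  unfold shiftDensity dotProduct; fun_prop

theorem stdPi_shift (m : I → ℝ) : (stdPi I).map (fun x => x + m)
    = (stdPi I).withDensity fun x => ENNReal.ofReal (shiftDensity m x) := by
  rw [stdPi_shift_eq_withDensity]
  congr 1
  ext x
  rw [← ENNReal.ofReal_prod_of_nonneg fun _ _ => (Real.exp_pos _).le, ← Real.exp_sum,
    shiftDensity]
  congr 2
  rw [Finset.sum_sub_distrib, dotProduct, dotProduct, Finset.sum_div]
  simp only [pow_two]

theorem lintegral_shift (m : I → ℝ) {f : (I → ℝ) → ℝ≥0∞} (hf : Measurable f) :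
    ∫⁻ x, f (x + m) ∂(stdPi I)
      = ∫⁻ x, ENNReal.ofReal (shiftDensity m x) * f x ∂(stdPi I) := by
  rw [← lintegral_map hf (measurable_add_const m), stdPi_shift,
    lintegral_withDensity_eq_lintegral_mul _
      (continuous_shiftDensity m).measurable.ennreal_ofReal hf]
  rfl

theorem lintegral_shiftDensity (m : I → ℝ) :
    ∫⁻ x, ENNReal.ofReal (shiftDensity m x) ∂(stdPi I) = 1 := by
  have := lintegral_shift m (f := fun _ => 1) measurable_const
  simpa using this.symm

theorem shiftDensity_mul (m m' x : I → ℝ) :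
    shiftDensity m x * shiftDensity m' x = Real.exp (m ⬝ᵥ m') * shiftDensity (m + m') x := by
  unfold shiftDensity
  rw [← Real.exp_add, ← Real.exp_add]
  congr 1
  simp only [add_dotProduct, dotProduct_add]
  rw [dotProduct_comm m' m]
  ring

/-- A lower bound for testing a point against a finite mixture of shifts. -/
theorem ofReal_le_lintegral_add_mixture [Nonempty ι] (d : ι → I → ℝ) {M : ℝ}
    (hM : ∑ i, ∑ j, Real.exp (d i ⬝ᵥ d j) ≤ M * (Fintype.card ι : ℝ) ^ 2) {t : (I → ℝ) → ℝ}
    (ht : Measurable t) (θ₀ θ₁ : ℝ) :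
    ENNReal.ofReal ((θ₀ - θ₁) ^ 2 / (1 + M)) ≤
      ∫⁻ x, ENNReal.ofReal ((t x - θ₀) ^ 2) ∂(stdPi I)
        + ENNReal.ofReal ((Fintype.card ι : ℝ)⁻¹)
          * ∑ i, ∫⁻ x, ENNReal.ofReal ((t (x + d i) - θ₁) ^ 2) ∂(stdPi I) := by
  set N : ℝ := ((Fintype.card ι : ℕ) : ℝ) with hN
  have hN0 : 0 < N := by rw [hN]; exact_mod_cast Fintype.card_pos
  -- The likelihood ratio of the mixture against the centre. It has mean one, and its second moment
  -- is the average of exp(d_i · d_j), hence at most M.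
  set L : (I → ℝ) → ℝ := fun x => N⁻¹ * ∑ i, shiftDensity (d i) x with hL
  have hL0 : ∀ x, 0 ≤ L x := fun x =>
    mul_nonneg (inv_nonneg.2 hN0.le) (Finset.sum_nonneg fun i _ => shiftDensity_nonneg _ _)
  have hLm : Measurable L := measurable_const.mul
    (Finset.measurable_sum _ fun i _ => (continuous_shiftDensity (d i)).measurable)
  have hM0 : 0 < M := by
    have h1 : 0 < ∑ i, ∑ j, Real.exp (d i ⬝ᵥ d j) :=
      Finset.sum_pos (fun i _ => Finset.sum_pos (fun j _ => Real.exp_pos _) Finset.univ_nonempty)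
        Finset.univ_nonempty
    have h2 := h1.trans_le hM
    exact pos_of_mul_pos_left h2 (sq_nonneg N)
  have hint : ∫⁻ x, ENNReal.ofReal (L x) ∂(stdPi I) = 1 := by
    simp only [hL]
    have : ∀ x, ENNReal.ofReal (N⁻¹ * ∑ i, shiftDensity (d i) x)
        = ENNReal.ofReal N⁻¹ * ∑ i, ENNReal.ofReal (shiftDensity (d i) x) := fun x => by
      rw [ENNReal.ofReal_mul (inv_nonneg.2 hN0.le),
        ENNReal.ofReal_sum_of_nonneg fun i _ => shiftDensity_nonneg _ _]
    simp only [this]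
    rw [lintegral_const_mul' _ _ ENNReal.ofReal_ne_top, lintegral_finsetSum _ fun i _ =>
      (continuous_shiftDensity (d i)).measurable.ennreal_ofReal]
    simp only [lintegral_shiftDensity]
    rw [Finset.sum_const, Finset.card_univ, nsmul_eq_mul, mul_one,
      ← ENNReal.ofReal_natCast, ← hN, ← ENNReal.ofReal_mul (inv_nonneg.2 hN0.le),
      inv_mul_cancel₀ hN0.ne', ENNReal.ofReal_one]
  have hsq : ∫⁻ x, ENNReal.ofReal (L x ^ 2) ∂(stdPi I) ≤ ENNReal.ofReal M := by
    have hc : (0 : ℝ) ≤ (N ^ 2)⁻¹ := by positivity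
    have : ∀ x, ENNReal.ofReal (L x ^ 2) = ENNReal.ofReal (N ^ 2)⁻¹ * ∑ i, ∑ j,
        ENNReal.ofReal (Real.exp (d i ⬝ᵥ d j)) * ENNReal.ofReal (shiftDensity (d i + d j) x) := by
      intro x
      have e : L x ^ 2 = (N ^ 2)⁻¹ * ∑ i, ∑ j,
          Real.exp (d i ⬝ᵥ d j) * shiftDensity (d i + d j) x := by
        simp only [hL, mul_pow, inv_pow, ← shiftDensity_mul]
        rw [pow_two (∑ i, _), Finset.sum_mul_sum]
      rw [e, ENNReal.ofReal_mul hc, ENNReal.ofReal_sum_of_nonneg fun i _ =>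
        Finset.sum_nonneg fun j _ => mul_nonneg (Real.exp_pos _).le (shiftDensity_nonneg _ _)]
      congr 1
      refine Finset.sum_congr rfl fun i _ => ?_
      rw [ENNReal.ofReal_sum_of_nonneg fun j _ =>
        mul_nonneg (Real.exp_pos _).le (shiftDensity_nonneg _ _)]
      exact Finset.sum_congr rfl fun j _ => ENNReal.ofReal_mul (Real.exp_pos _).le
    have hm : ∀ m : I → ℝ, Measurable fun x => ENNReal.ofReal (shiftDensity m x) := fun m =>
      (continuous_shiftDensity m).measurable.ennreal_ofReal
    simp only [this]
    rw [lintegral_const_mul' _ _ ENNReal.ofReal_ne_top, lintegral_finsetSum _ fun i _ =>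
      Finset.measurable_sum _ fun j _ => (hm _).const_mul _]
    have e2 : ∀ i, ∫⁻ x, ∑ j, ENNReal.ofReal (Real.exp (d i ⬝ᵥ d j))
        * ENNReal.ofReal (shiftDensity (d i + d j) x) ∂(stdPi I)
        = ENNReal.ofReal (∑ j, Real.exp (d i ⬝ᵥ d j)) := fun i => by
      rw [lintegral_finsetSum _ fun j _ => (hm _).const_mul _,
        ENNReal.ofReal_sum_of_nonneg fun j _ => (Real.exp_pos _).le]
      refine Finset.sum_congr rfl fun j _ => ?_
      rw [lintegral_const_mul' _ _ ENNReal.ofReal_ne_top, lintegral_shiftDensity, mul_one]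
    simp only [e2]
    rw [← ENNReal.ofReal_sum_of_nonneg fun i _ => Finset.sum_nonneg fun j _ => (Real.exp_pos _).le,
      ← ENNReal.ofReal_mul hc]
    refine ENNReal.ofReal_le_ofReal ?_
    rw [inv_mul_le_iff₀ (by positivity), mul_comm]
    exact hM
  have hmix : ENNReal.ofReal N⁻¹ * ∑ i, ∫⁻ x, ENNReal.ofReal ((t (x + d i) - θ₁) ^ 2) ∂(stdPi I)
      = ∫⁻ x, ENNReal.ofReal (L x * (t x - θ₁) ^ 2) ∂(stdPi I) := by
    have hf : Measurable fun x => ENNReal.ofReal ((t x - θ₁) ^ 2) :=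
      ((ht.sub_const _).pow_const 2).ennreal_ofReal
    have e : ∀ x, ENNReal.ofReal (L x * (t x - θ₁) ^ 2) = ENNReal.ofReal N⁻¹ *
        ∑ i, ENNReal.ofReal (shiftDensity (d i) x) * ENNReal.ofReal ((t x - θ₁) ^ 2) := fun x => by
      rw [ENNReal.ofReal_mul (hL0 x), ENNReal.ofReal_mul (inv_nonneg.2 hN0.le),
        ENNReal.ofReal_sum_of_nonneg fun i _ => shiftDensity_nonneg _ _, mul_assoc, Finset.sum_mul]
    simp only [e]
    have hg : ∀ i, Measurable fun x =>
        ENNReal.ofReal (shiftDensity (d i) x) * ENNReal.ofReal ((t x - θ₁) ^ 2) := fun i =>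
      (continuous_shiftDensity (d i)).measurable.ennreal_ofReal.mul hf
    rw [lintegral_const_mul' _ _ ENNReal.ofReal_ne_top, lintegral_finsetSum _ fun i _ => hg i]
    congr 1
    exact Finset.sum_congr rfl fun i _ => lintegral_shift (d i) hf
  rw [hmix]
  -- For any value t, (t - θ₀)² + L(t - θ₁)² ≥ D · L/(1 + L), and 1/(1 + L) ≥ 2s - s²(1 + L) because
  -- (1 - s(1 + L))² ≥ 0. Integrating gives at least (2s - s²(1 + M)) D, and this choice of s makes
  -- it D/(1 + M). The L² term is kept on the right so that all integrals are of nonnegative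
  -- functions.
  set s := (1 + M)⁻¹ with hs
  have hs0 : 0 < s := by positivity
  have hs1 : s ≤ 1 := inv_le_one_of_one_le₀ (by linarith)
  have hsM : s * (1 + M) = 1 := inv_mul_cancel₀ (by positivity)
  set D := (θ₀ - θ₁) ^ 2 with hD
  have hD0 : 0 ≤ D := sq_nonneg _
  have hA0 : 0 ≤ (2 * s - s ^ 2) * D := mul_nonneg (by nlinarith) hD0
  have hB0 : 0 ≤ s ^ 2 * D := by positivity
  have hpt : ∀ x, (2 * s - s ^ 2) * D * L x
      ≤ (t x - θ₀) ^ 2 + L x * (t x - θ₁) ^ 2 + s ^ 2 * D * L x ^ 2 := by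
    intro x
    have h0 := hL0 x
    have h1 : (2 * s * L x - s ^ 2 * L x * (1 + L x)) * D ≤ L x / (1 + L x) * D := by
      refine mul_le_mul_of_nonneg_right ?_ hD0
      rw [le_div_iff₀ (by positivity)]
      nlinarith [mul_nonneg h0 (sq_nonneg (1 - s * (1 + L x)))]
    have h2 : L x / (1 + L x) * D ≤ (t x - θ₀) ^ 2 + L x * (t x - θ₁) ^ 2 := by
      rw [div_mul_eq_mul_div, div_le_iff₀ (by positivity), hD]
      nlinarith [sq_nonneg ((t x - θ₀) + L x * (t x - θ₁))]
    linarith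
  have key : ENNReal.ofReal ((2 * s - s ^ 2) * D) ≤
      (∫⁻ x, ENNReal.ofReal ((t x - θ₀) ^ 2) ∂(stdPi I)
        + ∫⁻ x, ENNReal.ofReal (L x * (t x - θ₁) ^ 2) ∂(stdPi I))
        + ENNReal.ofReal (s ^ 2 * D * M) := by
    calc ENNReal.ofReal ((2 * s - s ^ 2) * D)
        = ∫⁻ x, ENNReal.ofReal ((2 * s - s ^ 2) * D * L x) ∂(stdPi I) := by
          simp only [ENNReal.ofReal_mul hA0]
          rw [lintegral_const_mul' _ _ ENNReal.ofReal_ne_top, hint, mul_one]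
      _ ≤ ∫⁻ x, (ENNReal.ofReal ((t x - θ₀) ^ 2) + ENNReal.ofReal (L x * (t x - θ₁) ^ 2)
            + ENNReal.ofReal (s ^ 2 * D) * ENNReal.ofReal (L x ^ 2)) ∂(stdPi I) := by
          refine lintegral_mono fun x => ?_
          rw [← ENNReal.ofReal_mul hB0, ← ENNReal.ofReal_add (sq_nonneg _)
            (mul_nonneg (hL0 x) (sq_nonneg _)), ← ENNReal.ofReal_add
            (add_nonneg (sq_nonneg _) (mul_nonneg (hL0 x) (sq_nonneg _)))
            (mul_nonneg hB0 (sq_nonneg _))]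
          exact ENNReal.ofReal_le_ofReal (hpt x)
      _ = (∫⁻ x, ENNReal.ofReal ((t x - θ₀) ^ 2) ∂(stdPi I)
            + ∫⁻ x, ENNReal.ofReal (L x * (t x - θ₁) ^ 2) ∂(stdPi I))
            + ENNReal.ofReal (s ^ 2 * D) * ∫⁻ x, ENNReal.ofReal (L x ^ 2) ∂(stdPi I) := by
          rw [lintegral_add_right _ ((hLm.pow_const 2).ennreal_ofReal.const_mul _),
            lintegral_add_left ((ht.sub_const _).pow_const 2).ennreal_ofReal,
            lintegral_const_mul' _ _ ENNReal.ofReal_ne_top]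
      _ ≤ _ := by
          rw [ENNReal.ofReal_mul hB0]
          gcongr
  have e3 : D / (1 + M) = (2 * s - s ^ 2) * D - s ^ 2 * D * M := by
    rw [div_eq_mul_inv, ← hs]
    linear_combination (D * s) * hsM
  rw [e3, ENNReal.ofReal_sub _ (by positivity)]
  exact tsub_le_iff_right.2 key

end Mixture

/-! ### From mixtures to the supremum of the risk -/

section Lower

variable {n p : ℕ} {ι : Type*} [Fintype ι]

theorem measurable_risk_fixed {T : Data n p → ℝ} (hT : Measurable T) (σ θ : ℝ)
    (β : EuclideanSpace ℝ (Fin p)) :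
    Measurable fun X : Design n p => ∫⁻ g, ENNReal.ofReal ((T (designMatrix X *ᵥ β.ofLp + σ • g, X)
      - θ) ^ 2) ∂(stdPi (Fin n)) := by
  have h1 : Measurable fun q : Design n p × (Fin n → ℝ) => (q.1, σ • q.2) :=
    measurable_fst.prodMk (measurable_snd.const_smul σ)
  have h2 := (((hT.comp (measurable_model β)).comp h1).sub_const θ).pow_const 2
  exact h2.ennreal_ofReal.lintegral_prod_right'

/-- The shift of the standardized errors which corresponds to replacing `β` by `β'`. -/
noncomputable def noiseShift (σ : ℝ) (X : Design n p) (δ : EuclideanSpace ℝ (Fin p)) : Fin n → ℝ :=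
  σ⁻¹ • (designMatrix X *ᵥ δ.ofLp)

/-- Expresses the overlaps in the chi-square moment through XᵀX, whose norm is controlled on K. -/
theorem noiseShift_dotProduct (σ : ℝ) (X : Design n p) (δ δ' : EuclideanSpace ℝ (Fin p)) :
    noiseShift σ X δ ⬝ᵥ noiseShift σ X δ' = (σ ^ 2)⁻¹ * inner ℝ δ (mulE (gram X) δ') := by
  unfold noiseShift
  rw [smul_dotProduct, dotProduct_smul, inner_eq_dotProduct]
  have : (mulE (gram X) δ').ofLp = (designMatrix X)ᵀ *ᵥ (designMatrix X *ᵥ δ'.ofLp) := by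
    rw [Matrix.mulVec_mulVec]; rfl
  rw [this, Matrix.dotProduct_mulVec δ.ofLp (designMatrix X)ᵀ, Matrix.vecMul_transpose]
  simp only [smul_eq_mul, pow_two, mul_inv]
  ring

/-- The supremum of the risk over a set is at least what testing a point against a mixture gives. -/
theorem ofReal_le_supRisk [Nonempty ι] {S : Matrix (Fin p) (Fin p) ℝ} {σ : ℝ} (hσ : 0 < σ)
    {G : Set (EuclideanSpace ℝ (Fin p))} {β' : EuclideanSpace ℝ (Fin p)} (hβ' : β' ∈ G)
    {β : ι → EuclideanSpace ℝ (Fin p)} (hβ : ∀ i, β i ∈ G) {θ : ℝ} (hθ : ∀ i, ‖β i‖ ^ 2 = θ)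
    {K : Set (Design n p)} (hK : 1 / 2 ≤ (designLaw n S).real K) {M : ℝ} (hM0 : 0 ≤ M)
    (hM : ∀ X ∈ K, ∑ i, ∑ j, Real.exp (noiseShift σ X (β i - β') ⬝ᵥ noiseShift σ X (β j - β'))
      ≤ M * (Fintype.card ι : ℝ) ^ 2) {T : Data n p → ℝ} (hT : Measurable T) :
    ENNReal.ofReal ((‖β'‖ ^ 2 - θ) ^ 2 / (4 * (1 + M))) ≤ supRisk S σ G T := by
  set N : ℝ := ((Fintype.card ι : ℕ) : ℝ) with hN
  have hN0 : 0 < N := by rw [hN]; exact_mod_cast Fintype.card_pos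
  set R := supRisk S σ G T with hR
  have hle : ∀ b ∈ G, risk S σ T b ≤ R := fun b hb => le_iSup₂ (f := fun b _ => risk S σ T b) b hb
  set F : Design n p → EuclideanSpace ℝ (Fin p) → ℝ≥0∞ := fun X b =>
    ∫⁻ g, ENNReal.ofReal ((T (designMatrix X *ᵥ b.ofLp + σ • g, X) - ‖b‖ ^ 2) ^ 2)
      ∂(stdPi (Fin n)) with hF
  have hFm : ∀ b, Measurable fun X => F X b := fun b => measurable_risk_fixed hT σ _ b
  have hsum : ∫⁻ X, (F X β' + ENNReal.ofReal N⁻¹ * ∑ i, F X (β i)) ∂(designLaw n S)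
      = risk S σ T β' + ENNReal.ofReal N⁻¹ * ∑ i, risk S σ T (β i) := by
    rw [lintegral_add_left (hFm β'), lintegral_const_mul' _ _ ENNReal.ofReal_ne_top,
      lintegral_finsetSum _ fun i _ => hFm (β i), risk_eq S σ hT β']
    congr 2
    exact Finset.sum_congr rfl fun i _ => (risk_eq S σ hT (β i)).symm
  have hupper : risk S σ T β' + ENNReal.ofReal N⁻¹ * ∑ i, risk S σ T (β i) ≤ R + R := by
    refine add_le_add (hle _ hβ') ?_
    calc _ ≤ ENNReal.ofReal N⁻¹ * ∑ _i : ι, R := by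
          gcongr with i
          exact hle _ (hβ i)
      _ = R := by
          rw [Finset.sum_const, Finset.card_univ, nsmul_eq_mul, ← mul_assoc,
            ← ENNReal.ofReal_natCast, ← hN, ← ENNReal.ofReal_mul (inv_nonneg.2 hN0.le),
            inv_mul_cancel₀ hN0.ne', ENNReal.ofReal_one, one_mul]
  have hlow : ∀ X ∈ K, ENNReal.ofReal ((‖β'‖ ^ 2 - θ) ^ 2 / (1 + M))
      ≤ F X β' + ENNReal.ofReal N⁻¹ * ∑ i, F X (β i) := by
    intro X hX
    have ht : Measurable fun g : Fin n → ℝ => T (designMatrix X *ᵥ β'.ofLp + σ • g, X) :=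
      hT.comp (((measurable_id.const_smul σ).const_add _).prodMk measurable_const)
    refine (ofReal_le_lintegral_add_mixture (fun i => noiseShift σ X (β i - β')) (hM X hX) ht
      (‖β'‖ ^ 2) θ).trans (le_of_eq ?_)
    simp only [hF]
    congr 2
    refine Finset.sum_congr rfl fun i _ => ?_
    rw [hθ i]
    refine lintegral_congr fun g => ?_
    congr 5
    -- Translating the standardized errors by X(β_i - β')/σ turns the observation under β' into the
    -- observation under β_i.
    rw [noiseShift, smul_add, smul_smul, mul_inv_cancel₀ hσ.ne', one_smul, WithLp.ofLp_sub,
      Matrix.mulVec_sub]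
    abel
  -- The bound holds only for designs in K, of probability at least one half, and it bounds the sum
  -- of two mean risks; these two factors of 2 make the 4 in the conclusion.
  have hmarkov : ENNReal.ofReal ((‖β'‖ ^ 2 - θ) ^ 2 / (1 + M)) * (designLaw n S) K ≤ R + R := by
    refine le_trans ?_ (hsum.le.trans hupper)
    refine le_trans ?_ (mul_meas_ge_le_lintegral₀ ((hFm β').add ((Finset.measurable_sum _ fun i _ =>
      hFm (β i)).const_mul _)).aemeasurable (ENNReal.ofReal ((‖β'‖ ^ 2 - θ) ^ 2 / (1 + M))))
    gcongr
    exact fun X hX => hlow X hX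
  have hK' : ENNReal.ofReal (1 / 2) ≤ (designLaw n S) K := by
    rw [ENNReal.ofReal_le_iff_le_toReal (measure_ne_top _ _)]
    exact hK
  have h2 : ENNReal.ofReal ((‖β'‖ ^ 2 - θ) ^ 2 / (1 + M) * (1 / 2)) ≤ 2 * R := by
    rw [ENNReal.ofReal_mul (by positivity), two_mul]
    exact (mul_le_mul_right hK' _).trans hmarkov
  have e : (‖β'‖ ^ 2 - θ) ^ 2 / (1 + M) * (1 / 2)
      = 2 * ((‖β'‖ ^ 2 - θ) ^ 2 / (4 * (1 + M))) := by field_simp; norm_num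
  rw [e, ENNReal.ofReal_mul (by norm_num), ENNReal.ofReal_ofNat] at h2
  exact (ENNReal.mul_le_mul_iff_right (by norm_num) (by norm_num)).1 h2

end Lower

section EventK

open scoped Matrix.Norms.L2Operator

variable {n p : ℕ}

theorem norm_gram_le_of_mem_eventK (hn : 0 < n) {τ : ℝ} {S : Matrix (Fin p) (Fin p) ℝ}
    {X : Design n p} (hX : X ∈ eventK n τ S) {B : ℝ} (hB : upperLevel τ S ≤ B) :
    ‖gram X‖ ≤ n * B := by
  have hn' : (0 : ℝ) < n := by exact_mod_cast hn
  have h := hX.2.2.le.trans hB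
  rw [specNorm_eq_norm, norm_smul, norm_inv, RCLike.norm_natCast, inv_mul_le_iff₀ hn'] at h
  exact h

theorem upperLevel_le {τ : ℝ} (hτ : τ < 1) {S : Matrix (Fin p) (Fin p) ℝ} {b : ℝ}
    (hb : specNorm S ≤ b) : upperLevel τ S ≤ 16 * b := by
  have ht1 : √τ < 1 := by rw [Real.sqrt_lt' one_pos]; simpa using hτ
  have ht0 : 0 ≤ √τ := Real.sqrt_nonneg _
  have h0 : 0 ≤ specNorm S := norm_nonneg _
  unfold upperLevel
  have : (1 + √τ) ^ 2 ≤ 4 := by nlinarith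
  nlinarith [mul_le_mul this hb h0 (by norm_num)]

end EventK

/-! ### Least favourable parameters -/

section Signs

variable {p : ℕ}

/-- The sign vector of `s`. -/
def signVec (s : Fin p → Bool) : Fin p → ℝ := fun j => if s j then 1 else -1

theorem signVec_sq (s : Fin p → Bool) (j : Fin p) : signVec s j ^ 2 = 1 := by
  unfold signVec; split_ifs <;> norm_num

/-- The sum over sign vectors factors over coordinates into 2 cosh u_j, and cosh x ≤ exp(x²/2). -/
theorem sum_exp_signVec_le (u : Fin p → ℝ) :
    ∑ s : Fin p → Bool, Real.exp (signVec s ⬝ᵥ u) ≤ 2 ^ p * Real.exp (u ⬝ᵥ u / 2) := by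
  have h1 : ∀ s : Fin p → Bool, Real.exp (signVec s ⬝ᵥ u)
      = ∏ j, Real.exp ((if s j then 1 else -1) * u j) := fun s => by
    rw [← Real.exp_sum]; rfl
  have h2 : ∑ s : Fin p → Bool, ∏ j, Real.exp ((if s j then 1 else -1) * u j)
      = ∏ j, ∑ b : Bool, Real.exp ((if b then 1 else -1) * u j) := by
    rw [Finset.prod_univ_sum, Fintype.piFinset_univ]
  simp only [h1]
  rw [h2]
  have h3 : ∀ j, ∑ b : Bool, Real.exp ((if b then (1 : ℝ) else -1) * u j) = 2 * Real.cosh (u j) := by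
    intro j
    rw [Fintype.sum_bool, Real.cosh_eq]
    simp only [if_true, Bool.false_eq_true, if_false, one_mul, neg_one_mul]
    ring
  simp only [h3]
  rw [Finset.prod_mul_distrib, Finset.prod_const, Finset.card_univ, Fintype.card_fin]
  refine mul_le_mul_of_nonneg_left ?_ (by positivity)
  calc ∏ j, Real.cosh (u j) ≤ ∏ j, Real.exp (u j ^ 2 / 2) :=
        Finset.prod_le_prod (fun j _ => (Real.cosh_pos _).le)
          fun j _ => Real.cosh_le_exp_half_sq (u j)
    _ = _ := by
        rw [← Real.exp_sum, dotProduct, Finset.sum_div]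
        simp only [pow_two]

end Signs

section LowerBounds

open scoped Matrix.Norms.L2Operator

variable {n p : ℕ}

/-- The lower bound from a pair of proportional coefficient vectors. -/
theorem ofReal_le_supRisk_scaling (hn : 0 < n) {τ : ℝ} {S : Matrix (Fin p) (Fin p) ℝ} {B : ℝ}
    (hB : upperLevel τ S ≤ B) (hK : 1 / 2 ≤ (designLaw n S).real (eventK n τ S)) {σ C c : ℝ}
    (hσ : 0 < σ) (hc : 1 < c) {β₀ : EuclideanSpace ℝ (Fin p)} (hβ₀ : ∀ j, |β₀ j| ≤ C)
    (hle : σ ≤ √(n : ℝ) * ‖β₀‖) {T : Data n p → ℝ} (hT : Measurable T) :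
    ENNReal.ofReal (1 / (4 * (1 + Real.exp B)) * (σ ^ 2 * ‖β₀‖ ^ 2 / n))
      ≤ supRisk S σ (paramClass n C c σ β₀) T := by
  have hn' : (0 : ℝ) < n := by exact_mod_cast hn
  have hsn : 0 < √(n : ℝ) := Real.sqrt_pos.2 hn'
  have hb : 0 < ‖β₀‖ := by
    by_contra h
    have : ‖β₀‖ = 0 := le_antisymm (not_lt.1 h) (norm_nonneg _)
    rw [this, mul_zero] at hle
    linarith
  -- With this η the displacement has squared norm η²‖β₀‖² = σ²/n, so the chi-square exponent is at
  -- most B on K. The squared norms are separated by at least η‖β₀‖² = σ‖β₀‖/√n. The condition η ≤ 1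
  -- makes the alternative a contraction of β₀, hence a member of the class.
  set η := σ / (√(n : ℝ) * ‖β₀‖) with hη
  have hη0 : 0 < η := by positivity
  have hη1 : η ≤ 1 := (div_le_one (by positivity)).2 hle
  have hηsq : η ^ 2 * ‖β₀‖ ^ 2 = σ ^ 2 / n := by
    rw [hη, div_pow, mul_pow, Real.sq_sqrt hn'.le]
    field_simp
  have hgen : ∀ r : ℝ, 0 ≤ r → r ≤ 1 → r • β₀ ∈ paramClass n C c σ β₀ := by
    intro r hr0 hr1
    refine ⟨fun j => ?_, ?_⟩
    · simp only [PiLp.smul_apply, smul_eq_mul, abs_mul, abs_of_nonneg hr0]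
      exact (mul_le_of_le_one_left (abs_nonneg _) hr1).trans (hβ₀ j)
    · rw [norm_smul, Real.norm_eq_abs, abs_of_nonneg hr0]
      have h1 : r * ‖β₀‖ ≤ ‖β₀‖ := mul_le_of_le_one_left hb.le hr1
      have h2 : 0 ≤ σ * √(p : ℝ) / √(n : ℝ) := by positivity
      nlinarith
  have h0 : β₀ ∈ paramClass n C c σ β₀ := by simpa using hgen 1 zero_le_one le_rfl
  have key := ofReal_le_supRisk (ι := Unit) hσ h0 (β := fun _ => (1 - η) • β₀)
    (fun _ => hgen _ (by linarith) (by linarith)) (fun _ => rfl) hK (Real.exp_pos B).le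
    (fun X hX => ?_) hT
  · refine le_trans (ENNReal.ofReal_le_ofReal ?_) key
    rw [norm_smul, mul_pow, Real.norm_eq_abs, sq_abs, one_div_mul_eq_div]
    refine div_le_div_of_nonneg_right ?_ (by positivity)
    have e : σ ^ 2 * ‖β₀‖ ^ 2 / n = (η * ‖β₀‖ ^ 2) ^ 2 := by
      rw [mul_div_right_comm, ← hηsq]; ring
    rw [e]
    refine pow_le_pow_left₀ (by positivity) ?_ 2
    have : ‖β₀‖ ^ 2 - (1 - η) ^ 2 * ‖β₀‖ ^ 2 = η * ‖β₀‖ ^ 2 + η * (1 - η) * ‖β₀‖ ^ 2 := by ring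
    rw [this]
    have : 0 ≤ η * (1 - η) * ‖β₀‖ ^ 2 :=
      mul_nonneg (mul_nonneg hη0.le (by linarith)) (sq_nonneg _)
    linarith
  · simp only [Finset.univ_unique, Finset.sum_singleton, Fintype.card_unit, Nat.cast_one, one_pow,
      mul_one]
    refine Real.exp_le_exp.2 ?_
    rw [noiseShift_dotProduct]
    set δ := (1 - η) • β₀ - β₀ with hδ
    have hδn : ‖δ‖ ^ 2 = σ ^ 2 / n := by
      have : δ = (-η) • β₀ := by rw [hδ, sub_smul, one_smul, neg_smul]; abel
      rw [this, norm_smul, mul_pow, Real.norm_eq_abs, sq_abs, neg_sq, hηsq]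
    have h1 : inner ℝ δ (mulE (gram X) δ) ≤ n * B * ‖δ‖ ^ 2 := by
      refine (real_inner_le_norm _ _).trans ?_
      have h2 : ‖mulE (gram X) δ‖ ≤ n * B * ‖δ‖ := (norm_mulE_le _ _).trans
        (mul_le_mul_of_nonneg_right (norm_gram_le_of_mem_eventK hn hX hB) (norm_nonneg _))
      nlinarith [norm_nonneg δ]
    rw [hδn] at h1
    have e : (n : ℝ) * B * (σ ^ 2 / n) = σ ^ 2 * B := by field_simp
    rw [e] at h1
    rw [inv_mul_le_iff₀ (by positivity)]
    exact h1

/-- The lower bound from the mixture over all sign vectors of a fixed amplitude. -/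
theorem ofReal_le_supRisk_signs (hn : 0 < n) (hp : 1 ≤ p) {τ : ℝ} {S : Matrix (Fin p) (Fin p) ℝ}
    {B : ℝ} (hB : upperLevel τ S ≤ B) (hK : 1 / 2 ≤ (designLaw n S).real (eventK n τ S))
    {σ C c κ : ℝ} (hσ : 0 < σ) (hC : 0 < C) (hc : 1 < c) (hκ : 0 < κ) (hκ1 : κ ≤ 1)
    (hκC : κ * σ ^ 2 ≤ C ^ 2 * n) (β₀ : EuclideanSpace ℝ (Fin p))
    {T : Data n p → ℝ} (hT : Measurable T) :
    ENNReal.ofReal (κ ^ 2 / (4 * (1 + Real.exp (B ^ 2 / 2))) * (σ ^ 4 * p / (n : ℝ) ^ 2))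
      ≤ supRisk S σ (paramClass n C c σ β₀) T := by
  have hn' : (0 : ℝ) < n := by exact_mod_cast hn
  have hp' : (1 : ℝ) ≤ p := by exact_mod_cast hp
  have hp0 : (0 : ℝ) < p := by linarith
  set q := √(p : ℝ) with hq
  have hq1 : 1 ≤ q := by rw [hq]; exact Real.one_le_sqrt.2 hp'
  have hq0 : 0 < q := by linarith
  have hqq : q ^ 2 = p := Real.sq_sqrt hp0.le
  -- Every sign vector then has squared norm a²p = κσ²√p/n, whose square is κ²σ⁴p/n². The bound a² ≤
  -- κσ²/n ≤ C² keeps the entries admissible, and κ ≤ 1 keeps the norm below σ√p/√n.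
  set a := √(κ * σ ^ 2 / (n * q)) with ha
  have ha0 : 0 ≤ a := Real.sqrt_nonneg _
  have ha2 : a ^ 2 = κ * σ ^ 2 / (n * q) := Real.sq_sqrt (by positivity)
  have ha2n : a ^ 2 * n ≤ κ * σ ^ 2 := by
    rw [ha2, div_mul_eq_mul_div, div_le_iff₀ (by positivity)]
    have : 0 ≤ κ * σ ^ 2 * n := by positivity
    nlinarith
  set β : (Fin p → Bool) → EuclideanSpace ℝ (Fin p) := fun s => WithLp.toLp 2 (a • signVec s) with hβ
  have hβn : ∀ s, ‖β s‖ ^ 2 = a ^ 2 * p := by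
    intro s
    rw [EuclideanSpace.real_norm_sq_eq]
    simp [hβ, mul_pow, signVec_sq, mul_comm]
  have hmem0 : (0 : EuclideanSpace ℝ (Fin p)) ∈ paramClass n C c σ β₀ := by
    refine ⟨fun j => by simpa using hC.le, ?_⟩
    rw [norm_zero]
    have : 0 ≤ ‖β₀‖ := norm_nonneg _
    positivity
  have hmem : ∀ s, β s ∈ paramClass n C c σ β₀ := by
    intro s
    refine ⟨fun j => ?_, ?_⟩
    · refine abs_le_of_sq_le_sq ?_ hC.le
      have : (β s) j ^ 2 = a ^ 2 := by simp [hβ, mul_pow, signVec_sq]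
      rw [this]
      nlinarith
    · have h1 : ‖β s‖ ≤ σ * q / √(n : ℝ) := by
        refine le_of_sq_le_sq ?_ (by positivity)
        rw [hβn, div_pow, mul_pow, hqq, Real.sq_sqrt hn'.le, le_div_iff₀ hn']
        have : a ^ 2 * n ≤ σ ^ 2 := ha2n.trans (mul_le_of_le_one_left (sq_nonneg _) hκ1)
        nlinarith
      have h2 : 0 ≤ σ * q / √(n : ℝ) := by positivity
      have h3 : 0 ≤ ‖β₀‖ := norm_nonneg _
      nlinarith
  have key := ofReal_le_supRisk (ι := Fin p → Bool) hσ hmem0 hmem hβn hK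
    (Real.exp_pos (B ^ 2 / 2)).le (fun X hX => ?_) hT
  · refine le_trans (ENNReal.ofReal_le_ofReal (le_of_eq ?_)) key
    rw [norm_zero, ha2]
    have e : (0 ^ 2 - κ * σ ^ 2 / (n * q) * p) ^ 2 = κ ^ 2 * (σ ^ 4 * p / (n : ℝ) ^ 2) := by
      rw [← hqq]; field_simp; ring
    rw [e]
    ring
  · simp only [sub_zero, noiseShift_dotProduct]
    have hgram := norm_gram_le_of_mem_eventK hn hX hB
    have hstep : ∀ t : Fin p → Bool, ∑ s, Real.exp ((σ ^ 2)⁻¹ * inner ℝ (β s) (mulE (gram X) (β t)))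
        ≤ 2 ^ p * Real.exp (B ^ 2 / 2) := by
      intro t
      -- For fixed t the exponent is linear in the signs s, so the sum over s is a Rademacher moment
      -- generating function. The factor 1/√p in a² compensates the dimension: a⁴p = κ²σ⁴/n², whence
      -- ‖u‖² ≤ κ²B².
      set u : Fin p → ℝ := ((σ ^ 2)⁻¹ * a) • (mulE (gram X) (β t)).ofLp with hu
      have e1 : ∀ s, (σ ^ 2)⁻¹ * inner ℝ (β s) (mulE (gram X) (β t)) = signVec s ⬝ᵥ u := by
        intro s
        rw [inner_eq_dotProduct, hu, dotProduct_smul]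
        simp only [hβ, smul_dotProduct, smul_eq_mul]
        ring
      simp only [e1]
      refine (sum_exp_signVec_le u).trans ?_
      refine mul_le_mul_of_nonneg_left (Real.exp_le_exp.2 ?_) (by positivity)
      have e2 : u ⬝ᵥ u = ((σ ^ 2)⁻¹ * a) ^ 2 * ‖mulE (gram X) (β t)‖ ^ 2 := by
        rw [hu, smul_dotProduct, dotProduct_smul, ← inner_eq_dotProduct, real_inner_self_eq_norm_sq]
        simp only [smul_eq_mul]
        ring
      have h3 : ‖mulE (gram X) (β t)‖ ^ 2 ≤ (n * B) ^ 2 * (a ^ 2 * p) := by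
        rw [← hβn t, ← mul_pow]
        refine pow_le_pow_left₀ (norm_nonneg _) ?_ 2
        exact (norm_mulE_le _ _).trans (mul_le_mul_of_nonneg_right hgram (norm_nonneg _))
      have h4 : u ⬝ᵥ u ≤ κ ^ 2 * B ^ 2 := by
        rw [e2]
        refine (mul_le_mul_of_nonneg_left h3 (sq_nonneg _)).trans (le_of_eq ?_)
        have : ((σ ^ 2)⁻¹ * a) ^ 2 * ((n * B) ^ 2 * (a ^ 2 * p))
            = ((σ ^ 2)⁻¹) ^ 2 * (a ^ 2) ^ 2 * (n * B) ^ 2 * p := by ring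
        rw [this, ha2, ← hqq]
        field_simp
      have h5 : κ ^ 2 ≤ 1 := pow_le_one₀ hκ.le hκ1
      nlinarith [sq_nonneg B]
    rw [Finset.sum_comm]
    calc _ ≤ ∑ _t : Fin p → Bool, (2 : ℝ) ^ p * Real.exp (B ^ 2 / 2) :=
          Finset.sum_le_sum fun t _ => hstep t
      _ = _ := by
          rw [Finset.sum_const, Finset.card_univ, nsmul_eq_mul]
          simp only [Fintype.card_pi, Fintype.card_bool, Finset.prod_const, Finset.card_univ,
            Fintype.card_fin, Nat.cast_pow, Nat.cast_ofNat]
          ring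

/-- The lower bound of the rate for all estimators. -/
theorem ofReal_le_supRisk_rate (hn : 0 < n) (hp : 1 ≤ p) {τ : ℝ} {S : Matrix (Fin p) (Fin p) ℝ}
    {B : ℝ} (hB : upperLevel τ S ≤ B) (hK : 1 / 2 ≤ (designLaw n S).real (eventK n τ S))
    {σ C c κ : ℝ} (hσ : 0 < σ) (hC : 0 < C) (hc : 1 < c) (hκ : 0 < κ) (hκ1 : κ ≤ 1)
    (hκC : κ * σ ^ 2 ≤ C ^ 2 * n) {β₀ : EuclideanSpace ℝ (Fin p)} (hβ₀ : ∀ j, |β₀ j| ≤ C)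
    {T : Data n p → ℝ} (hT : Measurable T) :
    ENNReal.ofReal (min (1 / (4 * (1 + Real.exp B))) (κ ^ 2 / (4 * (1 + Real.exp (B ^ 2 / 2)))) / 2
      * rate n σ β₀) ≤ supRisk S σ (paramClass n C c σ β₀) T := by
  have hn' : (0 : ℝ) < n := by exact_mod_cast hn
  have hp' : (1 : ℝ) ≤ p := by exact_mod_cast hp
  set k₁ := 1 / (4 * (1 + Real.exp B)) with hk₁
  set k₂ := κ ^ 2 / (4 * (1 + Real.exp (B ^ 2 / 2))) with hk₂
  have hk0 : 0 ≤ min k₁ k₂ := le_min (by positivity) (by positivity)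
  set r₁ := σ ^ 2 * ‖β₀‖ ^ 2 / n with hr₁
  set r₂ := σ ^ 4 * p / (n : ℝ) ^ 2 with hr₂
  have hr₁0 : 0 ≤ r₁ := by positivity
  have hr₂0 : 0 ≤ r₂ := by positivity
  have hrate : rate n σ β₀ = r₁ + r₂ := rfl
  have h2 := ofReal_le_supRisk_signs hn hp hB hK hσ hC hc hκ hκ1 hκC β₀ hT
  -- The larger of the two terms is at least half the rate. If it is r₁, then n‖β₀‖² ≥ σ²p ≥ σ²,
  -- which is the condition of the scaling construction.
  by_cases hle : r₁ ≤ r₂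
  · refine le_trans (ENNReal.ofReal_le_ofReal ?_) h2
    rw [hrate]
    nlinarith [min_le_right k₁ k₂]
  · have hle' : σ ≤ √(n : ℝ) * ‖β₀‖ := by
      refine le_of_sq_le_sq ?_ (by positivity)
      rw [mul_pow, Real.sq_sqrt hn'.le]
      have h3 := (not_le.1 hle).le
      rw [hr₁, hr₂, div_le_div_iff₀ (by positivity) hn'] at h3
      have h4 : (σ ^ 2 * n) * (σ ^ 2 * p) ≤ (σ ^ 2 * n) * (n * ‖β₀‖ ^ 2) := by nlinarith
      have h5 := le_of_mul_le_mul_left h4 (by positivity)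
      nlinarith [sq_nonneg σ]
    refine le_trans (ENNReal.ofReal_le_ofReal ?_)
      (ofReal_le_supRisk_scaling hn hB hK hσ hc hβ₀ hle' hT)
    rw [hrate]
    nlinarith [min_le_left k₁ k₂, not_le.1 hle]

end LowerBounds

/-! ### Comparison of ζ² with the rate -/

section ZetaBounds

open scoped Matrix.Norms.L2Operator

variable {n p : ℕ}

theorem continuous_specNorm : Continuous (specNorm (m := p)) := by
  have h : Continuous (Matrix.toEuclideanCLM (n := Fin p) (𝕜 := ℝ)) :=
    (Matrix.toEuclideanCLM (n := Fin p) (𝕜 := ℝ)).toAlgEquiv.toLinearMap.continuous_of_finiteDimensional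
  exact h.norm

theorem measurable_specNorm_inv {A : Design n p → Matrix (Fin p) (Fin p) ℝ} (hA : Continuous A) :
    Measurable fun X => specNorm (A X)⁻¹ := by
  have e : ∀ X, specNorm (A X)⁻¹ = |(A X).det⁻¹| * specNorm (A X).adjugate := fun X => by
    rw [Matrix.inv_def, Ring.inverse_eq_inv, specNorm_eq_norm, specNorm_eq_norm, norm_smul,
      Real.norm_eq_abs]
  simp only [e]
  exact (hA.matrix_det.measurable.inv.abs).mul
    (continuous_specNorm.comp hA.matrix_adjugate).measurable

theorem measurableSet_eventK (τ : ℝ) (S : Matrix (Fin p) (Fin p) ℝ) :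
    MeasurableSet (eventK n τ S) := by
  have hc : Continuous fun X : Design n p => (n : ℝ)⁻¹ • gram X := by
    have := continuous_gram (n := n) (p := p)
    fun_prop
  refine MeasurableSet.inter (s₁ := {X | IsUnit ((n : ℝ)⁻¹ • gram X).det}) ?_
    (MeasurableSet.inter ?_ ?_)
  · simp only [isUnit_iff_ne_zero]
    exact (hc.matrix_det.measurable (measurableSet_singleton 0)).compl
  · exact measurableSet_lt (measurable_specNorm_inv hc) measurable_const
  · exact measurableSet_lt (continuous_specNorm.comp hc).measurable measurable_const

theorem isUnit_det_gram_of_mem_eventK {τ : ℝ} {S : Matrix (Fin p) (Fin p) ℝ} {X : Design n p}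
    (hX : X ∈ eventK n τ S) : IsUnit (gram X).det := by
  have h := hX.1
  rw [Matrix.det_smul] at h
  exact isUnit_of_mul_isUnit_right h

theorem norm_gram_inv_le_of_mem_eventK (hn : 0 < n) {τ : ℝ} {S : Matrix (Fin p) (Fin p) ℝ}
    {X : Design n p} (hX : X ∈ eventK n τ S) {Λ : ℝ} (hΛ : (lowerLevel τ S)⁻¹ ≤ Λ) :
    ‖(gram X)⁻¹‖ ≤ Λ / n := by
  have hn' : (0 : ℝ) < n := by exact_mod_cast hn
  have h := hX.2.1.le.trans hΛ
  have e : ((n : ℝ)⁻¹ • gram X)⁻¹ = (n : ℝ) • (gram X)⁻¹ := by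
    refine Matrix.inv_eq_left_inv ?_
    rw [Matrix.smul_mul, Matrix.mul_smul, smul_smul, mul_inv_cancel₀ hn'.ne', one_smul,
      Matrix.nonsing_inv_mul _ (isUnit_det_gram_of_mem_eventK hX)]
  rw [e, specNorm_eq_norm, norm_smul, RCLike.norm_natCast, mul_comm, ← le_div_iff₀ hn'] at h
  exact h

theorem lowerLevel_inv_le {τ : ℝ} {S : Matrix (Fin p) (Fin p) ℝ} {L : ℝ} (hL : specNorm S⁻¹ ≤ L) :
    (lowerLevel τ S)⁻¹ ≤ 4 * L / (1 - √τ) ^ 2 := by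
  rw [lowerLevel, inv_div]
  gcongr

/-- For the lower bound let u = (XᵀX)⁻¹β. Then βᵀu = ‖Xu‖², while β = Xᵀ(Xu) gives ‖β‖ ≤ ‖X‖ ‖Xu‖,
and ‖X‖² = ‖XᵀX‖. -/
theorem quadForm_inv_bounds {X : Design n p} (h : IsUnit (gram X).det) {U V : ℝ} (hU : 0 < U)
    (hgU : ‖gram X‖ ≤ U) (hgV : ‖(gram X)⁻¹‖ ≤ V) (β : EuclideanSpace ℝ (Fin p)) :
    ‖β‖ ^ 2 / U ≤ β.ofLp ⬝ᵥ ((gram X)⁻¹ *ᵥ β.ofLp) ∧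
      β.ofLp ⬝ᵥ ((gram X)⁻¹ *ᵥ β.ofLp) ≤ V * ‖β‖ ^ 2 := by
  rw [← inner_mulE]
  set u := mulE (gram X)⁻¹ β with hu
  have hβ : mulE (gram X) u = β := by
    rw [hu, ← mulE_mul, Matrix.mul_nonsing_inv _ h, mulE_one]
  constructor
  · have h1 : inner ℝ β u = ‖mulE (designMatrix X) u‖ ^ 2 := by
      rw [norm_mulE_sq, ← gram, hβ, real_inner_comm]
    have h2 : ‖β‖ ≤ ‖designMatrix X‖ * ‖mulE (designMatrix X) u‖ := by
      conv_lhs => rw [← hβ, gram, mulE_mul]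
      refine (norm_mulE_le _ _).trans (le_of_eq ?_)
      rw [norm_transpose]
    have h3 : ‖designMatrix X‖ ^ 2 ≤ U := by
      rw [pow_two, ← norm_transpose_mul_self]; exact hgU
    rw [h1, div_le_iff₀ hU]
    calc ‖β‖ ^ 2 ≤ (‖designMatrix X‖ * ‖mulE (designMatrix X) u‖) ^ 2 :=
          pow_le_pow_left₀ (norm_nonneg _) h2 2
      _ = ‖mulE (designMatrix X) u‖ ^ 2 * ‖designMatrix X‖ ^ 2 := by ring
      _ ≤ _ := mul_le_mul_of_nonneg_left h3 (sq_nonneg _)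
  · refine (real_inner_le_norm _ _).trans ?_
    have h4 : ‖u‖ ≤ V * ‖β‖ :=
      (norm_mulE_le _ _).trans (mul_le_mul_of_nonneg_right hgV (norm_nonneg _))
    nlinarith [norm_nonneg β]

/-- Each of the p columns of the inverse has norm between 1/U and V. -/
theorem frobSq_inv_bounds {X : Design n p} (h : IsUnit (gram X).det) {U V : ℝ} (hU : 0 < U)
    (hgU : ‖gram X‖ ≤ U) (hgV : ‖(gram X)⁻¹‖ ≤ V) :
    p / U ^ 2 ≤ frobSq (gram X)⁻¹ ∧ frobSq (gram X)⁻¹ ≤ p * V ^ 2 := by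
  have hone : ∀ j : Fin p, ‖EuclideanSpace.single j (1 : ℝ)‖ = 1 := fun j => by simp
  have hlow : ∀ j : Fin p, 1 / U ^ 2 ≤ ‖mulE (gram X)⁻¹ (EuclideanSpace.single j 1)‖ ^ 2 := by
    intro j
    have h1 : 1 ≤ U * ‖mulE (gram X)⁻¹ (EuclideanSpace.single j 1)‖ := by
      have : mulE (gram X) (mulE (gram X)⁻¹ (EuclideanSpace.single j 1))
          = EuclideanSpace.single j 1 := by
        rw [← mulE_mul, Matrix.mul_nonsing_inv _ h, mulE_one]
      calc (1 : ℝ) = ‖mulE (gram X) (mulE (gram X)⁻¹ (EuclideanSpace.single j 1))‖ := by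
            rw [this, hone]
        _ ≤ ‖gram X‖ * ‖mulE (gram X)⁻¹ (EuclideanSpace.single j 1)‖ := norm_mulE_le _ _
        _ ≤ _ := mul_le_mul_of_nonneg_right hgU (norm_nonneg _)
    rw [div_le_iff₀ (by positivity), ← mul_pow, mul_comm]
    exact one_le_pow₀ h1
  have hup : ∀ j : Fin p, ‖mulE (gram X)⁻¹ (EuclideanSpace.single j 1)‖ ^ 2 ≤ V ^ 2 := by
    intro j
    refine pow_le_pow_left₀ (norm_nonneg _) ?_ 2
    have := norm_mulE_le (gram X)⁻¹ (EuclideanSpace.single j 1)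
    rw [hone, mul_one] at this
    exact this.trans hgV
  rw [frobSq_eq_sum_col]
  constructor
  · calc p / U ^ 2 = ∑ _j : Fin p, 1 / U ^ 2 := by simp [div_eq_mul_inv]
      _ ≤ _ := Finset.sum_le_sum fun j _ => hlow j
  · calc _ ≤ ∑ _j : Fin p, V ^ 2 := Finset.sum_le_sum fun j _ => hup j
      _ = _ := by simp

theorem gram_inv_sq_trace (X : Design n p) : ((gram X)⁻¹ ^ 2).trace = frobSq (gram X)⁻¹ := by
  rw [frobSq_eq_trace, gram_inv_transpose, pow_two]

theorem setIntegral_bounds {E : Type*} [MeasurableSpace E] {μ : Measure E} [IsProbabilityMeasure μ]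
    {K : Set E} (hK : MeasurableSet K) (hP : 1 / 2 ≤ μ.real K) {f : E → ℝ} (hf : Measurable f)
    {l u : ℝ} (hl : 0 ≤ l) (h : ∀ x ∈ K, l ≤ f x ∧ f x ≤ u) :
    l / 2 ≤ ∫ x in K, f x ∂μ ∧ ∫ x in K, f x ∂μ ≤ u := by
  -- A point of K gives 0 ≤ l ≤ u, so that the bound u survives multiplication by a probability.
  have hne : K.Nonempty := by
    by_contra hne
    rw [Set.not_nonempty_iff_eq_empty] at hne
    rw [hne, measureReal_empty] at hP
    norm_num at hP
  obtain ⟨x, hx⟩ := hne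
  have hu : 0 ≤ u := hl.trans ((h x hx).1.trans (h x hx).2)
  have hb : ∀ x ∈ K, ‖f x‖ ≤ u := fun x hx => by
    rw [Real.norm_eq_abs, abs_of_nonneg (hl.trans (h x hx).1)]
    exact (h x hx).2
  have hint : IntegrableOn f K μ := Measure.integrableOn_of_bounded (measure_ne_top _ _)
    hf.aestronglyMeasurable (ae_restrict_of_forall_mem hK hb)
  constructor
  · refine le_trans ?_ (setIntegral_ge_of_const_le_real hK (measure_ne_top _ _)
      (fun x hx => (h x hx).1) hint)
    nlinarith
  · refine (le_abs_self _).trans ((norm_setIntegral_le_of_norm_le_const (measure_lt_top _ _) hb).trans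
      (mul_le_of_le_one_right hu measureReal_le_one))

/-- On K the first two integrands are comparable to ‖β₀‖²/n and p/n², and P(K) ≥ 1/2 transfers this
to the integrals. The third term is nonnegative, and p ≤ n together with n - p ≥ κn shows that it is
at most of the order of the second. -/
theorem zetaSq_bounds (hn : 0 < n) {τ : ℝ} {S : Matrix (Fin p) (Fin p) ℝ} {B Λ κ : ℝ}
    (hB0 : 0 < B) (hB : upperLevel τ S ≤ B) (hΛ0 : 0 ≤ Λ) (hΛ : (lowerLevel τ S)⁻¹ ≤ Λ)
    (hκ : 0 < κ) (hκn : κ * n ≤ (n : ℝ) - p - 3)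
    (hK : 1 / 2 ≤ (designLaw n S).real (eventK n τ S)) (σ : ℝ) (β₀ : EuclideanSpace ℝ (Fin p)) :
    min (2 / B) (1 / B ^ 2) * rate n σ β₀ ≤ zetaSq n τ S σ β₀ ∧
      zetaSq n τ S σ β₀ ≤ (4 * Λ + 2 * Λ ^ 2 + 2 * Λ ^ 2 / κ) * rate n σ β₀ := by
  have hn' : (0 : ℝ) < n := by exact_mod_cast hn
  have hKm := measurableSet_eventK (n := n) τ S
  have hκn0 : 0 < κ * n := by positivity
  have hpn : (p : ℝ) ≤ n := by linarith
  have hU : 0 < n * B := by positivity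
  have hgU : ∀ X ∈ eventK n τ S, ‖gram X‖ ≤ n * B := fun X hX => norm_gram_le_of_mem_eventK hn hX hB
  have hgV : ∀ X ∈ eventK n τ S, ‖(gram X)⁻¹‖ ≤ Λ / n := fun X hX =>
    norm_gram_inv_le_of_mem_eventK hn hX hΛ
  have hq := setIntegral_bounds (μ := designLaw n S) hKm hK
    (f := fun X => β₀.ofLp ⬝ᵥ ((gram X)⁻¹ *ᵥ β₀.ofLp))
    (by
      simp only [dotProduct, Matrix.mulVec]
      exact Finset.measurable_sum _ fun i _ => measurable_const.mul (Finset.measurable_sum _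
        fun j _ => (measurable_gram_inv_apply i j).mul_const _))
    (l := ‖β₀‖ ^ 2 / (n * B)) (u := Λ / n * ‖β₀‖ ^ 2) (by positivity)
    (fun X hX => quadForm_inv_bounds (isUnit_det_gram_of_mem_eventK hX) hU (hgU X hX) (hgV X hX) β₀)
  have hf := setIntegral_bounds (μ := designLaw n S) hKm hK
    (f := fun X => ((gram X)⁻¹ ^ 2).trace)
    (by
      simp only [gram_inv_sq_trace]
      exact Finset.measurable_sum _ fun i _ => Finset.measurable_sum _ fun j _ =>
        (measurable_gram_inv_apply i j).pow_const 2)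
    (l := p / (n * B) ^ 2) (u := p * (Λ / n) ^ 2) (by positivity)
    (fun X hX => by
      rw [gram_inv_sq_trace]
      exact frobSq_inv_bounds (isUnit_det_gram_of_mem_eventK hX) hU (hgU X hX) (hgV X hX))
  have ht : (∫ X in eventK n τ S, ((gram X)⁻¹).trace ∂(designLaw n S)) ^ 2 ≤ (p * (Λ / n)) ^ 2 := by
    have hb : ∀ X ∈ eventK n τ S, ‖((gram X)⁻¹).trace‖ ≤ p * (Λ / n) := by
      intro X hX
      rw [Real.norm_eq_abs]
      refine abs_le_of_sq_le_sq ?_ (by positivity)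
      have h1 := trace_sq_le_frobSq (gram X)⁻¹
      have h2 := (frobSq_inv_bounds (isUnit_det_gram_of_mem_eventK hX) hU (hgU X hX) (hgV X hX)).2
      have h3 := mul_le_mul_of_nonneg_left h2 (Nat.cast_nonneg (α := ℝ) p)
      refine (h1.trans h3).trans (le_of_eq ?_)
      ring
    have h4 : ‖∫ X in eventK n τ S, ((gram X)⁻¹).trace ∂(designLaw n S)‖ ≤ p * (Λ / n) :=
      (norm_setIntegral_le_of_norm_le_const (measure_lt_top _ _) hb).trans
        (mul_le_of_le_one_right (by positivity) measureReal_le_one)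
    rw [Real.norm_eq_abs] at h4
    rw [← sq_abs]
    exact pow_le_pow_left₀ (abs_nonneg _) h4 2
  set Q := ∫ X in eventK n τ S, β₀.ofLp ⬝ᵥ ((gram X)⁻¹ *ᵥ β₀.ofLp) ∂(designLaw n S) with hQ
  set F := ∫ X in eventK n τ S, ((gram X)⁻¹ ^ 2).trace ∂(designLaw n S) with hF
  set W := (∫ X in eventK n τ S, ((gram X)⁻¹).trace ∂(designLaw n S)) ^ 2 with hW
  have hW0 : 0 ≤ W := sq_nonneg _
  have hz : zetaSq n τ S σ β₀ = 4 * σ ^ 2 * Q + 2 * σ ^ 4 * F + 2 * σ ^ 4 * W / ((n : ℝ) - p) := rfl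
  have hnp : 0 < (n : ℝ) - p := by linarith
  rw [hz]
  have hr : rate n σ β₀ = σ ^ 2 * ‖β₀‖ ^ 2 / n + σ ^ 4 * p / (n : ℝ) ^ 2 := rfl
  have hr1 : 0 ≤ σ ^ 2 * ‖β₀‖ ^ 2 / n := by positivity
  have hr2 : 0 ≤ σ ^ 4 * p / (n : ℝ) ^ 2 := by positivity
  constructor
  · have h1 : 4 * σ ^ 2 * (‖β₀‖ ^ 2 / (n * B) / 2) ≤ 4 * σ ^ 2 * Q :=
      mul_le_mul_of_nonneg_left hq.1 (by positivity)
    have h2 : 2 * σ ^ 4 * (p / (n * B) ^ 2 / 2) ≤ 2 * σ ^ 4 * F :=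
      mul_le_mul_of_nonneg_left hf.1 (by positivity)
    have h3 : 0 ≤ 2 * σ ^ 4 * W / ((n : ℝ) - p) := by positivity
    have e1 : 4 * σ ^ 2 * (‖β₀‖ ^ 2 / (n * B) / 2) = 2 / B * (σ ^ 2 * ‖β₀‖ ^ 2 / n) := by
      field_simp; ring
    have e2 : 2 * σ ^ 4 * (p / (n * B) ^ 2 / 2) = 1 / B ^ 2 * (σ ^ 4 * p / (n : ℝ) ^ 2) := by
      field_simp
    have h4 := mul_le_mul_of_nonneg_right (min_le_left (2 / B) (1 / B ^ 2)) hr1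
    have h5 := mul_le_mul_of_nonneg_right (min_le_right (2 / B) (1 / B ^ 2)) hr2
    rw [hr, mul_add]
    linarith
  · have h1 : 4 * σ ^ 2 * Q ≤ 4 * σ ^ 2 * (Λ / n * ‖β₀‖ ^ 2) :=
      mul_le_mul_of_nonneg_left hq.2 (by positivity)
    have h2 : 2 * σ ^ 4 * F ≤ 2 * σ ^ 4 * (p * (Λ / n) ^ 2) :=
      mul_le_mul_of_nonneg_left hf.2 (by positivity)
    have h3 : 2 * σ ^ 4 * W / ((n : ℝ) - p) ≤ 2 * σ ^ 4 * (p * n * (Λ / n) ^ 2) / (κ * n) := by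
      refine div_le_div₀ (by positivity) ?_ hκn0 (by linarith)
      refine mul_le_mul_of_nonneg_left (ht.trans ?_) (by positivity)
      rw [mul_pow, pow_two (p : ℝ)]
      gcongr
    have e1 : 4 * σ ^ 2 * (Λ / n * ‖β₀‖ ^ 2) = 4 * Λ * (σ ^ 2 * ‖β₀‖ ^ 2 / n) := by ring
    have e2 : 2 * σ ^ 4 * (p * (Λ / n) ^ 2) = 2 * Λ ^ 2 * (σ ^ 4 * p / (n : ℝ) ^ 2) := by ring
    have e3 : 2 * σ ^ 4 * (p * n * (Λ / n) ^ 2) / (κ * n)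
        = 2 * Λ ^ 2 / κ * (σ ^ 4 * p / (n : ℝ) ^ 2) := by field_simp
    have h4 : 0 ≤ 2 * Λ ^ 2 / κ := by positivity
    rw [hr]
    have h5 : 0 ≤ (2 * Λ ^ 2 + 2 * Λ ^ 2 / κ) * (σ ^ 2 * ‖β₀‖ ^ 2 / n) := by positivity
    have h6 : 0 ≤ 4 * Λ * (σ ^ 4 * p / (n : ℝ) ^ 2) := by positivity
    nlinarith

end ZetaBounds

/-! ### Conclusion -/

theorem hasExactOrder_of_bounds {R : ℕ → ℝ≥0∞} {r z : ℕ → ℝ} {k₁ k₂ k₃ k₄ : ℝ} (hk₁ : 0 < k₁)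
    (hk₂ : 0 < k₂) (hk₃ : 0 < k₃) (hk₄ : 0 < k₄)
    (h : ∀ᶠ n in atTop, (ENNReal.ofReal (k₁ * r n) ≤ R n ∧ R n ≤ ENNReal.ofReal (k₂ * r n)) ∧
      k₃ * r n ≤ z n ∧ z n ≤ k₄ * r n) : HasExactOrder R z := by
  refine ⟨k₁ / k₄, k₂ / k₃, by positivity, by positivity, ?_⟩
  filter_upwards [h] with n hn
  obtain ⟨⟨h1, h2⟩, h3, h4⟩ := hn
  refine ⟨(ENNReal.ofReal_le_ofReal ?_).trans h1, h2.trans (ENNReal.ofReal_le_ofReal ?_)⟩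
  · rw [div_mul_eq_mul_div, div_le_iff₀ hk₄]
    nlinarith
  · rw [div_mul_eq_mul_div, le_div_iff₀ hk₃]
    nlinarith

end QuadReg

theorem theorem2
    (p : ℕ → ℕ) (hp : ∀ n, 1 ≤ p n)
    (τ : ℝ) (hτ₀ : 0 ≤ τ) (hτ₁ : τ < 1)
    (hpn : Tendsto (fun n => (p n : ℝ) / (n : ℝ)) atTop (𝓝 τ))
    (S : ∀ n, Matrix (Fin (p n)) (Fin (p n)) ℝ)
    (hS : QuadReg.EigenvaluesBounded p S)
    (σ : ℕ → ℝ) (hσ : ∀ n, 0 < σ n)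
    (hσO : (fun n => σ n ^ 2) =O[atTop] (fun n => (n : ℝ)))
    (β₀ : ∀ n, EuclideanSpace ℝ (Fin (p n)))
    (C : ℝ) (hC : 0 < C) (hβ₀ : ∀ n j, |β₀ n j| ≤ C)
    (c : ℝ) (hc : 1 < c) :
    QuadReg.HasExactOrder
        (fun n => QuadReg.minimaxRisk n (S n) (σ n)
          (QuadReg.paramClass n C c (σ n) (β₀ n)))
        (fun n => QuadReg.zetaSq n τ (S n) (σ n) (β₀ n)) ∧
      QuadReg.HasExactOrder
        (fun n => QuadReg.supRisk (S n) (σ n)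
          (QuadReg.paramClass n C c (σ n) (β₀ n)) (QuadReg.biasCorrected (n := n)))
        (fun n => QuadReg.zetaSq n τ (S n) (σ n) (β₀ n)) := by
  obtain ⟨a, b, ha, hab⟩ := hS
  have hspec : ∀ n, (S n).PosDef ∧ QuadReg.specNorm (S n) ≤ |b| ∧
      QuadReg.specNorm (S n)⁻¹ ≤ a⁻¹ := fun n => by
    obtain ⟨h, hi⟩ := hab n
    exact QuadReg.spectral_bounds h ha hi
  obtain ⟨D, hD0, hD⟩ := hσO.exists_pos
  -- The 16 bounds 4(1 + √τ)², and the added 1 makes B positive without discussing the sign of b.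
  set B := 16 * (|b| + 1) with hB
  have hB0 : 0 < B := by positivity
  have hBn : ∀ n, QuadReg.upperLevel τ (S n) ≤ B := fun n =>
    QuadReg.upperLevel_le hτ₁ ((hspec n).2.1.trans (by linarith))
  have ht1 : √τ < 1 := by rw [Real.sqrt_lt' one_pos]; simpa using hτ₁
  set Λ := 4 * a⁻¹ / (1 - √τ) ^ 2 with hΛ
  have hΛ0 : 0 < Λ := by
    have : 0 < 1 - √τ := by linarith
    positivity
  have hΛn : ∀ n, (QuadReg.lowerLevel τ (S n))⁻¹ ≤ Λ := fun n =>
    QuadReg.lowerLevel_inv_le (hspec n).2.2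
  set κ := (1 - τ) / 2 with hκ
  have hκ0 : 0 < κ := by rw [hκ]; linarith
  -- With D the constant in σ² = O(n), this gives ρσ² ≤ C²n for large n, which lets the sign vectors
  -- of order σ/√n satisfy the bound C on their entries.
  set ρ := min 1 (C ^ 2 / D) with hρ
  have hρ0 : 0 < ρ := lt_min one_pos (by positivity)
  set k₁ := min (1 / (4 * (1 + Real.exp B))) (ρ ^ 2 / (4 * (1 + Real.exp (B ^ 2 / 2)))) / 2 with hk₁
  have hk₁0 : 0 < k₁ := half_pos (lt_min (by positivity) (by positivity))
  set k₂ := 16 * c ^ 2 * a⁻¹ / κ + 8 * (1 + 1 / κ) * a⁻¹ ^ 2 * (1 / κ ^ 2 + 1 / κ ^ 3) with hk₂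
  have hk₂0 : 0 < k₂ := by positivity
  have hk₃0 : 0 < min (2 / B) (1 / B ^ 2) := lt_min (by positivity) (by positivity)
  have hk₄0 : 0 < 4 * Λ + 2 * Λ ^ 2 + 2 * Λ ^ 2 / κ := by positivity
  have hmain : ∀ᶠ n in atTop,
      (ENNReal.ofReal (k₁ * QuadReg.rate n (σ n) (β₀ n)) ≤ QuadReg.minimaxRisk n (S n) (σ n)
          (QuadReg.paramClass n C c (σ n) (β₀ n)) ∧
        QuadReg.supRisk (S n) (σ n) (QuadReg.paramClass n C c (σ n) (β₀ n))
          (QuadReg.biasCorrected (n := n)) ≤ ENNReal.ofReal (k₂ * QuadReg.rate n (σ n) (β₀ n))) ∧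
      min (2 / B) (1 / B ^ 2) * QuadReg.rate n (σ n) (β₀ n)
          ≤ QuadReg.zetaSq n τ (S n) (σ n) (β₀ n) ∧
        QuadReg.zetaSq n τ (S n) (σ n) (β₀ n)
          ≤ (4 * Λ + 2 * Λ ^ 2 + 2 * Λ ^ 2 / κ) * QuadReg.rate n (σ n) (β₀ n) := by
    filter_upwards [eventually_gt_atTop 0, QuadReg.eventually_mul_le_sub hτ₁ hpn,
      QuadReg.eventually_half_le_eventK hτ₁ hp hpn fun n => (hspec n).1, hD.bound]
      with n hn hκn hK hσn
    rw [Real.norm_eq_abs, abs_of_nonneg (sq_nonneg _), RCLike.norm_natCast] at hσn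
    have hρC : ρ * σ n ^ 2 ≤ C ^ 2 * n := by
      calc ρ * σ n ^ 2 ≤ C ^ 2 / D * (D * n) :=
            mul_le_mul (min_le_right _ _) hσn (sq_nonneg _) (by positivity)
        _ = _ := by field_simp
    refine ⟨⟨?_, QuadReg.supRisk_biasCorrected_le (hspec n).1 (hspec n).2.2 hκ0 hn hκn _ _ _ _⟩,
      QuadReg.zetaSq_bounds hn hB0 (hBn n) hΛ0.le (hΛn n) hκ0 hκn hK _ _⟩
    exact le_iInf₂ fun T hT => QuadReg.ofReal_le_supRisk_rate hn (hp n) (hBn n) hK (hσ n) hC hc hρ0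
      (min_le_left _ _) hρC (hβ₀ n) hT
  have hmm : ∀ n, QuadReg.minimaxRisk n (S n) (σ n) (QuadReg.paramClass n C c (σ n) (β₀ n))
      ≤ QuadReg.supRisk (S n) (σ n) (QuadReg.paramClass n C c (σ n) (β₀ n))
          (QuadReg.biasCorrected (n := n)) := fun n =>
    iInf₂_le _ QuadReg.measurable_biasCorrected
  -- The lower bound holds for every estimator and the upper bound for the bias-corrected one. As
  -- the minimax risk is at most the latter's largest risk, the same two bounds sandwich both
  -- quantities.
  exact ⟨QuadReg.hasExactOrder_of_bounds hk₁0 hk₂0 hk₃0 hk₄0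
      (hmain.mono fun n h => ⟨⟨h.1.1, (hmm n).trans h.1.2⟩, h.2⟩),
    QuadReg.hasExactOrder_of_bounds hk₁0 hk₂0 hk₃0 hk₄0
      (hmain.mono fun n h => ⟨⟨h.1.1.trans (hmm n), h.1.2⟩, h.2⟩)⟩
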